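/- Let $\mathcal{E}_{ED}$ be the equation $(x+y)(u_{xx}+u_{yy})+u_x+u_y=0$ for a function $u(x,y)$. On its infinite prolongation $\mathcal{E}_{ED}^{\infty}$ use the internal coordinates $x,\ y,\ u_{ky},\ u_{x,ky}$ ($k\ge 0$), where $u_{ky}=\partial_y^k u$ and $u_{x,ky}=\partial_x\partial_y^k u$, and let $\mathcal{R}$ be the field of real rational functions of finitely many of these coordinates. Let $\bar D_x,\bar D_y$ be the total derivatives restricted to $\mathcal{E}_{ED}^{\infty}$ (so that $\bar D_x u_{x,ky}=\bar D_y^k\bigl(-\tfrac{u_x+u_y}{x+y}-u_{yy}\bigr)$). The rational higher symmetries of $\mathcal{E}_{ED}$ are the $\varphi\in\mathcal{R}$ with $$(x+y)(\bar D_x^2\varphi+\bar D_y^2\varphi)+\bar D_x\varphi+\bar D_y\varphi=0 ;$$ they form a real Lie algebra $\operatorname{Sym}_{\mathcal R}(\mathcal{E}_{ED})$ under the Jacobi bracket $\{\varphi,\psi\}=X_\varphi(\psi)-X_\psi(\varphi)$, where $X_\varphi=\sum_{k}\bar D_y^k(\varphi)\,\partial_{u_{ky}}+\sum_k \bar D_y^k\bar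 D_x(\varphi)\,\partial_{u_{x,ky}}$. Then the rational solutions $\varphi=\varphi(x,y)\in\mathbb{R}(x,y)$ of $\mathcal{E}_{ED}$ form an ideal $A$ of $\operatorname{Sym}_{\mathcal R}(\mathcal{E}_{ED})$, and the quotient Lie algebra $\operatorname{NSym}(\mathcal{E}_{ED})=\operatorname{Sym}_{\mathcal R}(\mathcal{E}_{ED})/A$ is infinite dimensional as a vector space and finitely generated as a Lie algebra. More precisely, let $$\varrho_0=-u_x+u_y,$$ $$\varrho_1=\tfrac12(x^2-2xy-y^2)u_x+\tfrac12(x^2+2xy-y^2)u_y+\tfrac12(x-y)u,$$ $$\varrho_2=(x+y)u_{yy}+(x-y)u_{xy}+\frac{1}{2(x+y)}\bigl((x-y)u_x+(3x+y)u_y\bigr),$$ which are rational higher symmetries, and for $j\ge1$, $m\ge0$ let $$\varrho_j^m=\{\ldots\{\{\ldots\{\varrho_0,\underbrace{\varrho_2\},\ldots,\varrho_2}_{j-1}\},\underbrace{\varrho_1\},\ldots,\varrho_1}_{m}\}.$$ Then $\varrho_j^m=0$ for $m>2j$, and the classes of $u$ and of the $\varrho_j^m$ with $j\ge 1$ and $0\le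 m\le 2j$ form a linear basis of $\operatorname{NSym}(\mathcal{E}_{ED})$. -/

import Mathlib

namespace EulerDarboux

/-- Internal coordinates on the infinite prolongation of the elliptic Euler-Darboux equation
`(x + y) (u_xx + u_yy) + u_x + u_y = 0`: the base coordinates `x`, `y` and the jet coordinates
`u k = u_{ky}` and `ux k = u_{x,ky}` (`k` derivatives with respect to `y`). -/
inductive Coord : Type
  | x : Coord
  | y : Coord
  | u : ℕ → Coord
  | ux : ℕ → Coord

/-- Real rational functions of finitely many internal coordinates. -/
abbrev RatFun : Type := FractionRing (MvPolynomial Coord ℝ)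

noncomputable section

/-- A coordinate, as a rational function. -/
def coord (c : Coord) : RatFun := algebraMap (MvPolynomial Coord ℝ) RatFun (MvPolynomial.X c)

/-- The polynomials, mapped to dual numbers by `p ↦ p + ε D p`, where `D` is the derivation
with prescribed values `f` on the coordinates. -/
def dualHom (f : Coord → RatFun) :
    MvPolynomial Coord ℝ →ₐ[ℝ] TrivSqZeroExt RatFun RatFun :=
  MvPolynomial.aeval fun c => TrivSqZeroExt.inl (coord c) + TrivSqZeroExt.inr (f c)

theorem fst_dualHom (f : Coord → RatFun) (p : MvPolynomial Coord ℝ) :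
    (dualHom f p).fst = algebraMap _ RatFun p := by
  have h : (TrivSqZeroExt.fstHom ℝ RatFun RatFun).comp (dualHom f)
      = IsScalarTower.toAlgHom ℝ (MvPolynomial Coord ℝ) RatFun := by
    apply MvPolynomial.algHom_ext
    intro c
    simp [dualHom, coord]
  exact DFunLike.congr_fun h p

theorem isUnit_dualHom (f : Coord → RatFun) (p : nonZeroDivisors (MvPolynomial Coord ℝ)) :
    IsUnit (dualHom f p) := by
  rw [TrivSqZeroExt.isUnit_iff_isUnit_fst, fst_dualHom]
  exact IsLocalization.map_units _ p

/-- Extension of `dualHom` to rational functions. -/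
def dualLift (f : Coord → RatFun) : RatFun →ₐ[ℝ] TrivSqZeroExt RatFun RatFun :=
  IsLocalization.liftAlgHom (M := nonZeroDivisors (MvPolynomial Coord ℝ)) (f := dualHom f)
    (isUnit_dualHom f)

theorem dualLift_algebraMap (f : Coord → RatFun) (p : MvPolynomial Coord ℝ) :
    dualLift f (algebraMap _ RatFun p) = dualHom f p := by
  simp [dualLift]

theorem fst_dualLift (f : Coord → RatFun) (q : RatFun) : (dualLift f q).fst = q := by
  have h : ((TrivSqZeroExt.fstHom ℝ RatFun RatFun).comp (dualLift f)).toRingHom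
      = RingHom.id RatFun := by
    apply IsLocalization.ringHom_ext (nonZeroDivisors (MvPolynomial Coord ℝ))
    apply RingHom.ext
    intro p
    simp [dualLift_algebraMap, fst_dualHom]
  exact DFunLike.congr_fun h q

/-- The derivation (vector field) on rational functions whose components with respect to the
coordinates are `f`, that is, the sum of `f c * ∂/∂c` over all coordinates `c`. -/
def vectorField (f : Coord → RatFun) : Derivation ℝ RatFun RatFun :=
  Derivation.mk' ((TrivSqZeroExt.sndHom RatFun RatFun).restrictScalars ℝ ∘ₗ
    (dualLift f).toLinearMap) (by
      intro a b
      simp [fst_dualLift, mul_comm])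

theorem vectorField_coord (f : Coord → RatFun) (c : Coord) :
    vectorField f (coord c) = f c := by
  change (dualLift f (coord c)).snd = f c
  rw [coord, dualLift_algebraMap]
  simp [dualHom]

/-- A derivation is determined by its components. -/
theorem derivation_ext {D E : Derivation ℝ RatFun RatFun}
    (h : ∀ c, D (coord c) = E (coord c)) : D = E := by
  have hp : ∀ p : MvPolynomial Coord ℝ,
      D (algebraMap _ RatFun p) = E (algebraMap _ RatFun p) := by
    intro p
    have := MvPolynomial.derivation_ext
      (D₁ := D.compAlgebraMap (MvPolynomial Coord ℝ))
      (D₂ := E.compAlgebraMap (MvPolynomial Coord ℝ)) (fun c => h c)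
    exact DFunLike.congr_fun this p
  ext q
  obtain ⟨a, b, -, rfl⟩ := IsFractionRing.div_surjective (A := MvPolynomial Coord ℝ) q
  rw [Derivation.leibniz_div, Derivation.leibniz_div, hp, hp]

/-- The total derivative with respect to `y`, restricted to the prolonged equation. -/
def Dy : Derivation ℝ RatFun RatFun := vectorField fun
  | .x => 0
  | .y => 1
  | .u k => coord (.u (k + 1))
  | .ux k => coord (.ux (k + 1))

/-- The restriction of the jet coordinate `u_{xx,ky}` to the prolonged equation: for `k = 0` the
equation itself is solved for `u_xx`; for `k > 0` the result is differentiated `k` times. -/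
def uxx (k : ℕ) : RatFun :=
  Dy^[k] (-(coord (.ux 0) + coord (.u 1)) / (coord .x + coord .y) - coord (.u 2))

/-- The total derivative with respect to `x`, restricted to the prolonged equation. -/
def Dx : Derivation ℝ RatFun RatFun := vectorField fun
  | .x => 1
  | .y => 0
  | .u k => coord (.ux k)
  | .ux k => uxx k

/-- The universal linearization `(x + y) (Dx² + Dy²) + Dx + Dy` of the equation. -/
def linearization : RatFun →ₗ[ℝ] RatFun :=
  LinearMap.mulLeft ℝ (coord .x + coord .y) ∘ₗ
    (Dx.toLinearMap ∘ₗ Dx.toLinearMap + Dy.toLinearMap ∘ₗ Dy.toLinearMap)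
    + Dx.toLinearMap + Dy.toLinearMap

/-- The space of (generating functions of) rational higher symmetries. -/
def Sym : Submodule ℝ RatFun := LinearMap.ker linearization

/-- The evolutionary field with generating function `φ`, restricted to the prolonged equation:
the sum of `D_σ(φ) ∂/∂u_σ` over the internal jet coordinates `u_σ`. -/
def evol (φ : RatFun) : Derivation ℝ RatFun RatFun := vectorField fun
  | .x => 0
  | .y => 0
  | .u k => Dy^[k] φ
  | .ux k => Dy^[k] (Dx φ)

/-- The Jacobi bracket. -/
def jacobi (φ ψ : RatFun) : RatFun := evol φ ψ - evol ψ φ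

/-! ### The Jacobi bracket makes the rational higher symmetries a Lie algebra -/

theorem linearization_apply (φ : RatFun) : linearization φ =
    (coord .x + coord .y) * (Dx (Dx φ) + Dy (Dy φ)) + Dx φ + Dy φ := rfl

theorem mem_Sym {φ : RatFun} : φ ∈ Sym ↔
    (coord .x + coord .y) * (Dx (Dx φ) + Dy (Dy φ)) + Dx φ + Dy φ = 0 := Iff.rfl

theorem Dy_x : Dy (coord .x) = 0 := vectorField_coord _ _
theorem Dy_y : Dy (coord .y) = 1 := vectorField_coord _ _
theorem Dy_u (k : ℕ) : Dy (coord (.u k)) = coord (.u (k + 1)) := vectorField_coord _ _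
theorem Dy_ux (k : ℕ) : Dy (coord (.ux k)) = coord (.ux (k + 1)) := vectorField_coord _ _
theorem Dx_x : Dx (coord .x) = 1 := vectorField_coord _ _
theorem Dx_y : Dx (coord .y) = 0 := vectorField_coord _ _
theorem Dx_u (k : ℕ) : Dx (coord (.u k)) = coord (.ux k) := vectorField_coord _ _
theorem Dx_ux (k : ℕ) : Dx (coord (.ux k)) = uxx k := vectorField_coord _ _
theorem evol_x (φ : RatFun) : evol φ (coord .x) = 0 := vectorField_coord _ _
theorem evol_y (φ : RatFun) : evol φ (coord .y) = 0 := vectorField_coord _ _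
theorem evol_u (φ : RatFun) (k : ℕ) : evol φ (coord (.u k)) = Dy^[k] φ :=
  vectorField_coord _ _
theorem evol_ux (φ : RatFun) (k : ℕ) : evol φ (coord (.ux k)) = Dy^[k] (Dx φ) :=
  vectorField_coord _ _

theorem x_add_y_ne_zero : coord .x + coord .y ≠ 0 := by
  intro h
  rw [coord, coord, ← map_add] at h
  have h0 := (IsFractionRing.injective (MvPolynomial Coord ℝ) RatFun) (h.trans (map_zero _).symm)
  have := congrArg (MvPolynomial.eval fun _ => (1 : ℝ)) h0
  norm_num at this

theorem uxx_succ (k : ℕ) : uxx (k + 1) = Dy (uxx k) := Function.iterate_succ_apply' _ _ _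

/-- Derivations whose commutator vanishes on all coordinates commute. -/
theorem commute_of_coord {D E : Derivation ℝ RatFun RatFun}
    (h : ∀ c, D (E (coord c)) = E (D (coord c))) (q : RatFun) : D (E q) = E (D q) := by
  have h0 : ⁅D, E⁆ = 0 := by
    apply derivation_ext
    intro c
    simp [Derivation.commutator_apply, h c]
  have := DFunLike.congr_fun h0 q
  rw [Derivation.commutator_apply] at this
  exact sub_eq_zero.mp this

theorem iterate_comm {D E : Derivation ℝ RatFun RatFun} (h : ∀ q, D (E q) = E (D q))
    (k : ℕ) (q : RatFun) : D (E^[k] q) = E^[k] (D q) := by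
  induction k with
  | zero => rfl
  | succ k ih => rw [Function.iterate_succ_apply', Function.iterate_succ_apply', h, ih]

theorem Dx_Dy (q : RatFun) : Dx (Dy q) = Dy (Dx q) := by
  apply commute_of_coord
  rintro (_ | _ | k | k)
  · rw [Dy_x, Dx_x]; simp
  · rw [Dy_y, Dx_y]; simp
  · rw [Dy_u, Dx_u, Dx_u, Dy_ux]
  · rw [Dy_ux, Dx_ux, Dx_ux, uxx_succ]

theorem evol_Dy (φ q : RatFun) : evol φ (Dy q) = Dy (evol φ q) := by
  apply commute_of_coord
  rintro (_ | _ | k | k)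
  · rw [Dy_x, evol_x]; simp
  · rw [Dy_y, evol_y]; simp
  · rw [Dy_u, evol_u, evol_u, Function.iterate_succ_apply']
  · rw [Dy_ux, evol_ux, evol_ux, Function.iterate_succ_apply']

theorem Dx_Dx_of_mem {φ : RatFun} (hφ : φ ∈ Sym) :
    Dx (Dx φ) = -(Dx φ + Dy φ) / (coord .x + coord .y) - Dy (Dy φ) := by
  have h := mem_Sym.mp hφ
  have h0 := x_add_y_ne_zero
  field_simp
  linear_combination h

theorem evol_Dx {φ : RatFun} (hφ : φ ∈ Sym) (q : RatFun) :
    evol φ (Dx q) = Dx (evol φ q) := by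
  apply commute_of_coord
  rintro (_ | _ | k | k)
  · rw [Dx_x, evol_x]; simp
  · rw [Dx_y, evol_y]; simp
  · rw [Dx_u, evol_u, evol_ux, iterate_comm Dx_Dy]
  · rw [Dx_ux, evol_ux, uxx, iterate_comm (evol_Dy φ), iterate_comm Dx_Dy, Dx_Dx_of_mem hφ]
    congr 1
    have h0 := x_add_y_ne_zero
    rw [map_sub, Derivation.leibniz_div, map_add, map_neg, map_add, evol_x, evol_y, evol_u,
      evol_u, evol_ux]
    simp only [smul_eq_mul, Function.iterate_succ_apply, Function.iterate_zero_apply]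
    field_simp
    ring

theorem evol_mem {φ ψ : RatFun} (hφ : φ ∈ Sym) (hψ : ψ ∈ Sym) : evol φ ψ ∈ Sym := by
  rw [mem_Sym] at hψ ⊢
  have h := congrArg (evol φ) hψ
  simp only [map_add, Derivation.leibniz, smul_eq_mul, evol_x, evol_y, evol_Dx hφ, evol_Dy,
    map_zero, mul_zero, add_zero] at h
  exact h

theorem jacobi_mem {φ ψ : RatFun} (hφ : φ ∈ Sym) (hψ : ψ ∈ Sym) : jacobi φ ψ ∈ Sym :=
  Sym.sub_mem (evol_mem hφ hψ) (evol_mem hψ hφ)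

theorem evol_add (φ ψ : RatFun) : evol (φ + ψ) = evol φ + evol ψ := by
  apply derivation_ext
  have hk : ∀ (k : ℕ) (a b : RatFun), Dy^[k] (a + b) = Dy^[k] a + Dy^[k] b := fun k a b =>
    iterate_map_add Dy k a b
  rintro (_ | _ | k | k) <;>
    simp [evol_x, evol_y, evol_u, evol_ux, hk]

theorem evol_smul (r : ℝ) (φ : RatFun) : evol (r • φ) = r • evol φ := by
  apply derivation_ext
  have hk : ∀ (k : ℕ) (a : RatFun), Dy^[k] (r • a) = r • Dy^[k] a := by
    intro k a
    induction k with
    | zero => rfl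
    | succ k ih => rw [Function.iterate_succ_apply', Function.iterate_succ_apply', ih,
      Derivation.map_smul]
  rintro (_ | _ | k | k) <;>
    simp [evol_x, evol_y, evol_u, evol_ux, hk]

/-- The commutator of evolutionary fields of symmetries corresponds to the Jacobi bracket. -/
theorem evol_jacobi {φ ψ : RatFun} (hφ : φ ∈ Sym) (hψ : ψ ∈ Sym) :
    evol (jacobi φ ψ) = ⁅evol φ, evol ψ⁆ := by
  apply derivation_ext
  have hy : ∀ k : ℕ, ∀ q, Dy^[k] (evol φ q) = evol φ (Dy^[k] q) := fun k q =>
    (iterate_comm (evol_Dy φ) k q).symm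
  have hy' : ∀ k : ℕ, ∀ q, Dy^[k] (evol ψ q) = evol ψ (Dy^[k] q) := fun k q =>
    (iterate_comm (evol_Dy ψ) k q).symm
  have hs : ∀ (k : ℕ) (a b : RatFun), Dy^[k] (a - b) = Dy^[k] a - Dy^[k] b := fun k a b =>
    iterate_map_sub Dy k a b
  rintro (_ | _ | k | k)
  · simp [Derivation.commutator_apply, evol_x]
  · simp [Derivation.commutator_apply, evol_y]
  · simp only [Derivation.commutator_apply, evol_u, jacobi, hs, hy, hy']
  · simp only [Derivation.commutator_apply, evol_ux, jacobi, hs, hy, hy', map_sub,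
      ← evol_Dx hφ, ← evol_Dx hψ]

instance : LieRing Sym where
  bracket φ ψ := ⟨jacobi φ ψ, jacobi_mem φ.2 ψ.2⟩
  add_lie φ ψ χ := by
    ext1
    change jacobi (φ + ψ) χ = jacobi φ χ + jacobi ψ χ
    simp only [jacobi, evol_add, Derivation.add_apply, map_add]
    ring
  lie_add φ ψ χ := by
    ext1
    change jacobi φ (ψ + χ) = jacobi φ ψ + jacobi φ χ
    simp only [jacobi, evol_add, Derivation.add_apply, map_add]
    ring
  lie_self φ := by
    ext1
    exact sub_self _
  leibniz_lie φ ψ χ := by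
    ext1
    change jacobi φ (jacobi ψ χ) = jacobi (jacobi φ ψ) χ + jacobi ψ (jacobi φ χ)
    have h (α β : RatFun) : jacobi α β = evol α β - evol β α := rfl
    rw [h φ (jacobi ψ χ), h (jacobi φ ψ) χ, h ψ (jacobi φ χ), evol_jacobi ψ.2 χ.2,
      evol_jacobi φ.2 ψ.2, evol_jacobi φ.2 χ.2]
    simp only [jacobi, Derivation.commutator_apply, map_sub]
    ring

instance : LieAlgebra ℝ Sym where
  lie_smul r φ ψ := by
    ext1
    change jacobi φ (r • ψ) = r • jacobi φ ψ
    simp only [jacobi, evol_smul, Derivation.smul_apply, Derivation.map_smul, smul_sub]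

theorem coe_lie (φ ψ : Sym) : ((⁅φ, ψ⁆ : Sym) : RatFun) = jacobi φ ψ := rfl

/-! ### The algebra of rational higher symmetries up to solutions -/

/-- The rational solutions of the equation: those generating functions of symmetries that are
rational functions of the base coordinates `x`, `y` only (on such functions the linearization is
the equation itself). -/
def solutions : Submodule ℝ Sym :=
  (Subalgebra.toSubmodule
    (IntermediateField.adjoin ℝ {coord .x, coord .y}).toSubalgebra).comap Sym.subtype

/-- The ideal of the Lie algebra of symmetries generated by the rational solutions. -/
def solutionIdeal : LieIdeal ℝ Sym := LieSubmodule.lieSpan ℝ Sym (solutions : Set Sym)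

/-- The Lie algebra of rational higher symmetries up to solutions. -/
abbrev NSym : Type := Sym ⧸ solutionIdeal

/-- The class of a symmetry up to solutions. -/
def cls (φ : Sym) : NSym := LieSubmodule.Quotient.mk φ

/-! ### The explicit symmetries -/

theorem derivation_two (D : Derivation ℝ RatFun RatFun) : D 2 = 0 :=
  D.map_natCast 2

theorem derivation_three (D : Derivation ℝ RatFun RatFun) : D 3 = 0 :=
  D.map_natCast 3

/-- The scaling symmetry `u`. -/
def symU : Sym := ⟨coord (.u 0), by
  have h0 := x_add_y_ne_zero
  rw [mem_Sym, Dx_u, Dx_ux, Dy_u, Dy_u, uxx]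
  simp only [Function.iterate_zero_apply]
  field_simp
  ring⟩

/-- `ϱ₀ = -u_x + u_y`. -/
def rho0 : Sym := ⟨-coord (.ux 0) + coord (.u 1), by
  have h0 := x_add_y_ne_zero
  rw [mem_Sym]
  simp only [Derivation.leibniz_div, smul_eq_mul, map_add, map_sub, map_neg,
    Dx_x, Dx_y, Dx_u, Dx_ux, Dy_x, Dy_y, Dy_u, Dy_ux, uxx, Function.iterate_succ_apply,
    Function.iterate_zero_apply]
  field_simp
  ring⟩

/-- `ϱ₁ = ½ (x² - 2xy - y²) u_x + ½ (x² + 2xy - y²) u_y + ½ (x - y) u`. -/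
def rho1 : Sym := ⟨
  1 / 2 * (coord .x ^ 2 - 2 * coord .x * coord .y - coord .y ^ 2) * coord (.ux 0)
    + 1 / 2 * (coord .x ^ 2 + 2 * coord .x * coord .y - coord .y ^ 2) * coord (.u 1)
    + 1 / 2 * (coord .x - coord .y) * coord (.u 0), by
  have h0 := x_add_y_ne_zero
  rw [mem_Sym]
  simp only [pow_two, Derivation.leibniz, Derivation.leibniz_div, smul_eq_mul, map_add, map_sub,
    map_neg, Derivation.map_one_eq_zero,
    Dx_x, Dx_y, Dx_u, Dx_ux, Dy_x, Dy_y, Dy_u, Dy_ux, uxx, Function.iterate_succ_apply,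
    Function.iterate_zero_apply, derivation_two, map_zero]
  field_simp
  ring⟩

/-- `ϱ₂ = (x + y) u_yy + (x - y) u_xy + ((x - y) u_x + (3x + y) u_y) / (2 (x + y))`. -/
def rho2 : Sym := ⟨
  (coord .x + coord .y) * coord (.u 2) + (coord .x - coord .y) * coord (.ux 1)
    + 1 / (2 * (coord .x + coord .y))
      * ((coord .x - coord .y) * coord (.ux 0) + (3 * coord .x + coord .y) * coord (.u 1)), by
  have h0 := x_add_y_ne_zero
  rw [mem_Sym]
  simp only [pow_two, Derivation.leibniz, Derivation.leibniz_div, Derivation.leibniz_inv,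
    smul_eq_mul, map_add, map_sub,
    map_neg, Derivation.map_one_eq_zero,
    Dx_x, Dx_y, Dx_u, Dx_ux, Dy_x, Dy_y, Dy_u, Dy_ux, uxx, Function.iterate_succ_apply,
    Function.iterate_zero_apply, derivation_two, derivation_three, map_zero]
  field_simp
  ring⟩

/-- The iterated Jacobi bracket `{…{{…{ϱ₀, ϱ₂}, …, ϱ₂}, ϱ₁}, …, ϱ₁}` with `j - 1` copies of `ϱ₂`
followed by `m` copies of `ϱ₁`; it is used for `j ≥ 1` only. -/
def rho (j m : ℕ) : Sym := (fun φ => ⁅φ, rho1⁆)^[m] ((fun φ => ⁅φ, rho2⁆)^[j - 1] rho0)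

end

end EulerDarboux

set_option linter.unusedSectionVars false

/-! In the coordinates `r = x + y`, `t = x - y` the equation reads `r (u_rr + u_tt) + u_r = 0`, the
axially symmetric Laplace equation. For every integer `κ` it has one formal solution `H_κ` that is
homogeneous of degree `κ` and equals `t ^ κ` on the axis `r = 0` (`homSol`, `eq_axial_of_ode`). Its
coefficients are polynomial in `κ`. For `κ ≥ 0` it is a solid Legendre polynomial (`solid`); for `κ
< 0` it is a rational function times the irrational `(r² + t²) ^ (-1/2)`.

The polynomial solutions suffice to test everything: no nonzero linear differential operator in the
internal jets annihilates all of them (`jets_linearIndependent`). Indeed their generating function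
is `q ^ (-1/2)` for a quadratic polynomial `q`, and each further derivative adds one more factor `q`
to the denominator. Hence substituting a generic combination of the `H_k` embeds the rational
functions of the jets into a field of formal series (`spec`), compatibly with the total derivatives.
Moreover, a rational function that is invariant under all shifts of `u` by polynomial solutions
depends on `x`, `y` only (`mem_baseField_of_evol_solid`).

The variation of a symmetry along `H_k` is again a symmetry. Its homogeneous components depend
polynomially on `k`, so they extend to all integers `κ` and remain multiples of homogeneous
solutions. Rationality of the symmetry forbids passing between negative and nonnegative degrees
(`IsPolyFamily.coeff_eq_zero`). For second variations this forces vanishing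
(`evol_solid_evol_solid`), so rational symmetries are affine in the jets. For first variations it
gives `H_k ↦ ∑_j p_j(k) H_{k+j}` with real polynomials `p_j`, the symbols, whose degree is at most
the order of the symmetry and which vanish at `κ` whenever `κ` and `κ + j` lie on different sides of
zero (`IsSplit`, `exists_symbol_polynomial`). This prescribes `|j|` roots, so a nonzero `p_j` has
degree at least `|j|`. Symbols determine a symmetry up to functions of `x`, `y`.

The symmetries `ϱ₀`, `ϱ₁`, `ϱ₂` send `H_k` to `-2k H_{k-1}`, `½ (k+1) H_{k+1}` and `-(2k-1) k
H_{k-1}`. It follows that `ϱ_j^m` shifts degrees by `m - j` with a symbol of degree exactly `j` if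
`m ≤ 2j` (`hasAction_rho`). So for each shift `d` there is exactly one representative of every
degree `j ≥ |d|`, with `u` covering `j = 0`, and comparison of leading coefficients gives the basis.
For `m > 2j` the shift exceeds the degree bound, the symbol is zero, and `ϱ_j^m`, being homogeneous
of degree one in the jets, vanishes. -/

namespace EulerDarboux
noncomputable section

/-! ### Derivations of Laurent series -/

section Series

open HahnSeries

variable {A : Type*} [CommRing A] [Algebra ℝ A]

/-- The coefficientwise algebra structure, preferred to the one induced by power series. -/
instance seriesAlgebra : Algebra ℝ (HahnSeries ℤ A) := HahnSeries.instAlgebra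

/-- The derivation of Laurent series acting on the coefficients. -/
def coeffDer (d : Derivation ℝ A A) : Derivation ℝ (HahnSeries ℤ A) (HahnSeries ℤ A) :=
  Derivation.mk'
    { toFun := fun f : HahnSeries ℤ A => (f.map d : HahnSeries ℤ A)
      map_add' := fun f g => by ext; simp
      map_smul' := fun a f => by ext; simp }
    (by
      intro f g
      ext n
      have hf : (f.map d).support ⊆ f.support := by
        intro i hi hfi
        exact hi (by simp [hfi])
      have hg : (g.map d).support ⊆ g.support := by
        intro i hi hgi
        exact hi (by simp [hgi])
      -- Differentiation can only shrink supports, so all three convolutions can be written over the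
      -- same antidiagonal, that of the supports of `f` and `g`, and the Leibniz rule holds term by
      -- term.
      have h1 := coeff_mul_right' (x := f) (a := n) g.isPWO_support hg
      have h2 := coeff_mul_left' (y := g) (a := n) f.isPWO_support hf
      simp only [LinearMap.coe_mk, AddHom.coe_mk, smul_eq_mul, coeff_add]
      rw [h1, mul_comm g, h2, map_coeff, coeff_mul, map_sum, ← Finset.sum_add_distrib]
      refine Finset.sum_congr rfl fun ij _ => ?_
      simp [Derivation.leibniz, mul_comm])

@[simp]
theorem coeff_coeffDer (d : Derivation ℝ A A) (f : HahnSeries ℤ A) (n : ℤ) :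
    (coeffDer d f).coeff n = d (f.coeff n) := rfl

/-- The Euler operator on Laurent series. -/
def euler : Derivation ℝ (HahnSeries ℤ A) (HahnSeries ℤ A) :=
  Derivation.mk'
    { toFun := fun f : HahnSeries ℤ A =>
        (HahnSeries.mk (fun n => n * f.coeff n)
          (f.isPWO_support.mono fun i hi hfi => hi (by simp [hfi])) : HahnSeries ℤ A)
      map_add' := fun f g => by ext; simp [mul_add]
      map_smul' := fun a f => by ext; simp }
    (by
      have hs (f : HahnSeries ℤ A) : (HahnSeries.mk (fun n : ℤ => (n : A) * f.coeff n)
          (f.isPWO_support.mono fun i hi hfi => hi (by simp [hfi]))).support ⊆ f.support := by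
        intro i hi hfi
        exact hi (by simp [hfi])
      intro f g
      ext n
      have h1 := coeff_mul_right' (x := f) (a := n) g.isPWO_support (hs g)
      have h2 := coeff_mul_left' (y := g) (a := n) f.isPWO_support (hs f)
      simp only [LinearMap.coe_mk, AddHom.coe_mk, smul_eq_mul,
        coeff_add]
      rw [h1, mul_comm g, h2, coeff_mul, Finset.mul_sum, ← Finset.sum_add_distrib]
      refine Finset.sum_congr rfl fun ij hij => ?_
      rw [Finset.mem_antidiagonal] at hij
      rw [← hij.2.2]
      push_cast
      ring)

@[simp]
theorem coeff_euler (f : HahnSeries ℤ A) (n : ℤ) :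
    (euler f).coeff n = n * f.coeff n := rfl

theorem euler_single (n : ℤ) (a : A) : euler (single n a) = single n (n * a) := by
  ext m
  by_cases h : m = n
  · subst h; simp
  · simp [coeff_single_of_ne h]

theorem coeffDer_single (d : Derivation ℝ A A) (n : ℤ) (a : A) :
    coeffDer d (single n a) = single n (d a) := by
  ext m
  by_cases h : m = n
  · subst h; simp
  · simp [coeff_single_of_ne h]

instance [CharZero A] : CharZero (HahnSeries ℤ A) :=
  charZero_of_injective_ringHom (f := (C : A →+* HahnSeries ℤ A)) C_injective

end Series

/-- The series whose coefficients lie in a given subfield form a subfield. -/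
def seriesSubfield {K : Type*} [Field K] (S : Subfield K) : Subfield (HahnSeries ℤ K) :=
  RingHom.fieldRange
    { toFun := fun f : HahnSeries ℤ S => f.map S.subtype
      map_one' := HahnSeries.map_one (S.subtype.toMonoidWithZeroHom)
      map_mul' := fun f g => HahnSeries.map_mul (S.subtype.toNonUnitalRingHom)
      map_zero' := by ext; simp
      map_add' := fun f g => by ext; simp }

theorem mem_seriesSubfield {K : Type*} [Field K] {S : Subfield K} {f : HahnSeries ℤ K} :
    f ∈ seriesSubfield S ↔ ∀ n, f.coeff n ∈ S := by
  constructor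
  · rintro ⟨g, rfl⟩ n
    exact (g.coeff n).2
  · intro h
    refine ⟨⟨fun n => ⟨f.coeff n, h n⟩, f.isPWO_support.mono fun i hi hfi => hi ?_⟩, ?_⟩
    · exact Subtype.ext hfi
    · ext n
      rfl

/-! ### The homogeneous solutions along the axis -/

section Axial

variable (K : Type*) [Field K]

/-- The coefficient of `r ^ (2 i) * t ^ (κ - 2 i)` in the homogeneous solution of degree `κ`
equal to `t ^ κ` on the axis `r = 0`. -/
def axialCoeffAux (κ : ℤ) : ℕ → K
  | 0 => 1
  | i + 1 => -((κ - 2 * i) * (κ - 2 * i - 1)) / (4 * (i + 1) ^ 2) * axialCoeffAux κ i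

/-- The coefficient of `r ^ n * t ^ (κ - n)` in the homogeneous solution of degree `κ`
equal to `t ^ κ` on the axis `r = 0`. -/
def axialCoeff (κ n : ℤ) : K :=
  if 0 ≤ n ∧ Even n then axialCoeffAux K κ (n / 2).toNat else 0

theorem axialCoeff_zero (κ : ℤ) : axialCoeff K κ 0 = 1 := by
  simp [axialCoeff, axialCoeffAux]

theorem axialCoeff_two_mul (κ : ℤ) (i : ℕ) :
    axialCoeff K κ (2 * i) = axialCoeffAux K κ i := by
  simp [axialCoeff]

theorem axialCoeff_of_neg (κ : ℤ) {n : ℤ} (hn : n < 0) : axialCoeff K κ n = 0 := by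
  simp [axialCoeff, hn.not_ge]

theorem axialCoeff_of_odd (κ : ℤ) {n : ℤ} (hn : ¬ Even n) : axialCoeff K κ n = 0 := by
  simp [axialCoeff, hn]

/-- The case distinction behind all coefficient identities below: `n` negative or odd, zero, or
positive and even. The value at `n - 2` is carried along because multiplication by `r²` shifts the
index by two. -/
theorem axial_cases (n : ℤ) :
    ((∀ κ, axialCoeff K κ n = 0) ∧ (∀ κ, axialCoeff K κ (n - 2) = 0)) ∨
    (n = 0 ∧ (∀ κ, axialCoeff K κ n = 1) ∧ (∀ κ, axialCoeff K κ (n - 2) = 0)) ∨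
    ∃ i : ℕ, n = 2 * i + 2 ∧ (∀ κ, axialCoeff K κ n = axialCoeffAux K κ (i + 1)) ∧
      ∀ κ, axialCoeff K κ (n - 2) = axialCoeffAux K κ i := by
  by_cases he : Even n
  · rcases lt_trichotomy n 0 with hn | hn | hn
    · left
      exact ⟨fun κ => axialCoeff_of_neg K κ hn, fun κ => axialCoeff_of_neg K κ (by omega)⟩
    · subst hn
      right; left
      exact ⟨rfl, fun κ => axialCoeff_zero K κ, fun κ => axialCoeff_of_neg K κ (by omega)⟩
    · right; right
      obtain ⟨m, hm⟩ := he
      obtain ⟨i, hi⟩ : ∃ i : ℕ, m = i + 1 := ⟨(m - 1).toNat, by omega⟩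
      have h1 : n = 2 * ((i + 1 : ℕ) : ℤ) := by push_cast; omega
      have h2 : n - 2 = 2 * (i : ℤ) := by omega
      refine ⟨i, by omega, fun κ => ?_, fun κ => ?_⟩
      · rw [h1, axialCoeff_two_mul]
      · rw [h2, axialCoeff_two_mul]
  · left
    refine ⟨fun κ => axialCoeff_of_odd K κ he, fun κ => axialCoeff_of_odd K κ fun h => he ?_⟩
    have := h.add (show Even (2 : ℤ) by decide)
    simpa using this

variable [CharZero K]

theorem axialCoeffAux_succ (κ : ℤ) (i : ℕ) : 4 * (i + 1) ^ 2 * axialCoeffAux K κ (i + 1) =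
    -((κ - 2 * i) * (κ - 2 * i - 1)) * axialCoeffAux K κ i := by
  have : (i + 1 : K) ≠ 0 := Nat.cast_add_one_ne_zero i
  rw [axialCoeffAux]
  field_simp

theorem axialCoeffAux_shift (κ : ℤ) (i : ℕ) :
    (κ - 2 * i) * axialCoeffAux K κ i = κ * axialCoeffAux K (κ - 1) i := by
  induction i with
  | zero => simp [axialCoeffAux]
  | succ i ih =>
    have h : (4 * (i + 1) ^ 2 : K) ≠ 0 := by
      have : (i + 1 : K) ≠ 0 := Nat.cast_add_one_ne_zero i
      simpa using this
    apply mul_left_cancel₀ h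
    have h1 := axialCoeffAux_succ K κ i
    have h2 := axialCoeffAux_succ K (κ - 1) i
    push_cast at h1 h2 ⊢
    linear_combination (κ - 2 * (i + 1) : K) * h1 - (κ : K) * h2
      - (κ - 2 * i - 1 : K) * (κ - 2 * i - 2) * ih

theorem axialCoeffAux_add_one (κ : ℤ) (i : ℕ) : 4 * (i + 1) ^ 2 * axialCoeffAux K (κ + 1) (i + 1) =
    -((κ - 2 * i) * (κ + 1)) * axialCoeffAux K κ i := by
  have h1 := axialCoeffAux_succ K (κ + 1) i
  have h2 := axialCoeffAux_shift K (κ + 1) i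
  rw [add_sub_cancel_right] at h2
  push_cast at h1 h2
  linear_combination h1 - (κ - 2 * i : K) * h2

theorem axialCoeffAux_add_two (κ : ℤ) (i : ℕ) : 4 * (i + 1) ^ 2 * axialCoeffAux K (κ + 2) (i + 1) =
    -((κ + 2) * (κ + 1)) * axialCoeffAux K κ i := by
  have h1 := axialCoeffAux_add_one K (κ + 1) i
  have h2 := axialCoeffAux_shift K (κ + 1) i
  rw [add_sub_cancel_right] at h2
  rw [show κ + 1 + 1 = κ + 2 by ring] at h1
  push_cast at h1 h2
  linear_combination h1 - (κ + 2 : K) * h2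

/-- Coefficient form of the equation `r (u_rr + u_tt) + u_r = 0` for a homogeneous function of
degree `κ`. -/
theorem axialCoeff_ode (κ n : ℤ) : (n : K) ^ 2 * axialCoeff K κ n =
    -((κ - n + 2) * (κ - n + 1)) * axialCoeff K κ (n - 2) := by
  rcases axial_cases K n with ⟨h1, h2⟩ | ⟨h0, h1, h2⟩ | ⟨i, h0, h1, h2⟩
  · simp [h1, h2]
  · subst h0
    simp [h1, axialCoeff_of_neg]
  · rw [h1, h2, h0]
    push_cast
    linear_combination axialCoeffAux_succ K κ i

/-- Coefficient form of `∂_t H_κ = κ H_{κ-1}`: translation along the axis preserves the equation. -/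
theorem axialCoeff_shift (κ n : ℤ) :
    ((κ : K) - n) * axialCoeff K κ n = κ * axialCoeff K (κ - 1) n := by
  rcases axial_cases K n with ⟨h1, h2⟩ | ⟨h0, h1, h2⟩ | ⟨i, h0, h1, h2⟩
  · simp [h1]
  · simp only [h1]
    simp [h0]
  · rw [h1, h1, h0]
    have := axialCoeffAux_shift K κ (i + 1)
    push_cast at this ⊢
    linear_combination this

/-- Coefficient form of the special conformal transformation along the axis, which raises the degree
by one. -/
theorem axialCoeff_raise (κ n : ℤ) : (κ + n + 1) * axialCoeff K κ n
    - (κ - n + 2) * axialCoeff K κ (n - 2) = (κ + 1) * axialCoeff K (κ + 1) n := by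
  rcases axial_cases K n with ⟨h1, h2⟩ | ⟨h0, h1, h2⟩ | ⟨i, h0, h1, h2⟩
  · simp [h1, h2]
  · subst h0
    simp [h1, axialCoeff_of_neg]
  · rw [h1, h1, h2, h0]
    have h : (4 * (i + 1) ^ 2 : K) ≠ 0 := by
      have : (i + 1 : K) ≠ 0 := Nat.cast_add_one_ne_zero i
      simpa using this
    apply mul_left_cancel₀ h
    push_cast
    linear_combination (κ + (2 * i + 2) + 1 : K) * axialCoeffAux_succ K κ i
      - (κ + 1 : K) * axialCoeffAux_add_one K κ i

/-- Bonnet's three-term recurrence for Legendre polynomials, valid in every integer degree. -/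
theorem axialCoeff_recurrence (κ n : ℤ) : (κ + 2) * axialCoeff K (κ + 2) n =
    (2 * κ + 3) * axialCoeff K (κ + 1) n
      - (κ + 1) * (axialCoeff K κ n + axialCoeff K κ (n - 2)) := by
  rcases axial_cases K n with ⟨h1, h2⟩ | ⟨h0, h1, h2⟩ | ⟨i, h0, h1, h2⟩
  · simp [h1, h2]
  · simp only [h1, h2]
    ring
  · rw [h1, h1, h1, h2]
    have h : (4 * (i + 1) ^ 2 : K) ≠ 0 := by
      have : (i + 1 : K) ≠ 0 := Nat.cast_add_one_ne_zero i
      simpa using this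
    apply mul_left_cancel₀ h
    linear_combination (κ + 2 : K) * axialCoeffAux_add_two K κ i
      - (2 * κ + 3 : K) * axialCoeffAux_add_one K κ i + (κ + 1 : K) * axialCoeffAux_succ K κ i

end Axial

end
end EulerDarboux

/-! ### Formal series in `t` and `r / t` and the homogeneous solutions. -/

namespace EulerDarboux
noncomputable section

open HahnSeries

variable {K : Type*} [Field K]

/-! ### Polynomial functions of an integer argument -/

/-- Functions on the integers given by a polynomial. -/
def IsPolyFun (c : ℤ → K) : Prop := ∃ P : Polynomial K, ∀ κ : ℤ, c κ = P.eval (κ : K)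

theorem IsPolyFun.const (a : K) : IsPolyFun fun _ => a := ⟨Polynomial.C a, by simp⟩

theorem IsPolyFun.id : IsPolyFun fun κ : ℤ => (κ : K) := ⟨Polynomial.X, by simp⟩

theorem IsPolyFun.add {c d : ℤ → K} : IsPolyFun c → IsPolyFun d → IsPolyFun fun κ => c κ + d κ := by
  rintro ⟨P, hP⟩ ⟨Q, hQ⟩
  exact ⟨P + Q, fun κ => by simp [hP, hQ]⟩

theorem IsPolyFun.mul {c d : ℤ → K} : IsPolyFun c → IsPolyFun d → IsPolyFun fun κ => c κ * d κ := by
  rintro ⟨P, hP⟩ ⟨Q, hQ⟩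
  exact ⟨P * Q, fun κ => by simp [hP, hQ]⟩

theorem IsPolyFun.sum {ι : Type*} (s : Finset ι) {c : ι → ℤ → K} (h : ∀ i ∈ s, IsPolyFun (c i)) :
    IsPolyFun fun κ => ∑ i ∈ s, c i κ := by
  classical
  induction s using Finset.induction_on with
  | empty => simpa using IsPolyFun.const (0 : K)
  | insert i s hi ih =>
    simp only [Finset.sum_insert hi]
    exact (h i (by simp)).add (ih fun j hj => h j (by simp [hj]))

theorem polynomial_eq_zero_of_eval_nat [CharZero K] (P : Polynomial K) (N : ℕ)
    (h : ∀ k : ℕ, N ≤ k → P.eval (k : K) = 0) : P = 0 := by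
  apply Polynomial.eq_zero_of_infinite_isRoot
  refine Set.Infinite.mono (s := (fun k : ℕ => (k : K)) '' Set.Ici N) ?_ ?_
  · rintro _ ⟨k, hk, rfl⟩
    exact h k hk
  · exact (Set.Ici_infinite N).image Nat.cast_injective.injOn

/-- This transfers identities from natural degrees, where there are honest polynomial solutions, to
negative degrees. -/
theorem IsPolyFun.eq_zero_of_nat [CharZero K] {c : ℤ → K} (hc : IsPolyFun c) (N : ℕ)
    (h : ∀ k : ℕ, N ≤ k → c k = 0) (κ : ℤ) : c κ = 0 := by
  obtain ⟨P, hP⟩ := hc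
  have : P = 0 := polynomial_eq_zero_of_eval_nat P N fun k hk => by
    rw [← h k hk, hP]; simp
  simp [hP, this]

theorem IsPolyFun.eq_zero_of_neg [CharZero K] {c : ℤ → K} (hc : IsPolyFun c)
    (h : ∀ κ < 0, c κ = 0) (κ : ℤ) : c κ = 0 := by
  have h' : IsPolyFun fun κ => c (-κ) := by
    obtain ⟨P, hP⟩ := hc
    exact ⟨P.comp (-Polynomial.X), fun κ => by simp [hP]⟩
  have := h'.eq_zero_of_nat 1 (fun k hk => h _ (by omega)) (-κ)
  simpa using this

variable [Algebra ℝ K]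

/-! ### Bihomogeneous expansions

Functions of `r` and `t` are expanded as iterated Laurent series in `t` (outer variable) and
`r / t` (inner variable). -/

/-- The multiple of a derivation by a function. -/
def scaleDer {A : Type*} [CommRing A] [Algebra ℝ A] (a : A) (D : Derivation ℝ A A) :
    Derivation ℝ A A := a • D

theorem scaleDer_apply {A : Type*} [CommRing A] [Algebra ℝ A] (a : A) (D : Derivation ℝ A A)
    (b : A) : scaleDer a D b = a * D b := rfl

/-- The derivative with respect to `r`. -/
def Dr : Derivation ℝ (HahnSeries ℤ (HahnSeries ℤ K)) (HahnSeries ℤ (HahnSeries ℤ K)) :=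
  -- With `z = r / t` as inner variable, `z ∂_z` at fixed `t` equals `r ∂_r`; the prefactor is `1 /
  -- r = t⁻¹ z⁻¹`.
  scaleDer (single (-1) (single (-1) 1)) (coeffDer euler)

/-- The derivative with respect to `t`. -/
def Dt : Derivation ℝ (HahnSeries ℤ (HahnSeries ℤ K)) (HahnSeries ℤ (HahnSeries ℤ K)) :=
  scaleDer (single (-1) 1) (euler - coeffDer euler)

/-- `(F.coeff n).coeff i` is the coefficient of `r ^ i * t ^ (n - i)`: the outer index is the total
degree, the inner one the degree in `r`. -/
theorem coeff_Dr (F : HahnSeries ℤ (HahnSeries ℤ K)) (n i : ℤ) :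
    ((Dr F).coeff n).coeff i = (i + 1) * (F.coeff (n + 1)).coeff (i + 1) := by
  simp [Dr, scaleDer_apply, coeff_single_mul]

theorem coeff_Dt (F : HahnSeries ℤ (HahnSeries ℤ K)) (n i : ℤ) :
    ((Dt F).coeff n).coeff i = (n + 1 - i) * (F.coeff (n + 1)).coeff i := by
  have h (m : ℤ) (f : HahnSeries ℤ K) : ((m : HahnSeries ℤ K) * f).coeff i = m * f.coeff i := by
    rw [← single_zero_intCast, coeff_single_zero_mul]
  simp [Dt, scaleDer_apply, coeff_single_mul]
  rw [← Int.cast_one, ← Int.cast_add, h]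
  push_cast
  ring

theorem ext_coeff {F G : HahnSeries ℤ (HahnSeries ℤ K)}
    (h : ∀ n i, (F.coeff n).coeff i = (G.coeff n).coeff i) : F = G := by
  ext n i
  exact h n i

theorem Dr_Dt (F : HahnSeries ℤ (HahnSeries ℤ K)) : Dr (Dt F) = Dt (Dr F) := by
  apply ext_coeff
  intro n i
  simp only [coeff_Dr, coeff_Dt]
  push_cast
  ring

/-- The derivative with respect to `x = (r + t) / 2`. -/
def SDx : Derivation ℝ (HahnSeries ℤ (HahnSeries ℤ K)) (HahnSeries ℤ (HahnSeries ℤ K)) := Dr + Dt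

/-- The derivative with respect to `y = (r - t) / 2`. -/
def SDy : Derivation ℝ (HahnSeries ℤ (HahnSeries ℤ K)) (HahnSeries ℤ (HahnSeries ℤ K)) := Dr - Dt

theorem SDx_SDy (F : HahnSeries ℤ (HahnSeries ℤ K)) : SDx (SDy F) = SDy (SDx F) := by
  simp only [SDx, SDy, Derivation.add_apply, Derivation.sub_apply, map_add, map_sub, Dr_Dt]
  ring

/-- The expansion of `r`. -/
def serR : HahnSeries ℤ (HahnSeries ℤ K) := single 1 (single 1 1)

/-- The expansion of `t`. -/
def serT : HahnSeries ℤ (HahnSeries ℤ K) := single 1 1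

theorem coeff_serR_mul (F : HahnSeries ℤ (HahnSeries ℤ K)) (n i : ℤ) :
    ((serR * F).coeff n).coeff i = (F.coeff (n - 1)).coeff (i - 1) := by
  simp [serR, coeff_single_mul]

theorem coeff_serT_mul (F : HahnSeries ℤ (HahnSeries ℤ K)) (n i : ℤ) :
    ((serT * F).coeff n).coeff i = (F.coeff (n - 1)).coeff i := by
  simp [serT, coeff_single_mul]

theorem Dr_serR : Dr (serR : HahnSeries ℤ (HahnSeries ℤ K)) = 1 := by
  simp [Dr, scaleDer_apply, serR, coeffDer_single, euler_single]

theorem Dr_serT : Dr (serT : HahnSeries ℤ (HahnSeries ℤ K)) = 0 := by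
  rw [serT, Dr, scaleDer_apply, ← single_zero_one]
  simp [coeffDer_single]

theorem Dt_serR : Dt (serR : HahnSeries ℤ (HahnSeries ℤ K)) = 0 := by
  simp [Dt, scaleDer_apply, serR, coeffDer_single, euler_single]

theorem Dt_serT : Dt (serT : HahnSeries ℤ (HahnSeries ℤ K)) = 1 := by
  rw [serT, Dt, scaleDer_apply, ← single_zero_one]
  simp [coeffDer_single, euler_single]

/-- The equation in the coordinates `r`, `t`, on the level of coefficients. -/
theorem coeff_equation (F : HahnSeries ℤ (HahnSeries ℤ K)) (n i : ℤ) :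
    ((serR * (Dr (Dr F) + Dt (Dt F)) + Dr F).coeff (n - 1)).coeff (i - 1)
      = i ^ 2 * (F.coeff n).coeff i + (n - i + 1) * (n - i + 2) * (F.coeff n).coeff (i - 2) := by
  simp only [coeff_add, mul_add, coeff_serR_mul, coeff_Dr, coeff_Dt]
  rw [show n - 1 - 1 + 1 + 1 = n by ring, show i - 1 - 1 + 1 + 1 = i by ring,
    show n - 1 + 1 = n by ring, show i - 1 + 1 = i by ring, show i - 1 - 1 = i - 2 by ring]
  push_cast
  ring

/-! ### Homogeneous solutions -/

variable (K) in
/-- The homogeneous solution of degree `κ` restricted to `t = 1`, a power series in `r`. -/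
def axial (κ : ℤ) : HahnSeries ℤ K :=
  ofSuppBddBelow (axialCoeff K κ) ⟨0, by
    intro n hn
    by_contra h
    exact hn (axialCoeff_of_neg K κ (not_le.mp h))⟩

@[simp]
theorem coeff_axial (κ n : ℤ) : (axial K κ).coeff n = axialCoeff K κ n := rfl

variable (K) in
/-- The homogeneous solution of degree `κ` equal to `t ^ κ` on the axis. -/
def homSol (κ : ℤ) : HahnSeries ℤ (HahnSeries ℤ K) := single κ (axial K κ)

theorem axial_ne_zero (κ : ℤ) : axial K κ ≠ 0 := by
  intro h
  have := congrArg (fun f => f.coeff 0) h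
  simp [axialCoeff_zero] at this

/-- Laurent series solutions on the line `t = 1` are regular on the axis. -/
theorem eq_axial_of_ode [CharZero K] (n : ℤ) (f : HahnSeries ℤ K)
    (h : ∀ i : ℤ, (i : K) ^ 2 * f.coeff i + (n - i + 1) * (n - i + 2) * f.coeff (i - 2) = 0) :
    f = C (f.coeff 0) * axial K n := by
  rw [← sub_eq_zero]
  set g := f - C (f.coeff 0) * axial K n with hg
  have hgc (i : ℤ) : g.coeff i = f.coeff i - f.coeff 0 * axialCoeff K n i := by
    simp [hg]
  have h0 : g.coeff 0 = 0 := by simp [hgc, axialCoeff_zero]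
  have hode (i : ℤ) : (i : K) ^ 2 * g.coeff i + (n - i + 1) * (n - i + 2) * g.coeff (i - 2) = 0 := by
    rw [hgc, hgc]
    linear_combination h i - f.coeff 0 * axialCoeff_ode K n i
  -- The lowest exponent of a nonzero `g` solves the indicial equation `i² = 0`, but the coefficient
  -- at its double root `0` has been removed.
  by_contra hne
  have h1 := hode g.order
  rw [coeff_eq_zero_of_lt_order (show g.order - 2 < g.order by omega), mul_zero, add_zero,
    mul_eq_zero, pow_eq_zero_iff two_ne_zero, Int.cast_eq_zero] at h1
  rcases h1 with h1 | h1
  · rw [← h1] at h0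
    exact coeff_order_eq_zero.not.mpr hne h0
  · exact coeff_order_eq_zero.not.mpr hne h1

/-- The relation `∂_t H_κ = κ H_{κ-1}` restricted to `t = 1`. It produces `H_{κ-1}` from `H_κ`
whenever `κ ≠ 0`. -/
theorem euler_axial [CharZero K] (κ : ℤ) :
    κ * axial K κ - euler (axial K κ) = κ * axial K (κ - 1) := by
  have h (m : ℤ) (f : HahnSeries ℤ K) (i : ℤ) :
      ((m : HahnSeries ℤ K) * f).coeff i = m * f.coeff i := by
    rw [← single_zero_intCast, coeff_single_zero_mul]
  ext i
  simp only [coeff_sub, h, coeff_euler, coeff_axial]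
  linear_combination axialCoeff_shift K κ i

theorem axial_recurrence [CharZero K] (κ : ℤ) : ((κ + 2 : ℤ) : HahnSeries ℤ K) * axial K (κ + 2) =
    ((2 * κ + 3 : ℤ) : HahnSeries ℤ K) * axial K (κ + 1)
      - ((κ + 1 : ℤ) : HahnSeries ℤ K) * ((1 + single 2 1) * axial K κ) := by
  have h (m : ℤ) (f : HahnSeries ℤ K) (i : ℤ) :
      ((m : HahnSeries ℤ K) * f).coeff i = m * f.coeff i := by
    rw [← single_zero_intCast, coeff_single_zero_mul]
  ext i
  simp only [coeff_sub, h, add_mul, one_mul, coeff_add, coeff_single_mul, coeff_axial]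
  have := axialCoeff_recurrence K κ i
  push_cast
  linear_combination this

theorem homSol_equation [CharZero K] (κ : ℤ) :
    serR * (Dr (Dr (homSol K κ)) + Dt (Dt (homSol K κ))) + Dr (homSol K κ) = 0 := by
  apply ext_coeff
  intro n i
  have := coeff_equation (homSol K κ) (n + 1) (i + 1)
  rw [add_sub_cancel_right, add_sub_cancel_right] at this
  rw [this]
  by_cases h : n + 1 = κ
  · simp only [homSol, h, coeff_single_same, coeff_axial, coeff_zero]
    have := axialCoeff_ode K κ (i + 1)
    linear_combination this
  · simp [homSol, coeff_single_of_ne h]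

theorem Dt_homSol [CharZero K] (κ : ℤ) : Dt (homSol K κ) = (κ : HahnSeries ℤ (HahnSeries ℤ K)) * homSol K (κ - 1) := by
  apply ext_coeff
  intro n i
  rw [coeff_Dt, ← single_zero_intCast, coeff_single_zero_mul, ← single_zero_intCast,
    coeff_single_zero_mul]
  by_cases h : n + 1 = κ
  · obtain rfl : n = κ - 1 := by omega
    simp only [homSol, sub_add_cancel, coeff_single_same, coeff_axial]
    have := axialCoeff_shift K κ i
    push_cast
    linear_combination this
  · simp [homSol, coeff_single_of_ne h, coeff_single_of_ne (show n ≠ κ - 1 by omega)]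

theorem euler_homSol [CharZero K] (κ : ℤ) :
    serR * Dr (homSol K κ) + serT * Dt (homSol K κ) =
      (κ : HahnSeries ℤ (HahnSeries ℤ K)) * homSol K κ := by
  apply ext_coeff
  intro n i
  rw [coeff_add, coeff_add, coeff_serR_mul, coeff_serT_mul, coeff_Dr, coeff_Dt,
    ← single_zero_intCast, coeff_single_zero_mul, ← single_zero_intCast, coeff_single_zero_mul]
  rw [sub_add_cancel, sub_add_cancel]
  by_cases h : n = κ
  · subst h
    push_cast
    ring
  · simp [homSol, coeff_single_of_ne h]

/-- Twice the first-order operator of `ϱ₁`, written in `r` and `t`. -/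
theorem raise_homSol [CharZero K] (κ : ℤ) :
    2 * (serR * (serT * Dr (homSol K κ))) + serT * (serT * Dt (homSol K κ))
      - serR * (serR * Dt (homSol K κ)) + serT * homSol K κ =
        ((κ + 1 : ℤ) : HahnSeries ℤ (HahnSeries ℤ K)) * homSol K (κ + 1) := by
  apply ext_coeff
  intro n i
  rw [two_mul]
  simp only [coeff_add, coeff_sub, coeff_serR_mul, coeff_serT_mul, coeff_Dr, coeff_Dt]
  rw [← single_zero_intCast, coeff_single_zero_mul, ← single_zero_intCast, coeff_single_zero_mul,
    show n - 1 - 1 + 1 = n - 1 by ring]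
  by_cases h : n - 1 = κ
  · obtain rfl : n = κ + 1 := by omega
    simp only [homSol, add_sub_cancel_right, sub_add_cancel, coeff_single_same, coeff_axial]
    have := axialCoeff_raise K κ i
    rw [show i - 1 - 1 = i - 2 by ring]
    push_cast
    linear_combination this
  · simp [homSol, coeff_single_of_ne h, coeff_single_of_ne (show n ≠ κ + 1 by omega)]

theorem homSol_recurrence [CharZero K] (κ : ℤ) :
    ((κ + 2 : ℤ) : HahnSeries ℤ (HahnSeries ℤ K)) * homSol K (κ + 2) =
    ((2 * κ + 3 : ℤ) : HahnSeries ℤ (HahnSeries ℤ K)) * (serT * homSol K (κ + 1))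
      - ((κ + 1 : ℤ) : HahnSeries ℤ (HahnSeries ℤ K)) *
        ((serR ^ 2 + serT ^ 2) * homSol K κ) := by
  have h := axial_recurrence (K := K) κ
  simp only [← single_zero_intCast, homSol, serT, serR, single_mul_single, single_pow, ← single_add,
    one_mul, one_pow, zero_add, add_mul] at h ⊢
  rw [show (2 • (1 : ℤ)) + κ = κ + 2 by simp; ring, show (1 : ℤ) + (κ + 1) = κ + 2 by ring,
    ← single_sub]
  congr 1
  rw [h, add_comm (axial K κ)]
  rfl

theorem homSol_zero [CharZero K] : homSol K 0 = 1 := by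
  have h : axial K 0 = 1 := by
    have h0 := eq_axial_of_ode (K := K) 0 1 (by
      intro i
      by_cases h : i = 0
      · subst h
        simp [coeff_one]
      · by_cases h2 : i - 2 = 0
        · obtain rfl : i = 2 := by omega
          simp [coeff_one]
        · simp [coeff_one, h, h2])
    simpa [coeff_one] using h0.symm
  rw [homSol, h]
  rfl

theorem homSol_one [CharZero K] : homSol K 1 = serT := by
  have h : axial K 1 = 1 := by
    have h0 := eq_axial_of_ode (K := K) 1 1 (by
      intro i
      by_cases h : i = 0
      · subst h
        simp [coeff_one]
      · by_cases h2 : i - 2 = 0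
        · obtain rfl : i = 2 := by omega
          simp [coeff_one]
          norm_num
        · simp [coeff_one, h, h2])
    simpa [coeff_one] using h0.symm
  rw [homSol, h]
  rfl

end
end EulerDarboux

/-! ### Separation of negative and nonnegative degrees by irrationality. -/

namespace EulerDarboux
noncomputable section

open HahnSeries

variable {K : Type*} [Field K] [Algebra ℝ K] [CharZero K]

/-! ### Rationality and parity with respect to the square root of `r² + t²` -/

variable (K) in
/-- Polynomials as Laurent series. -/
def polySeries : Polynomial K →+* HahnSeries ℤ K :=
  (ofPowerSeries ℤ K).comp Polynomial.coeToPowerSeries.ringHom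

theorem polySeries_injective : Function.Injective (polySeries K) :=
  ofPowerSeries_injective.comp (Polynomial.coe_injective K)

theorem polySeries_C (a : K) : polySeries K (Polynomial.C a) = C a := by
  simp [polySeries]

theorem polySeries_X : polySeries K Polynomial.X = single 1 1 := by
  simp [polySeries]

variable (K) in
/-- Laurent expansion of rational functions of one variable. -/
def ratHom : FractionRing (Polynomial K) →+* HahnSeries ℤ K :=
  IsFractionRing.lift (polySeries_injective (K := K))

theorem ratHom_algebraMap (p : Polynomial K) :
    ratHom K (algebraMap _ _ p) = polySeries K p := by
  simp [ratHom]

variable (K) in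
/-- Laurent series of rational functions. -/
def ratSeries : Subfield (HahnSeries ℤ K) := (ratHom K).fieldRange

theorem polySeries_mem (p : Polynomial K) : polySeries K p ∈ ratSeries K :=
  ⟨_, ratHom_algebraMap p⟩

theorem C_mem_ratSeries (a : K) : C a ∈ ratSeries K := by
  rw [← polySeries_C]
  exact polySeries_mem _

theorem intCast_mem_ratSeries (n : ℤ) : (n : HahnSeries ℤ K) ∈ ratSeries K :=
  intCast_mem _ n

theorem single_mem_ratSeries : single 1 1 ∈ ratSeries K := by
  rw [← polySeries_X]
  exact polySeries_mem _

theorem single_neg_mem_ratSeries : single (-1) 1 ∈ ratSeries K := by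
  have h : (single (-1) 1 : HahnSeries ℤ K) = (single 1 1)⁻¹ := by
    apply eq_inv_of_mul_eq_one_left
    simp
  rw [h]
  exact inv_mem single_mem_ratSeries

theorem single_two_mem_ratSeries : single 2 1 ∈ ratSeries K := by
  have h : (single 2 1 : HahnSeries ℤ K) = single 1 1 * single 1 1 := by simp
  rw [h]
  exact mul_mem single_mem_ratSeries single_mem_ratSeries

theorem euler_polySeries (p : Polynomial K) :
    euler (polySeries K p) = polySeries K (Polynomial.X * Polynomial.derivative p) := by
  induction p using Polynomial.induction_on' with
  | add p q hp hq => simp [hp, hq, mul_add]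
  | monomial n a =>
    have h (n : ℕ) (a : K) : polySeries K (Polynomial.monomial n a) = single (n : ℤ) a := by
      rw [← Polynomial.C_mul_X_pow_eq_monomial, map_mul, map_pow, polySeries_C, polySeries_X,
        C_apply, single_pow, single_mul_single]
      simp
    rw [h, euler_single, Polynomial.derivative_monomial, ← Polynomial.monomial_one_one_eq_X,
      Polynomial.monomial_mul_monomial, h]
    rcases n with _ | n
    · simp
    · rw [show 1 + (n + 1 - 1) = n + 1 by omega]
      congr 1
      push_cast
      ring

theorem derivation_div_mem {F : Type*} [Field F] [Algebra ℝ F] (D : Derivation ℝ F F)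
    (S : Subfield F) {a b : F} (ha : a ∈ S) (hb : b ∈ S) (hDa : D a ∈ S) (hDb : D b ∈ S) :
    D (a / b) ∈ S := by
  rw [Derivation.leibniz_div]
  exact mul_mem (pow_mem (inv_mem hb) 2) (sub_mem (mul_mem hb hDa) (mul_mem ha hDb))

theorem euler_mem_ratSeries {f : HahnSeries ℤ K} (hf : f ∈ ratSeries K) :
    euler f ∈ ratSeries K := by
  obtain ⟨z, rfl⟩ := hf
  obtain ⟨a, b, -, rfl⟩ := IsFractionRing.div_surjective (A := Polynomial K) z
  rw [map_div₀, ratHom_algebraMap, ratHom_algebraMap]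
  refine derivation_div_mem _ _ (polySeries_mem _) (polySeries_mem _) ?_ ?_ <;>
  · rw [euler_polySeries]
    exact polySeries_mem _

/-- Bonnet's recurrence, started at `1, 1`, stays within rational functions, since the leading
factor `k + 2` is invertible. -/
theorem axial_nat_mem (k : ℕ) : axial K k ∈ ratSeries K := by
  have key : ∀ k : ℕ, axial K k ∈ ratSeries K ∧ axial K (k + 1 : ℕ) ∈ ratSeries K := by
    intro k
    induction k with
    | zero =>
      have h0 : axial K 0 = 1 := by
        have := homSol_zero (K := K)
        have h := congrArg (fun F => F.coeff 0) this
        simpa [homSol, coeff_one] using h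
      have h1 : axial K 1 = 1 := by
        have := homSol_one (K := K)
        have h := congrArg (fun F => F.coeff 1) this
        simpa [homSol, serT] using h
      simp only [Nat.cast_zero, zero_add, Nat.cast_one, h0, h1]
      exact ⟨one_mem _, one_mem _⟩
    | succ k ih =>
      refine ⟨ih.2, ?_⟩
      have h := axial_recurrence (K := K) k
      have hne : (((k : ℤ) + 2 : ℤ) : HahnSeries ℤ K) ≠ 0 := by
        rw [Ne, Int.cast_eq_zero]
        omega
      have h' := (eq_inv_mul_iff_mul_eq₀ hne).mpr h
      rw [show ((k + 1 + 1 : ℕ) : ℤ) = (k : ℤ) + 2 by push_cast; ring, h']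
      refine mul_mem (inv_mem (intCast_mem_ratSeries _)) (sub_mem
        (mul_mem (intCast_mem_ratSeries _) ?_) (mul_mem (intCast_mem_ratSeries _)
          (mul_mem (add_mem (one_mem _) single_two_mem_ratSeries) ih.1)))
      have := ih.2
      push_cast at this
      exact this
  exact (key k).1

/-- The first-order equation of `(1 + z²) ^ (-1/2)`. For `κ = -1` both sides of the coefficient
recurrence contain a factor `n`, which cancels. -/
theorem euler_axial_neg_one :
    (1 + single 2 1) * euler (axial K (-1)) = -(single 2 1 * axial K (-1)) := by
  ext n
  simp only [add_mul, one_mul, coeff_add, coeff_neg, coeff_single_mul, coeff_euler, coeff_axial]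
  have h := axialCoeff_ode K (-1) n
  by_cases hn : n = 0
  · subst hn
    simp [axialCoeff_of_neg]
  · have hn' : (n : K) ≠ 0 := Int.cast_ne_zero.mpr hn
    apply mul_left_cancel₀ hn'
    push_cast at h ⊢
    linear_combination h

theorem one_add_single_two_ne_zero : (1 + single 2 1 : HahnSeries ℤ K) ≠ 0 := by
  intro h
  have := congrArg (fun f => f.coeff 2) h
  simp [coeff_one] at this

/-- The solution of degree `-1` is proportional to the inverse distance from the origin. -/
theorem exists_axial_neg_one_sq :
    ∃ c : K, c ≠ 0 ∧ axial K (-1) * axial K (-1) * (1 + single 2 1) = C c := by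
  set w := axial K (-1) with hw
  set g := w * w * (1 + single 2 1) with hg
  have hw0 : w ≠ 0 := axial_ne_zero _
  have h2 : euler (single 2 1 : HahnSeries ℤ K) = 2 * single 2 1 := by
    rw [euler_single, two_mul, ← single_add]
    norm_num
  have he : euler g = 0 := by
    simp only [hg, Derivation.leibniz, map_add, Derivation.map_one_eq_zero, smul_eq_mul, h2]
    linear_combination 2 * w * euler_axial_neg_one (K := K)
  have hC : g = C (g.coeff 0) := by
    ext n
    by_cases hn : n = 0
    · subst hn; simp
    · have := congrArg (fun f => f.coeff n) he
      simp only [coeff_euler, coeff_zero, mul_eq_zero, Int.cast_eq_zero, hn, false_or] at this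
      rw [this, C_apply, coeff_single_of_ne hn]
  refine ⟨g.coeff 0, fun h0 => ?_, hC⟩
  rw [h0, map_zero] at hC
  exact mul_ne_zero (mul_ne_zero hw0 hw0) one_add_single_two_ne_zero hC

/-- Polynomial rings are integrally closed, so a square root would be a polynomial `α X + β`;
evaluation at `0`, `1`, `-1` gives `α β = 0` and then a contradiction. -/
theorem not_isSquare_one_add_X_sq (d : K) (hd : d ≠ 0) (z : FractionRing (Polynomial K)) :
    z ^ 2 ≠ algebraMap _ _ (Polynomial.C d * (1 + Polynomial.X ^ 2)) := by
  intro h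
  obtain ⟨a, rfl⟩ := IsIntegrallyClosed.exists_algebraMap_eq_of_isIntegral_pow (R := Polynomial K)
    (x := z) (n := 2) two_pos (h ▸ isIntegral_algebraMap)
  rw [← map_pow] at h
  have h := IsFractionRing.injective (Polynomial K) (FractionRing (Polynomial K)) h
  have hdeg : a.natDegree ≤ 1 := by
    have h1 := congrArg Polynomial.natDegree h
    rw [Polynomial.natDegree_pow, Polynomial.natDegree_C_mul hd] at h1
    have h2 : (1 + Polynomial.X ^ 2 : Polynomial K).natDegree ≤ 2 := by compute_degree
    omega
  obtain ⟨α, β, rfl⟩ := Polynomial.exists_eq_X_add_C_of_natDegree_le_one hdeg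
  have e (x : K) : (α * x + β) ^ 2 = d * (1 + x ^ 2) := by
    have := congrArg (Polynomial.eval x) h
    simpa using this
  have h0 := e 0
  have h1 := e 1
  have h2 := e (-1)
  have hb : β ≠ 0 := by
    rintro rfl
    apply hd
    linear_combination -h0
  have ha : α = 0 := by
    have : 4 * (α * β) = 0 := by linear_combination h1 - h2
    simpa [hb] using this
  subst ha
  apply hd
  linear_combination h0 - h1

/-- If `H_{-1}` were rational at `t = 1`, its inverse would be a rational square root of a constant
multiple of `1 + X²`. -/
theorem axial_neg_one_not_mem : axial K (-1) ∉ ratSeries K := by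
  rintro ⟨z, hz⟩
  obtain ⟨c, hc, h⟩ := exists_axial_neg_one_sq (K := K)
  have hz0 : z ≠ 0 := by
    rintro rfl
    rw [map_zero] at hz
    exact axial_ne_zero _ hz.symm
  have h1 : z * z * algebraMap (Polynomial K) (FractionRing (Polynomial K)) (1 + Polynomial.X ^ 2) =
      algebraMap (Polynomial K) (FractionRing (Polynomial K)) (Polynomial.C c) := by
    apply (ratHom K).injective
    rw [map_mul, map_mul, hz, ratHom_algebraMap, ratHom_algebraMap, polySeries_C, map_add, map_one,
      map_pow, polySeries_X, ← h, single_pow]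
    simp
  have hcc : algebraMap (Polynomial K) (FractionRing (Polynomial K)) (Polynomial.C c⁻¹)
      * algebraMap (Polynomial K) (FractionRing (Polynomial K)) (Polynomial.C c) = 1 := by
    rw [← map_mul, ← map_mul, inv_mul_cancel₀ hc, map_one, map_one]
  refine not_isSquare_one_add_X_sq c⁻¹ (inv_ne_zero hc) z⁻¹ ?_
  rw [map_mul, inv_pow, inv_eq_iff_eq_inv, eq_comm]
  apply inv_eq_of_mul_eq_one_left
  linear_combination hcc
    + algebraMap (Polynomial K) (FractionRing (Polynomial K)) (Polynomial.C c⁻¹) * h1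

variable (K) in
/-- The factor by which the solution of degree `κ` differs from rational functions. -/
def parityUnit (κ : ℤ) : HahnSeries ℤ K := if 0 ≤ κ then 1 else axial K (-1)

/-- Series with the same parity as the solution of degree `κ`. -/
def HasParity (κ : ℤ) (f : HahnSeries ℤ K) : Prop := ∃ s ∈ ratSeries K, f = s * parityUnit K κ

theorem HasParity.add {κ : ℤ} {f g : HahnSeries ℤ K} :
    HasParity κ f → HasParity κ g → HasParity κ (f + g) := by
  rintro ⟨s, hs, rfl⟩ ⟨s', hs', rfl⟩
  exact ⟨s + s', add_mem hs hs', by ring⟩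

theorem HasParity.mul {κ : ℤ} {s f : HahnSeries ℤ K} (hs : s ∈ ratSeries K) :
    HasParity κ f → HasParity κ (s * f) := by
  rintro ⟨s', hs', rfl⟩
  exact ⟨s * s', mul_mem hs hs', by ring⟩

theorem HasParity.sub {κ : ℤ} {f g : HahnSeries ℤ K} (hf : HasParity κ f) (hg : HasParity κ g) :
    HasParity κ (f - g) := by
  have := hf.add (hg.mul (neg_mem (one_mem (ratSeries K))))
  convert this using 1
  ring

theorem HasParity.zero (κ : ℤ) : HasParity κ (0 : HahnSeries ℤ K) := ⟨0, zero_mem _, by simp⟩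

theorem HasParity.sum {ι : Type*} (s : Finset ι) {κ : ℤ} {f : ι → HahnSeries ℤ K}
    (h : ∀ i ∈ s, HasParity κ (f i)) : HasParity κ (∑ i ∈ s, f i) := by
  classical
  induction s using Finset.induction_on with
  | empty => simpa using HasParity.zero κ
  | insert i s hi ih =>
    rw [Finset.sum_insert hi]
    exact (h i (by simp)).add (ih fun j hj => h j (by simp [hj]))

theorem HasParity.euler {κ : ℤ} {f : HahnSeries ℤ K} :
    HasParity κ f → HasParity κ (euler f) := by
  rintro ⟨s, hs, rfl⟩
  have hu : HasParity κ (EulerDarboux.euler (parityUnit K κ)) := by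
    unfold HasParity parityUnit
    split_ifs with h
    · exact ⟨0, zero_mem _, by simp⟩
    · refine ⟨-((1 + single 2 1)⁻¹ * single 2 1), neg_mem (mul_mem (inv_mem
        (add_mem (one_mem _) single_two_mem_ratSeries)) single_two_mem_ratSeries), ?_⟩
      have := (eq_inv_mul_iff_mul_eq₀ one_add_single_two_ne_zero).mpr (euler_axial_neg_one (K := K))
      rw [this]
      ring
  rw [Derivation.leibniz]
  exact (hu.mul hs).add ⟨_, euler_mem_ratSeries hs, mul_comm _ _⟩

/-- Negative degrees are reached from `-1` downwards by differentiation in `t`, dividing by the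
nonzero degree; each step preserves rational multiples of `axial K (-1)`. -/
theorem hasParity_axial (κ : ℤ) : HasParity κ (axial K κ) := by
  rcases le_or_gt 0 κ with h | h
  · obtain ⟨k, rfl⟩ := Int.eq_ofNat_of_zero_le h
    exact ⟨_, axial_nat_mem k, by simp [parityUnit]⟩
  · obtain ⟨k, rfl⟩ : ∃ k : ℕ, κ = -1 - k := ⟨(-1 - κ).toNat, by omega⟩
    clear h
    induction k with
    | zero => exact ⟨1, one_mem _, by simp [parityUnit]⟩
    | succ k ih =>
      have hu : parityUnit K (-1 - (k + 1 : ℕ)) = parityUnit K (-1 - k) := by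
        rw [parityUnit, parityUnit, if_neg (by omega), if_neg (by omega)]
      have h := euler_axial (K := K) (-1 - k)
      have hne : ((-1 - k : ℤ) : HahnSeries ℤ K) ≠ 0 := by
        rw [Ne, Int.cast_eq_zero]
        omega
      have h' := (eq_inv_mul_iff_mul_eq₀ hne).mpr h.symm
      have : HasParity (-1 - k) (axial K (-1 - k - 1)) := by
        rw [h']
        exact ((ih.mul (intCast_mem_ratSeries _)).sub ih.euler).mul
          (inv_mem (intCast_mem_ratSeries _))
      rw [show (-1 - ((k + 1 : ℕ) : ℤ)) = -1 - k - 1 by push_cast; ring] at hu ⊢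
      unfold HasParity at this ⊢
      rw [hu]
      exact this

/-- A nonzero series of both parities would make `axial K (-1)` a quotient of rational functions. -/
theorem HasParity.eq_zero {κ μ : ℤ} {f : HahnSeries ℤ K} (hκ : 0 ≤ κ) (hμ : μ < 0)
    (h1 : HasParity κ f) (h2 : HasParity μ f) : f = 0 := by
  obtain ⟨s, hs, h1⟩ := h1
  obtain ⟨s', hs', h2⟩ := h2
  rw [parityUnit, if_pos hκ, mul_one] at h1
  rw [parityUnit, if_neg hμ.not_ge] at h2
  by_cases h0 : s' = 0
  · rw [h2, h0, zero_mul]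
  · exfalso
    apply axial_neg_one_not_mem (K := K)
    have : axial K (-1) = s'⁻¹ * s := by
      rw [← h1, h2]
      field_simp
    rw [this]
    exact mul_mem (inv_mem hs') hs

/-! ### Families depending polynomially on the degree of homogeneity -/

/-- Families of series with polynomial coefficients and with the parity of the solution of the
corresponding degree. -/
structure IsFamily (f : ℤ → HahnSeries ℤ K) : Prop where
  bdd : ∃ N : ℤ, ∀ κ, ∀ i < N, (f κ).coeff i = 0
  poly : ∀ i, IsPolyFun fun κ => (f κ).coeff i
  parity : ∀ κ, HasParity κ (f κ)

theorem IsFamily.sub {f g : ℤ → HahnSeries ℤ K} (hf : IsFamily f) (hg : IsFamily g) :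
    IsFamily fun κ => f κ - g κ := by
  obtain ⟨N, hN⟩ := hf.bdd
  obtain ⟨M, hM⟩ := hg.bdd
  refine ⟨⟨min N M, fun κ i hi => ?_⟩, fun i => ?_, fun κ => (hf.parity κ).sub (hg.parity κ)⟩
  · simp [hN κ i (by omega), hM κ i (by omega)]
  · have := (hf.poly i).add ((IsPolyFun.const (-1)).mul (hg.poly i))
    convert this using 2
    rw [coeff_sub]
    ring

theorem IsFamily.add {f g : ℤ → HahnSeries ℤ K} (hf : IsFamily f) (hg : IsFamily g) :
    IsFamily fun κ => f κ + g κ := by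
  obtain ⟨N, hN⟩ := hf.bdd
  obtain ⟨M, hM⟩ := hg.bdd
  refine ⟨⟨min N M, fun κ i hi => ?_⟩, fun i => ?_, fun κ => (hf.parity κ).add (hg.parity κ)⟩
  · simp [hN κ i (by omega), hM κ i (by omega)]
  · exact (hf.poly i).add (hg.poly i)

theorem IsFamily.euler {f : ℤ → HahnSeries ℤ K} (hf : IsFamily f) :
    IsFamily fun κ => EulerDarboux.euler (f κ) := by
  obtain ⟨N, hN⟩ := hf.bdd
  refine ⟨⟨N, fun κ i hi => ?_⟩, fun i => ?_, fun κ => (hf.parity κ).euler⟩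
  · simp [hN κ i hi]
  · exact (IsPolyFun.const _).mul (hf.poly i)

theorem IsFamily.single_mul {f : ℤ → HahnSeries ℤ K} (hf : IsFamily f) :
    IsFamily fun κ => single (-1) 1 * f κ := by
  obtain ⟨N, hN⟩ := hf.bdd
  refine ⟨⟨N - 1, fun κ i hi => ?_⟩, fun i => ?_,
    fun κ => (hf.parity κ).mul single_neg_mem_ratSeries⟩
  · simp [coeff_single_mul, hN κ (i + 1) (by omega)]
  · simp only [coeff_single_mul, one_mul]
    exact hf.poly _

theorem coeff_intCast_mul (m : ℤ) (f : HahnSeries ℤ K) (i : ℤ) :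
    ((m : HahnSeries ℤ K) * f).coeff i = m * f.coeff i := by
  rw [← single_zero_intCast, coeff_single_zero_mul]

theorem IsFamily.intCast_mul {f : ℤ → HahnSeries ℤ K} (hf : IsFamily f) (n : ℤ) :
    IsFamily fun κ => ((κ - n : ℤ) : HahnSeries ℤ K) * f κ := by
  obtain ⟨N, hN⟩ := hf.bdd
  refine ⟨⟨N, fun κ i hi => ?_⟩, fun i => ?_,
    fun κ => (hf.parity κ).mul (intCast_mem_ratSeries _)⟩
  · rw [coeff_intCast_mul, hN κ i hi, mul_zero]
  · simp only [coeff_intCast_mul]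
    have := (IsPolyFun.id (K := K)).add (IsPolyFun.const (-(n : K)))
    convert this.mul (hf.poly i) using 2
    push_cast
    ring

theorem isPolyFun_axialCoeff (j i : ℤ) : IsPolyFun fun κ => axialCoeff K (κ + j) i := by
  have h (n : ℕ) : IsPolyFun fun κ => axialCoeffAux K (κ + j) n := by
    induction n with
    | zero => exact IsPolyFun.const 1
    | succ n ih =>
      have h1 (a : K) : IsPolyFun fun κ : ℤ => (κ : K) + a := IsPolyFun.id.add (IsPolyFun.const a)
      convert (((h1 (j - 2 * n)).mul (h1 (j - 2 * n - 1))).mul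
        (IsPolyFun.const (-1 / (4 * (n + 1) ^ 2) : K))).mul ih using 2 with κ
      rw [axialCoeffAux]
      push_cast
      ring
  rcases axial_cases K i with ⟨h1, -⟩ | ⟨-, h1, -⟩ | ⟨n, -, h1, -⟩
  · simpa [h1] using IsPolyFun.const (0 : K)
  · simpa [h1] using IsPolyFun.const (1 : K)
  · simpa [h1] using h (n + 1)

theorem isFamily_axial : IsFamily (axial K) :=
  ⟨⟨0, fun κ i hi => axialCoeff_of_neg K κ hi⟩,
    fun i => by simpa using isPolyFun_axialCoeff (K := K) 0 i, hasParity_axial⟩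

/-- Because of the lower bound on supports uniform in `κ`, the convolution runs over a finite index
set independent of `κ`. -/
theorem IsFamily.isPolyFun_mul {f : ℤ → HahnSeries ℤ K} (hf : IsFamily f) (g : HahnSeries ℤ K)
    (i : ℤ) : IsPolyFun fun κ => (g * f κ).coeff i := by
  obtain ⟨N, hN⟩ := hf.bdd
  have hP : (Set.Ici N).IsPWO := (BddBelow.isWF bddBelow_Ici).isPWO
  have h (κ : ℤ) := coeff_mul_right' (x := g) (y := f κ) (a := i) hP (fun n hn => by
    by_contra h
    exact hn (hN κ n (not_le.mp h)))
  simp only [h]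
  exact IsPolyFun.sum _ fun ij _ => (IsPolyFun.const _).mul (hf.poly ij.2)

/-- Families of homogeneous functions, of degree `κ - n` for the index `κ`. -/
def IsHomFamily (n : ℤ) (F : ℤ → HahnSeries ℤ (HahnSeries ℤ K)) : Prop :=
  ∃ f, IsFamily f ∧ ∀ κ, F κ = single (κ - n) (f κ)

theorem isHomFamily_homSol : IsHomFamily 0 (homSol K) :=
  ⟨_, isFamily_axial, fun κ => by rw [sub_zero]; rfl⟩

theorem IsHomFamily.add {n : ℤ} {F G : ℤ → HahnSeries ℤ (HahnSeries ℤ K)} :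
    IsHomFamily n F → IsHomFamily n G → IsHomFamily n fun κ => F κ + G κ := by
  rintro ⟨f, hf, hF⟩ ⟨g, hg, hG⟩
  exact ⟨_, hf.add hg, fun κ => by simp only [hF, hG, single_add]⟩

theorem IsHomFamily.sub {n : ℤ} {F G : ℤ → HahnSeries ℤ (HahnSeries ℤ K)} :
    IsHomFamily n F → IsHomFamily n G → IsHomFamily n fun κ => F κ - G κ := by
  rintro ⟨f, hf, hF⟩ ⟨g, hg, hG⟩
  exact ⟨_, hf.sub hg, fun κ => by simp only [hF, hG, single_sub]⟩

theorem IsHomFamily.Dr {n : ℤ} {F : ℤ → HahnSeries ℤ (HahnSeries ℤ K)} :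
    IsHomFamily n F → IsHomFamily (n + 1) fun κ => Dr (F κ) := by
  rintro ⟨f, hf, hF⟩
  refine ⟨_, hf.euler.single_mul, fun κ => ?_⟩
  simp only [hF]
  rw [EulerDarboux.Dr, scaleDer_apply, coeffDer_single, single_mul_single,
    show κ - (n + 1) = -1 + (κ - n) by ring]

theorem IsHomFamily.Dt {n : ℤ} {F : ℤ → HahnSeries ℤ (HahnSeries ℤ K)} :
    IsHomFamily n F → IsHomFamily (n + 1) fun κ => Dt (F κ) := by
  rintro ⟨f, hf, hF⟩
  refine ⟨_, (hf.intCast_mul n).sub hf.euler, fun κ => ?_⟩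
  simp only [hF]
  rw [EulerDarboux.Dt, scaleDer_apply, Derivation.sub_apply, coeffDer_single, euler_single,
    ← single_sub, single_mul_single, one_mul,
    show κ - (n + 1) = -1 + (κ - n) by ring]

theorem IsHomFamily.SDx {n : ℤ} {F : ℤ → HahnSeries ℤ (HahnSeries ℤ K)} (h : IsHomFamily n F) :
    IsHomFamily (n + 1) fun κ => SDx (F κ) := h.Dr.add h.Dt

theorem IsHomFamily.SDy {n : ℤ} {F : ℤ → HahnSeries ℤ (HahnSeries ℤ K)} (h : IsHomFamily n F) :
    IsHomFamily (n + 1) fun κ => SDy (F κ) := h.Dr.sub h.Dt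

theorem IsHomFamily.iterate_SDy {n : ℤ} {F : ℤ → HahnSeries ℤ (HahnSeries ℤ K)}
    (h : IsHomFamily n F) (k : ℕ) : IsHomFamily (n + k) fun κ => EulerDarboux.SDy^[k] (F κ) := by
  induction k with
  | zero => simpa using h
  | succ k ih =>
    simp only [Function.iterate_succ_apply']
    convert ih.SDy using 1
    push_cast
    ring

end
end EulerDarboux

namespace EulerDarboux
noncomputable section

/-! ### The generating function of the polynomial solutions -/

section Generating

open PowerSeries

variable {F : Type*} [Field F] [Algebra ℝ F] [CharZero F]

/-- The derivation of power series acting on the coefficients. -/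
def powerDer (D : Derivation ℝ F F) : Derivation ℝ F⟦X⟧ F⟦X⟧ :=
  Derivation.mk'
    { toFun := fun f => PowerSeries.mk fun n => D (coeff n f)
      map_add' := fun f g => by ext; simp
      map_smul' := fun a f => by ext; simp }
    (by
      intro f g
      ext n
      simp only [LinearMap.coe_mk, AddHom.coe_mk, coeff_mk, smul_eq_mul, map_add]
      rw [mul_comm g]
      simp only [coeff_mul, map_sum, Derivation.leibniz, smul_eq_mul, coeff_mk,
        ← Finset.sum_add_distrib]
      exact Finset.sum_congr rfl fun _ _ => by ring)

@[simp]
theorem coeff_powerDer (D : Derivation ℝ F F) (f : F⟦X⟧) (n : ℕ) :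
    coeff n (powerDer D f) = D (coeff n f) := by
  simp [powerDer]

variable (F) in
/-- The Euler operator on power series. -/
def powerEuler : Derivation ℝ F⟦X⟧ F⟦X⟧ := scaleDer X ((derivative F).restrictScalars ℝ)

theorem coeff_powerEuler (f : F⟦X⟧) (n : ℕ) : coeff n (powerEuler F f) = n * coeff n f := by
  rw [powerEuler, scaleDer_apply]
  rcases n with _ | n
  · simp
  · rw [coeff_succ_X_mul]
    simp only [Derivation.restrictScalars_apply, coeff_derivative]
    push_cast
    ring

theorem coeff_iterate_powerDer (D : Derivation ℝ F F) (f : F⟦X⟧) (i n : ℕ) :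
    coeff n ((powerDer D)^[i] f) = D^[i] (coeff n f) := by
  induction i with
  | zero => rfl
  | succ i ih => rw [Function.iterate_succ_apply', Function.iterate_succ_apply', coeff_powerDer, ih]

theorem coeff_iterate_powerEuler (f : F⟦X⟧) (i n : ℕ) :
    coeff n ((powerEuler F)^[i] f) = (n : F) ^ i * coeff n f := by
  induction i with
  | zero => simp
  | succ i ih =>
    rw [Function.iterate_succ_apply', coeff_powerEuler, ih]
    ring

/-- Derivations of power series preserving the polynomials. -/
def PreservesPoly (Δ : Derivation ℝ F⟦X⟧ F⟦X⟧) : Prop :=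
  ∀ h : Polynomial F, ∃ h' : Polynomial F, Δ h = h'

theorem preservesPoly_of_coeff {Δ : Derivation ℝ F⟦X⟧ F⟦X⟧} (d : ℕ → F → F)
    (hd : ∀ n, d n 0 = 0) (h : ∀ f n, coeff n (Δ f) = d n (coeff n f)) : PreservesPoly Δ := by
  intro p
  refine ⟨∑ i ∈ p.support, Polynomial.monomial i (d i (p.coeff i)), ?_⟩
  ext n
  rw [h, Polynomial.coeff_coe, Polynomial.coeff_coe, Polynomial.finsetSum_coeff]
  simp only [Polynomial.coeff_monomial]
  rw [Finset.sum_ite_eq']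
  split_ifs with hn
  · rfl
  · rw [Polynomial.notMem_support_iff.mp hn, hd]

theorem preservesPoly_powerDer (D : Derivation ℝ F F) : PreservesPoly (powerDer D) :=
  preservesPoly_of_coeff (fun _ => D) (fun _ => map_zero D) (fun f n => coeff_powerDer D f n)

theorem preservesPoly_powerEuler : PreservesPoly (powerEuler F) :=
  preservesPoly_of_coeff (fun n a => n * a) (fun _ => mul_zero _) coeff_powerEuler

/-- The quadratic polynomial whose inverse square root generates the polynomial solutions. -/
def genPoly (x y : F) : Polynomial F :=
  1 - Polynomial.C (2 * (x - y)) * Polynomial.X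
    + Polynomial.C (2 * (x ^ 2 + y ^ 2)) * Polynomial.X ^ 2

/-- Sequences satisfying the recurrence of the polynomial solutions. -/
structure IsLegendre (x y : F) (P : ℕ → F) : Prop where
  zero : P 0 = 1
  one : P 1 = x - y
  recurrence : ∀ k : ℕ, (k + 2) * P (k + 2)
    = (2 * k + 3) * ((x - y) * P (k + 1)) - (k + 1) * (2 * (x ^ 2 + y ^ 2) * P k)

variable {x y : F} {P : ℕ → F}

/-- The recurrence read as a differential equation for the generating function `G`: `q G' = -½ q'
G`. -/
theorem IsLegendre.derivative_mk (hP : IsLegendre x y P) :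
    (genPoly x y : F⟦X⟧) * derivative F (PowerSeries.mk P)
      = (C (x - y) - C (2 * (x ^ 2 + y ^ 2)) * X) * PowerSeries.mk P := by
  have h1 : (genPoly x y : F⟦X⟧) * derivative F (PowerSeries.mk P) = derivative F (PowerSeries.mk P)
      - C (2 * (x - y)) * (X * derivative F (PowerSeries.mk P))
      + C (2 * (x ^ 2 + y ^ 2)) * (X * (X * derivative F (PowerSeries.mk P))) := by
    simp only [genPoly, Polynomial.coe_add, Polynomial.coe_sub, Polynomial.coe_one,
      Polynomial.coe_mul, Polynomial.coe_C, Polynomial.coe_X, Polynomial.coe_pow]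
    ring
  rw [h1]
  ext n
  rw [sub_mul, mul_assoc (C (2 * (x ^ 2 + y ^ 2)))]
  rcases n with _ | _ | k
  · have h0 : constantCoeff (derivative F (PowerSeries.mk P)) = x - y := by
      rw [← coeff_zero_eq_constantCoeff_apply, coeff_derivative]
      simp [hP.one]
    simp [hP.zero, h0]
  · simp only [map_add, map_sub (coeff _), coeff_C_mul, coeff_succ_X_mul, coeff_derivative, coeff_mk,
      coeff_zero_X_mul]
    have := hP.recurrence 0
    push_cast at this ⊢
    simp only [zero_add] at this ⊢
    linear_combination this
  · simp only [map_add, map_sub (coeff _), coeff_C_mul, coeff_succ_X_mul, coeff_derivative, coeff_mk]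
    have := hP.recurrence (k + 1)
    push_cast at this ⊢
    rw [show k + 1 + 2 = k + 1 + 1 + 1 by ring] at this
    linear_combination this

theorem derivative_genPoly : derivative F (genPoly x y : F⟦X⟧) =
    -2 * (C (x - y) - C (2 * (x ^ 2 + y ^ 2)) * X) := by
  rw [derivative_coe, genPoly]
  simp only [Polynomial.derivative_add, Polynomial.derivative_sub, Polynomial.derivative_one,
    Polynomial.derivative_C_mul, Polynomial.derivative_X, Polynomial.derivative_X_pow,
    Polynomial.coe_add, Polynomial.coe_sub, Polynomial.coe_mul, Polynomial.coe_C,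
    Polynomial.coe_zero, Polynomial.coe_one, Polynomial.coe_pow, Polynomial.coe_X]
  simp only [map_mul, map_ofNat, Nat.cast_ofNat]
  ring

/-- This is `G = q ^ (-1/2)`: by the differential equation `q G²` has zero derivative, and its
constant term is `1`. -/
theorem IsLegendre.genPoly_mul_sq (hP : IsLegendre x y P) :
    (genPoly x y : F⟦X⟧) * (PowerSeries.mk P * PowerSeries.mk P) = 1 := by
  apply derivative.ext
  · simp only [Derivation.leibniz, smul_eq_mul, derivative_genPoly, Derivation.map_one_eq_zero]
    linear_combination 2 * PowerSeries.mk P * hP.derivative_mk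
  · simp [genPoly, hP.zero]

theorem IsLegendre.mk_ne_zero (hP : IsLegendre x y P) : (PowerSeries.mk P : F⟦X⟧) ≠ 0 := by
  intro h
  have := hP.genPoly_mul_sq
  rw [h] at this
  simp at this

theorem IsLegendre.derivation_mk (hP : IsLegendre x y P) (Δ : Derivation ℝ F⟦X⟧ F⟦X⟧) :
    2 * ((genPoly x y : F⟦X⟧) * Δ (PowerSeries.mk P)) = -(Δ (genPoly x y : F⟦X⟧) * PowerSeries.mk P) := by
  have h := congrArg Δ hP.genPoly_mul_sq
  simp only [Derivation.leibniz, smul_eq_mul, Derivation.map_one_eq_zero] at h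
  apply mul_left_cancel₀ hP.mk_ne_zero
  linear_combination h

/-- `f` is `h / q ^ n * G` for a polynomial `h` congruent to `c * g` modulo the generating
polynomial `q`, where `G` is the generating function. -/
def Rep (x y : F) (P : ℕ → F) (n : ℕ) (c : F) (g : Polynomial F) (f : F⟦X⟧) : Prop :=
  ∃ h : Polynomial F, (genPoly x y : F⟦X⟧) ^ n * f = h * PowerSeries.mk P ∧
    genPoly x y ∣ h - Polynomial.C c * g

/-- Since `G = q ^ (-1/2)`, differentiating `h q ^ (-n) G` gives the numerator `q Δh - (n + 1/2) h
Δq` over `q ^ (n + 1)`; modulo `q` only the second term survives. -/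
theorem Rep.derivation (hP : IsLegendre x y P) {n : ℕ} {c : F} {g : Polynomial F} {f : F⟦X⟧}
    (hf : Rep x y P n c g f) {Δ : Derivation ℝ F⟦X⟧ F⟦X⟧} (hΔ : PreservesPoly Δ)
    {q' : Polynomial F} (hq' : Δ (genPoly x y : F⟦X⟧) = q') :
    Rep x y P (n + 1) (-(2 * n + 1) / 2 * c) (g * q') (Δ f) := by
  obtain ⟨h, h1, h2⟩ := hf
  obtain ⟨h', hh'⟩ := hΔ h
  obtain ⟨s, hs⟩ := h2
  refine ⟨genPoly x y * h' - Polynomial.C ((2 * n + 1) / 2 : F) * (h * q'), ?_, ?_⟩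
  · have e1 := congrArg Δ h1
    simp only [Derivation.leibniz, smul_eq_mul, hh', Derivation.leibniz_pow, nsmul_eq_mul] at e1
    rw [hq'] at e1
    have e2 := hP.derivation_mk Δ
    rw [hq'] at e2
    -- For `n = 0` the truncated exponent `n - 1` does no harm, because of the factor `n`.
    have e3 : (genPoly x y : F⟦X⟧) * (n * ((genPoly x y : F⟦X⟧) ^ (n - 1) * q'))
        = n * ((genPoly x y : F⟦X⟧) ^ n * q') := by
      rcases n with _ | n
      · simp
      · rw [Nat.add_sub_cancel, pow_succ]
        ring
    have e4 : (2 : F⟦X⟧) * ((Polynomial.C ((2 * n + 1) / 2 : F) : Polynomial F) : F⟦X⟧)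
        = 2 * n + 1 := by
      rw [Polynomial.coe_C]
      have : (C ((2 : F) * ((2 * n + 1) / 2)) : F⟦X⟧) = C (2 * (n : F) + 1) := by
        congr 1
        field_simp
      rw [map_mul, map_add, map_mul, map_ofNat, map_natCast, map_one] at this
      exact this
    have h2 : (2 : F⟦X⟧) ≠ 0 := by
      rw [← map_ofNat (C : F →+* F⟦X⟧) 2, Ne, map_eq_zero_iff _ C_injective]
      exact two_ne_zero
    apply mul_left_cancel₀ h2
    rw [Polynomial.coe_sub, Polynomial.coe_mul, Polynomial.coe_mul, Polynomial.coe_mul]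
    linear_combination 2 * (genPoly x y : F⟦X⟧) * e1 + h * e2 - 2 * f * e3
      - 2 * (n : F⟦X⟧) * q' * h1 + (h * q' : F⟦X⟧) * PowerSeries.mk P * e4
  · refine ⟨h' - Polynomial.C ((2 * n + 1) / 2 : F) * (s * q'), ?_⟩
    have : Polynomial.C (-(2 * n + 1) / 2 * c) = -(Polynomial.C ((2 * n + 1) / 2 : F) * Polynomial.C c) := by
      rw [← map_mul, ← map_neg]
      congr 1
      ring
    rw [this]
    linear_combination -(Polynomial.C ((2 * n + 1) / 2 : F) * q') * hs

/-- The leading factors of the iterated derivatives of the generating function. -/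
def repCoeff (F : Type*) [Field F] : ℕ → F
  | 0 => 1
  | n + 1 => -(2 * n + 1) / 2 * repCoeff F n

theorem repCoeff_ne_zero (n : ℕ) : repCoeff F n ≠ 0 := by
  induction n with
  | zero => exact one_ne_zero
  | succ n ih =>
    have : (2 * n + 1 : F) ≠ 0 := by exact_mod_cast (2 * n).succ_ne_zero
    rw [repCoeff]
    exact mul_ne_zero (div_ne_zero (neg_ne_zero.mpr this) two_ne_zero) ih

theorem rep_iterate (hP : IsLegendre x y P) {Δ : Derivation ℝ F⟦X⟧ F⟦X⟧} (hΔ : PreservesPoly Δ)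
    {q' : Polynomial F} (hq' : Δ (genPoly x y : F⟦X⟧) = q') {m : ℕ} {g : Polynomial F}
    {f : F⟦X⟧} (hf : Rep x y P m (repCoeff F m) g f) (n : ℕ) :
    Rep x y P (n + m) (repCoeff F (n + m)) (g * q' ^ n) (Δ^[n] f) := by
  induction n with
  | zero => simpa using hf
  | succ n ih =>
    rw [Function.iterate_succ_apply', pow_succ, ← mul_assoc, Nat.succ_add]
    have := ih.derivation hP hΔ hq'
    exact this

theorem rep_mk : Rep x y P 0 (repCoeff F 0) 1 (PowerSeries.mk P) := ⟨1, by simp, by simp [repCoeff]⟩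

/-- `f` is a polynomial multiple of the generating function divided by `q ^ n`. -/
def HasOrder (x y : F) (P : ℕ → F) (n : ℕ) (f : F⟦X⟧) : Prop :=
  ∃ h : Polynomial F, (genPoly x y : F⟦X⟧) ^ n * f = h * PowerSeries.mk P

theorem Rep.hasOrder {n : ℕ} {c : F} {g : Polynomial F} {f : F⟦X⟧} (hf : Rep x y P n c g f) :
    HasOrder x y P n f := by
  obtain ⟨h, h1, -⟩ := hf
  exact ⟨h, h1⟩

theorem HasOrder.mono {n m : ℕ} {f : F⟦X⟧} (hf : HasOrder x y P n f) (h : n ≤ m) :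
    HasOrder x y P m f := by
  obtain ⟨k, rfl⟩ := Nat.exists_eq_add_of_le h
  obtain ⟨g, hg⟩ := hf
  refine ⟨genPoly x y ^ k * g, ?_⟩
  rw [Polynomial.coe_mul, Polynomial.coe_pow]
  linear_combination (genPoly x y : F⟦X⟧) ^ k * hg

theorem HasOrder.add {n : ℕ} {f g : F⟦X⟧} (hf : HasOrder x y P n f) (hg : HasOrder x y P n g) :
    HasOrder x y P n (f + g) := by
  obtain ⟨a, ha⟩ := hf
  obtain ⟨b, hb⟩ := hg
  refine ⟨a + b, ?_⟩
  rw [Polynomial.coe_add]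
  linear_combination ha + hb

theorem HasOrder.C_mul {n : ℕ} {f : F⟦X⟧} (hf : HasOrder x y P n f) (a : F) :
    HasOrder x y P n (C a * f) := by
  obtain ⟨h, hh⟩ := hf
  refine ⟨Polynomial.C a * h, ?_⟩
  rw [Polynomial.coe_mul, Polynomial.coe_C]
  linear_combination C a * hh

theorem HasOrder.sum {ι : Type*} {n : ℕ} (s : Finset ι) {f : ι → F⟦X⟧}
    (h : ∀ i ∈ s, HasOrder x y P n (f i)) : HasOrder x y P n (∑ i ∈ s, f i) := by
  classical
  induction s using Finset.induction_on with
  | empty => exact ⟨0, by simp⟩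
  | insert i s hi ih =>
    rw [Finset.sum_insert hi]
    exact (h i (by simp)).add (ih fun j hj => h j (by simp [hj]))

theorem degree_genPoly
    (hr : x ^ 2 + y ^ 2 ≠ 0) : (genPoly x y).degree = 2 := by
  have h : (2 * (x ^ 2 + y ^ 2) : F) ≠ 0 := mul_ne_zero two_ne_zero hr
  unfold genPoly
  compute_degree!

theorem isCoprime_genPoly_X : IsCoprime (genPoly x y) Polynomial.X :=
  ⟨1, Polynomial.C (2 * (x - y)) - Polynomial.C (2 * (x ^ 2 + y ^ 2)) * Polynomial.X, by
    rw [genPoly]; ring⟩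

/-- The derivative of the generating polynomial with respect to `y`. -/
def genPolyY (y : F) : Polynomial F :=
  Polynomial.X * (Polynomial.C 2 + Polynomial.C (4 * y) * Polynomial.X)

/-- The derivative of the generating polynomial with respect to `x`. -/
def genPolyX (x : F) : Polynomial F :=
  Polynomial.X * (-Polynomial.C 2 + Polynomial.C (4 * x) * Polynomial.X)

/-- The Euler operator applied to the generating polynomial. -/
def genPolyE (x y : F) : Polynomial F :=
  Polynomial.X * (-Polynomial.C (2 * (x - y)) + Polynomial.C (4 * (x ^ 2 + y ^ 2)) * Polynomial.X)

/-- Apart from `X`, the second polynomial has the linear factor `2 + 4 y X`, and a Bézout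
combination of it with `q` equals `2 (x + y)²`; `v` inverts this constant. -/
theorem isCoprime_genPoly_genPolyY
    (hxy : x + y ≠ 0) : IsCoprime (genPoly x y) (genPolyY y) := by
  refine isCoprime_genPoly_X.mul_right ?_
  have hu : IsUnit (Polynomial.C (2 * (x + y) ^ 2)) :=
    Polynomial.isUnit_C.mpr (mul_ne_zero two_ne_zero (pow_ne_zero 2 hxy)).isUnit
  obtain ⟨v, hv⟩ := hu.exists_left_inv
  refine ⟨v * Polynomial.C (4 * y ^ 2), -v * (Polynomial.C (-2 * y * (x - y) - (x ^ 2 + y ^ 2))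
    + Polynomial.C (2 * y * (x ^ 2 + y ^ 2)) * Polynomial.X), ?_⟩
  rw [← hv]
  simp only [genPoly, map_mul, map_add, map_sub, map_pow, map_neg, map_ofNat]
  ring

/-- Here `genPolyE` is `X q'`, and the discriminant of `q` is `-4 (x + y)²`, so `q` is separable. -/
theorem isCoprime_genPoly_genPolyE (hxy : x + y ≠ 0) : IsCoprime (genPoly x y) (genPolyE x y) := by
  refine isCoprime_genPoly_X.mul_right ?_
  have hu : IsUnit (Polynomial.C ((x + y) ^ 2)) :=
    Polynomial.isUnit_C.mpr (pow_ne_zero 2 hxy).isUnit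
  obtain ⟨v, hv⟩ := hu.exists_left_inv
  refine ⟨v * Polynomial.C (2 * (x ^ 2 + y ^ 2)), v * (Polynomial.C ((x - y) / 2)
    - Polynomial.C (x ^ 2 + y ^ 2) * Polynomial.X), ?_⟩
  have h2 : Polynomial.C ((x - y) / 2) * 2 = Polynomial.C (x - y) := by
    rw [← map_ofNat (Polynomial.C : F →+* _) 2, ← map_mul]
    congr 1
    field_simp
  rw [← hv]
  simp only [genPoly, map_mul, map_add, map_sub, map_pow, map_ofNat] at h2 ⊢
  linear_combination (v * (-(Polynomial.C x - Polynomial.C y)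
    + 2 * (Polynomial.C x ^ 2 + Polynomial.C y ^ 2) * Polynomial.X)) * h2

theorem eq_zero_of_genPoly_dvd
    (hr : x ^ 2 + y ^ 2 ≠ 0) {a b : F}
    (h : genPoly x y ∣ Polynomial.C a + Polynomial.C b * Polynomial.X) : a = 0 ∧ b = 0 := by
  have h0 := Polynomial.eq_zero_of_dvd_of_degree_lt h (by
    rw [degree_genPoly hr]
    refine lt_of_le_of_lt (b := 1) ?_ (by norm_num)
    compute_degree)
  constructor
  · simpa using congrArg (fun p => p.coeff 0) h0
  · simpa using congrArg (fun p => p.coeff 1) h0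

variable {Dx Dy : Derivation ℝ F F}

theorem derivation_natCast_mul (D : Derivation ℝ F F) (n : ℕ) (a : F) :
    D (n * a) = n * D a := by
  simp [Derivation.leibniz]

theorem derivation_genPoly (D : Derivation ℝ F F) : powerDer D (genPoly x y : F⟦X⟧) =
    ((Polynomial.C (-(2 * (D x - D y))) * Polynomial.X
      + Polynomial.C (4 * (x * D x + y * D y)) * Polynomial.X ^ 2 : Polynomial F) : F⟦X⟧) := by
  have h2 (a : F) : D (2 * a) = 2 * D a := derivation_natCast_mul D 2 a
  ext n
  rw [coeff_powerDer, Polynomial.coeff_coe, Polynomial.coeff_coe]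
  simp only [genPoly, Polynomial.coeff_add, Polynomial.coeff_sub, Polynomial.coeff_C_mul,
    Polynomial.coeff_X_pow, Polynomial.coeff_X, Polynomial.coeff_one]
  rcases n with _ | _ | _ | n <;> simp [h2, Derivation.leibniz_pow]
  · ring

theorem powerDer_genPoly_y
    (hyx : Dy x = 0) (hyy : Dy y = 1) : powerDer Dy (genPoly x y : F⟦X⟧) = genPolyY y := by
  rw [derivation_genPoly, hyx, hyy, genPolyY]
  congr 1
  simp only [zero_sub, mul_neg, mul_one, neg_neg, mul_zero, zero_add]
  ring

theorem powerDer_genPoly_x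
    (hxx : Dx x = 1) (hxy' : Dx y = 0) : powerDer Dx (genPoly x y : F⟦X⟧) = genPolyX x := by
  rw [derivation_genPoly, hxx, hxy', genPolyX]
  congr 1
  simp only [sub_zero, mul_one, mul_zero, add_zero, map_neg]
  ring

theorem powerEuler_genPoly : powerEuler F (genPoly x y : F⟦X⟧) = genPolyE x y := by
  ext n
  rw [coeff_powerEuler, Polynomial.coeff_coe, Polynomial.coeff_coe, genPolyE, mul_add,
    mul_left_comm Polynomial.X (Polynomial.C _), mul_neg, mul_comm Polynomial.X (Polynomial.C _),
    ← pow_two]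
  simp only [genPoly, Polynomial.coeff_add, Polynomial.coeff_sub, Polynomial.coeff_C_mul,
    Polynomial.coeff_X_pow, Polynomial.coeff_X, Polynomial.coeff_one, Polynomial.coeff_neg]
  rcases n with _ | _ | _ | n <;> simp
  ring

theorem rep_iterate_y (hyx : Dy x = 0) (hyy : Dy y = 1) (hP : IsLegendre x y P) (n : ℕ) :
    Rep x y P n (repCoeff F n) (genPolyY y ^ n) ((powerDer Dy)^[n] (PowerSeries.mk P)) := by
  simpa using rep_iterate hP (preservesPoly_powerDer Dy) (powerDer_genPoly_y hyx hyy) rep_mk n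

theorem rep_iterate_xy
    (hxx : Dx x = 1) (hxy' : Dx y = 0) (hyx : Dy x = 0) (hyy : Dy y = 1) (hP : IsLegendre x y P) (n : ℕ) :
    Rep x y P (n + 1) (repCoeff F (n + 1)) (genPolyX x * genPolyY y ^ n)
      ((powerDer Dy)^[n] (powerDer Dx (PowerSeries.mk P))) := by
  have h := rep_iterate hP (preservesPoly_powerDer Dx) (powerDer_genPoly_x hxx hxy')
    (rep_mk (x := x) (y := y) (P := P)) 1
  simp only [one_mul, pow_one, Function.iterate_one, add_zero] at h
  exact rep_iterate hP (preservesPoly_powerDer Dy) (powerDer_genPoly_y hyx hyy) h n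

/-- No linear differential operator in the internal jet coordinates annihilates all polynomial
solutions. -/
theorem jets_linearIndependent
    (hxy : x + y ≠ 0) (hr : x ^ 2 + y ^ 2 ≠ 0) (hxx : Dx x = 1) (hxy' : Dx y = 0) (hyx : Dy x = 0) (hyy : Dy y = 1) (hP : IsLegendre x y P) (n : ℕ) (a b : ℕ → F)
    (h : ∀ k, ∑ i ∈ Finset.range (n + 1), a i * Dy^[i] (P k)
      + ∑ i ∈ Finset.range n, b i * Dy^[i] (Dx (P k)) = 0) :
    (∀ i ≤ n, a i = 0) ∧ ∀ i < n, b i = 0 := by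
  induction n with
  | zero =>
    have h0 := h 0
    simp only [zero_add, Finset.range_one, Finset.sum_singleton, Finset.range_zero,
      Finset.sum_empty, add_zero, Function.iterate_zero_apply, hP.zero, mul_one] at h0
    exact ⟨fun i hi => by rwa [Nat.le_zero.mp hi], fun i hi => absurd hi (Nat.not_lt_zero i)⟩
  | succ n ih =>
    set G : F⟦X⟧ := PowerSeries.mk P with hG
    set low : F⟦X⟧ := ∑ i ∈ Finset.range (n + 1), C (a i) * (powerDer Dy)^[i] G
      + ∑ i ∈ Finset.range n, C (b i) * (powerDer Dy)^[i] (powerDer Dx G) with hlow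
    have hsum : low + (C (a (n + 1)) * (powerDer Dy)^[n + 1] G
        + C (b n) * (powerDer Dy)^[n] (powerDer Dx G)) = 0 := by
      ext k
      have := h k
      rw [Finset.sum_range_succ _ (n + 1),
        Finset.sum_range_succ (fun i => b i * Dy^[i] (Dx (P k))) n] at this
      simp only [hlow, map_add, map_sum, coeff_C_mul, coeff_iterate_powerDer, coeff_powerDer, hG,
        coeff_mk, map_zero]
      linear_combination this
    have hord : HasOrder x y P n low := by
      refine (HasOrder.sum _ fun i hi => ?_).add (HasOrder.sum _ fun i hi => ?_)
      · exact ((rep_iterate_y hyx hyy hP i).hasOrder.mono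
          (Nat.lt_succ_iff.mp (Finset.mem_range.mp hi))).C_mul _
      · exact ((rep_iterate_xy hxx hxy' hyx hyy hP i).hasOrder.mono
          (Finset.mem_range.mp hi)).C_mul _
    obtain ⟨hl, hhl⟩ := hord
    obtain ⟨h1, hh1, s1, hs1⟩ := rep_iterate_y hyx hyy hP (n + 1)
    obtain ⟨h2, hh2, s2, hs2⟩ := rep_iterate_xy hxx hxy' hyx hyy hP n
    have hpoly : genPoly x y * hl + (Polynomial.C (a (n + 1)) * h1 + Polynomial.C (b n) * h2) = 0 := by
      apply Polynomial.coe_injective F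
      apply mul_right_cancel₀ hP.mk_ne_zero
      rw [Polynomial.coe_add, Polynomial.coe_add, Polynomial.coe_mul, Polynomial.coe_mul,
        Polynomial.coe_mul, Polynomial.coe_C, Polynomial.coe_C, Polynomial.coe_zero, zero_mul]
      linear_combination -(genPoly x y : F⟦X⟧) * hhl - C (a (n + 1)) * hh1 - C (b n) * hh2
        + (genPoly x y : F⟦X⟧) ^ (n + 1) * hsum
    -- Multiplied by `q ^ (n + 1)` and taken modulo `q`, the relation retains only its two terms of
    -- top order. The factors `genPolyY` and `X` are coprime to `q`, so the linear factor vanishes: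
    -- `a = b` and `b (x + y) = 0` for the top coefficients.
    have hdvd : genPoly x y ∣ genPolyY y ^ n * (Polynomial.X * (Polynomial.C (repCoeff F (n + 1))
        * (Polynomial.C (2 * (a (n + 1) - b n))
          + Polynomial.C (4 * (a (n + 1) * y + b n * x)) * Polynomial.X))) := by
      refine ⟨-hl - Polynomial.C (a (n + 1)) * s1 - Polynomial.C (b n) * s2, ?_⟩
      have e : Polynomial.X * (Polynomial.C (2 * (a (n + 1) - b n))
          + Polynomial.C (4 * (a (n + 1) * y + b n * x)) * Polynomial.X)
          = Polynomial.C (a (n + 1)) * genPolyY y + Polynomial.C (b n) * genPolyX x := by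
        simp only [genPolyX, genPolyY, map_mul, map_add, map_sub, map_ofNat]
        ring
      rw [mul_left_comm Polynomial.X, e]
      linear_combination hpoly - Polynomial.C (a (n + 1)) * hs1 - Polynomial.C (b n) * hs2
    have hd1 := ((isCoprime_genPoly_genPolyY hxy).pow_right).dvd_of_dvd_mul_left hdvd
    have hd2 := isCoprime_genPoly_X.dvd_of_dvd_mul_left hd1
    rw [mul_add, ← mul_assoc, ← map_mul, ← map_mul] at hd2
    obtain ⟨ha, hb⟩ := eq_zero_of_genPoly_dvd hr hd2
    have hc := repCoeff_ne_zero (F := F) (n + 1)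
    simp only [mul_eq_zero, hc, OfNat.ofNat_ne_zero, false_or] at ha hb
    have hab : a (n + 1) = b n := sub_eq_zero.mp ha
    have hb0 : b n = 0 := by
      rw [hab, ← mul_add, add_comm y, mul_eq_zero] at hb
      exact hb.resolve_right hxy
    rw [hb0] at hab
    have := ih (fun k => by
      have := h k
      rw [Finset.sum_range_succ _ (n + 1),
        Finset.sum_range_succ (fun i => b i * Dy^[i] (Dx (P k))) n, hab, hb0] at this
      simpa using this)
    refine ⟨fun i hi => ?_, fun i hi => ?_⟩
    · rcases Nat.le_succ_iff.mp hi with hi | rfl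
      · exact this.1 i hi
      · exact hab
    · rcases Nat.lt_succ_iff_lt_or_eq.mp hi with hi | rfl
      · exact this.2 i hi
      · exact hb0

/-- Multiplication of the coefficients of the generating function by the values of a polynomial
raises the order by the degree of the polynomial. -/
theorem natDegree_le_of_hasOrder
    (hxy : x + y ≠ 0) (hr : x ^ 2 + y ^ 2 ≠ 0) (hP : IsLegendre x y P) {n : ℕ} {L : F⟦X⟧}
    (hL : HasOrder x y P n L) (c : Polynomial F) (i j : ℕ)
    (h : X ^ i * L = X ^ j * PowerSeries.mk fun m => c.eval (m : F) * P m) : c.natDegree ≤ n := by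
  by_contra hlt
  rw [not_le] at hlt
  obtain ⟨N, hN⟩ : ∃ N, c.natDegree = N + 1 := ⟨c.natDegree - 1, by omega⟩
  have hrep (m : ℕ) : Rep x y P m (repCoeff F m) (genPolyE x y ^ m) ((powerEuler F)^[m] (PowerSeries.mk P)) := by
    simpa using rep_iterate hP preservesPoly_powerEuler powerEuler_genPoly rep_mk m
  -- The Euler operator multiplies the `m`-th coefficient by `m`, so the series is `c` of the Euler
  -- operator, applied to `G`.
  have hexp : (PowerSeries.mk fun m => c.eval (m : F) * P m) =
      ∑ m ∈ Finset.range (N + 1), C (c.coeff m) * (powerEuler F)^[m] (PowerSeries.mk P)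
        + C (c.coeff (N + 1)) * (powerEuler F)^[N + 1] (PowerSeries.mk P) := by
    rw [← Finset.sum_range_succ (fun m => C (c.coeff m) * (powerEuler F)^[m] (PowerSeries.mk P))]
    ext k
    simp only [map_sum, coeff_C_mul, coeff_iterate_powerEuler, coeff_mk]
    rw [Polynomial.eval_eq_sum_range, hN, Finset.sum_mul]
    exact Finset.sum_congr rfl fun m _ => by ring
  have hord : HasOrder x y P N (∑ m ∈ Finset.range (N + 1), C (c.coeff m) * (powerEuler F)^[m] (PowerSeries.mk P)) :=
    HasOrder.sum _ fun m hm => ((hrep m).hasOrder.mono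
      (Nat.lt_succ_iff.mp (Finset.mem_range.mp hm))).C_mul _
  obtain ⟨hl, hhl⟩ := hord
  obtain ⟨h1, hh1, s1, hs1⟩ := hrep (N + 1)
  obtain ⟨h2, hh2⟩ := hL.mono (show n ≤ N by omega)
  rw [hexp] at h
  have hpoly : Polynomial.X ^ i * (genPoly x y * h2)
      = Polynomial.X ^ j * (genPoly x y * hl + Polynomial.C (c.coeff (N + 1)) * h1) := by
    apply Polynomial.coe_injective F
    apply mul_right_cancel₀ hP.mk_ne_zero
    rw [Polynomial.coe_mul, Polynomial.coe_mul, Polynomial.coe_mul, Polynomial.coe_add,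
      Polynomial.coe_mul, Polynomial.coe_mul, Polynomial.coe_C, Polynomial.coe_pow,
      Polynomial.coe_pow, Polynomial.coe_X]
    linear_combination -(genPoly x y : F⟦X⟧) * X ^ i * hh2 + (genPoly x y : F⟦X⟧) ^ (N + 1) * h
      + X ^ j * ((genPoly x y : F⟦X⟧) * hhl + C (c.coeff (N + 1)) * hh1)
  -- All terms except the one of top degree `N + 1` in the Euler operator disappear modulo `q`.
  -- Coprimality of `q` with `X` and `genPolyE` then kills the leading coefficient of `c`.
  have hdvd : genPoly x y ∣ Polynomial.X ^ j * (genPolyE x y ^ (N + 1) *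
      (Polynomial.C (c.coeff (N + 1) * repCoeff F (N + 1)) + Polynomial.C 0 * Polynomial.X)) := by
    refine ⟨Polynomial.X ^ i * h2 - Polynomial.X ^ j * hl
      - Polynomial.X ^ j * (Polynomial.C (c.coeff (N + 1)) * s1), ?_⟩
    rw [map_mul, map_zero]
    linear_combination -hpoly - Polynomial.X ^ j * Polynomial.C (c.coeff (N + 1)) * hs1
  have hd1 := (isCoprime_genPoly_X.pow_right).dvd_of_dvd_mul_left hdvd
  have hd2 := ((isCoprime_genPoly_genPolyE hxy).pow_right).dvd_of_dvd_mul_left hd1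
  obtain ⟨h0, -⟩ := eq_zero_of_genPoly_dvd hr hd2
  rw [mul_eq_zero, or_iff_left (repCoeff_ne_zero _), ← hN, ← Polynomial.leadingCoeff,
    Polynomial.leadingCoeff_eq_zero] at h0
  rw [h0] at hN
  simp at hN

end Generating

end
end EulerDarboux

/-! ### Differential calculus in the field of rational functions of the jets. -/

namespace EulerDarboux
noncomputable section

/-! ### Partial derivatives of polynomials -/

section Polynomials

variable {σ : Type*}

theorem totalDegree_pderiv_lt {p : MvPolynomial σ ℝ} {c : σ} (h : MvPolynomial.pderiv c p ≠ 0) :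
    (MvPolynomial.pderiv c p).totalDegree < p.totalDegree := by
  have key : ∀ m ∈ (MvPolynomial.pderiv c p).support, (m.sum fun _ e => e) + 1 ≤ p.totalDegree := by
    intro m hm
    rw [MvPolynomial.mem_support_iff, MvPolynomial.coeff_pderiv] at hm
    have h1 := MvPolynomial.le_totalDegree
      (MvPolynomial.mem_support_iff.mpr (left_ne_zero_of_mul hm))
    rw [Finsupp.sum_add_index' (fun _ => rfl) (fun _ _ _ => rfl)] at h1
    simpa using h1
  obtain ⟨m, hm⟩ := MvPolynomial.support_nonempty.mpr h
  have h0 := key m hm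
  have : (MvPolynomial.pderiv c p).totalDegree ≤ p.totalDegree - 1 :=
    Finset.sup_le fun m hm => by have := key m hm; omega
  omega

/-- In characteristic zero a variable that occurs is seen by its derivative: a monomial containing
it is multiplied by a positive exponent. -/
theorem mem_supported_of_pderiv {p : MvPolynomial σ ℝ} {s : Set σ}
    (h : ∀ c ∉ s, MvPolynomial.pderiv c p = 0) : p ∈ MvPolynomial.supported ℝ s := by
  rw [MvPolynomial.mem_supported]
  intro c hc
  by_contra hcs
  obtain ⟨d, hd, hcd⟩ := (MvPolynomial.mem_vars_iff_mem_support c).mp (Finset.mem_coe.mp hc)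
  have h0 := congrArg (MvPolynomial.coeff (d - Finsupp.single c 1)) (h c hcs)
  have hle : Finsupp.single c 1 ≤ d := by
    rw [Finsupp.single_le_iff]
    exact Nat.one_le_iff_ne_zero.mpr (Finsupp.mem_support_iff.mp hcd)
  rw [MvPolynomial.coeff_pderiv, tsub_add_cancel_of_le hle, MvPolynomial.coeff_zero,
    mul_eq_zero] at h0
  rcases h0 with h0 | h0
  · exact MvPolynomial.mem_support_iff.mp hd h0
  · exact absurd h0 (by positivity)

/-- The chain rule for a derivation composed with an evaluation of polynomials. -/
theorem derivation_aeval {A : Type*} [CommRing A] [Algebra ℝ A] (D : Derivation ℝ A A) (g : σ → A)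
    (T : Finset σ) {p : MvPolynomial σ ℝ} (hp : p ∈ MvPolynomial.supported ℝ (T : Set σ)) :
    D (MvPolynomial.aeval g p) =
      ∑ c ∈ T, MvPolynomial.aeval g (MvPolynomial.pderiv c p) * D (g c) := by
  classical
  rw [MvPolynomial.supported_eq_adjoin_X] at hp
  induction hp using Algebra.adjoin_induction with
  | mem p hp =>
    obtain ⟨c, hc, rfl⟩ := hp
    rw [Finset.sum_eq_single c]
    · simp
    · intro d _ hd
      rw [MvPolynomial.pderiv_X_of_ne hd.symm, map_zero, zero_mul]
    · exact fun h => absurd hc h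
  | algebraMap r =>
    rw [AlgHom.commutes, D.map_algebraMap]
    exact (Finset.sum_eq_zero fun c _ => by
      rw [MvPolynomial.algebraMap_eq, MvPolynomial.pderiv_C, map_zero, zero_mul]).symm
  | add p q _ _ hp hq =>
    simp only [map_add, hp, hq, add_mul, Finset.sum_add_distrib]
  | mul p q _ _ hp hq =>
    simp only [map_mul, map_add, Derivation.leibniz, smul_eq_mul, hp, hq, Finset.mul_sum]
    rw [← Finset.sum_add_distrib]
    exact Finset.sum_congr rfl fun c _ => by ring

end Polynomials

/-! ### Partial derivatives of rational functions -/

instance : DecidableEq Coord := Classical.decEq _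

/-- The partial derivative with respect to a coordinate. -/
def partialD (c : Coord) : Derivation ℝ RatFun RatFun := vectorField (Pi.single c 1)

theorem partialD_coord (c d : Coord) : partialD c (coord d) = if d = c then 1 else 0 := by
  rw [partialD, vectorField_coord, Pi.single_apply]

theorem partialD_self (c : Coord) : partialD c (coord c) = 1 := by simp [partialD_coord]

theorem partialD_of_ne {c d : Coord} (h : d ≠ c) : partialD c (coord d) = 0 := by
  simp [partialD_coord, h]

theorem partialD_algebraMap (c : Coord) (p : MvPolynomial Coord ℝ) :
    partialD c (algebraMap _ RatFun p) = algebraMap _ RatFun (MvPolynomial.pderiv c p) := by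
  induction p using MvPolynomial.induction_on with
  | C a =>
    rw [MvPolynomial.pderiv_C, map_zero, ← MvPolynomial.algebraMap_eq,
      ← IsScalarTower.algebraMap_apply ℝ (MvPolynomial Coord ℝ) RatFun, Derivation.map_algebraMap]
  | add p q hp hq => simp only [map_add, hp, hq]
  | mul_X p d hp =>
    rw [map_mul, Derivation.leibniz, hp, Derivation.leibniz]
    change _ • partialD c (coord d) + _ = _
    rw [partialD_coord]
    by_cases h : d = c
    · subst h
      simp
    · simp [h, MvPolynomial.pderiv_X_of_ne h]

/-- The coordinates of order at most `n`, where `u_{x,ky}` has order `k + 1`. -/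
def coordsLE (n : ℕ) : Finset Coord :=
  {.x, .y} ∪ (Finset.range (n + 1)).image .u ∪ (Finset.range n).image .ux

theorem mem_coordsLE_u {n k : ℕ} : Coord.u k ∈ coordsLE n ↔ k ≤ n := by
  simp [coordsLE]

theorem mem_coordsLE_ux {n k : ℕ} : Coord.ux k ∈ coordsLE n ↔ k < n := by
  simp [coordsLE]

theorem sum_coordsLE {M : Type*} [AddCommMonoid M] (n : ℕ) (f : Coord → M) :
    ∑ c ∈ coordsLE n, f c = f .x + f .y + ∑ i ∈ Finset.range (n + 1), f (.u i)
      + ∑ i ∈ Finset.range n, f (.ux i) := by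
  rw [coordsLE, Finset.sum_union, Finset.sum_union, Finset.sum_image, Finset.sum_image,
    Finset.sum_pair]
  · simp
  · simp
  · simp
  · rw [Finset.disjoint_left]
    intro c hc
    simp at hc ⊢
    rcases hc with rfl | rfl <;> simp
  · rw [Finset.disjoint_left]
    intro c hc
    simp at hc ⊢
    rcases hc with rfl | rfl | ⟨k, -, rfl⟩ <;> simp

theorem coordsLE_mono {m n : ℕ} (h : m ≤ n) : coordsLE m ⊆ coordsLE n := by
  rintro (_ | _ | k | k) hc
  · simp [coordsLE]
  · simp [coordsLE]
  · rw [mem_coordsLE_u] at hc ⊢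
    omega
  · rw [mem_coordsLE_ux] at hc ⊢
    omega

theorem exists_subset_coordsLE (T : Finset Coord) : ∃ n, T ⊆ coordsLE n := by
  induction T using Finset.induction_on with
  | empty => exact ⟨0, by simp⟩
  | insert c T _ ih =>
    obtain ⟨n, hn⟩ := ih
    obtain ⟨m, hm⟩ : ∃ m, c ∈ coordsLE m := by
      rcases c with _ | _ | k | k
      · exact ⟨0, by simp [coordsLE]⟩
      · exact ⟨0, by simp [coordsLE]⟩
      · exact ⟨k, mem_coordsLE_u.mpr le_rfl⟩
      · exact ⟨k + 1, mem_coordsLE_ux.mpr (by omega)⟩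
    exact ⟨max m n, Finset.insert_subset (coordsLE_mono (le_max_left _ _) hm)
      (hn.trans (coordsLE_mono (le_max_right _ _)))⟩

/-- Rational functions of the coordinates of order at most `n`. -/
def OrderLE (n : ℕ) (q : RatFun) : Prop :=
  ∃ a b : MvPolynomial Coord ℝ, a ∈ MvPolynomial.supported ℝ (coordsLE n : Set Coord) ∧
    b ∈ MvPolynomial.supported ℝ (coordsLE n : Set Coord) ∧
      q = algebraMap _ RatFun a / algebraMap _ RatFun b

theorem OrderLE.mono {m n : ℕ} (h : m ≤ n) {q : RatFun} : OrderLE m q → OrderLE n q := by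
  rintro ⟨a, b, ha, hb, rfl⟩
  have hs := MvPolynomial.supported_mono (R := ℝ) (Finset.coe_subset.mpr (coordsLE_mono h))
  exact ⟨a, b, hs ha, hs hb, rfl⟩

theorem exists_orderLE (q : RatFun) : ∃ n, OrderLE n q := by
  obtain ⟨a, b, -, rfl⟩ := IsFractionRing.div_surjective (A := MvPolynomial Coord ℝ) q
  obtain ⟨n, hn⟩ := exists_subset_coordsLE (a.vars ∪ b.vars)
  refine ⟨n, a, b, ?_, ?_, rfl⟩ <;> rw [MvPolynomial.mem_supported, Finset.coe_subset]
  · exact Finset.subset_union_left.trans hn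
  · exact Finset.subset_union_right.trans hn

theorem exists_orderLE_finset (T : Finset RatFun) : ∃ n, ∀ q ∈ T, OrderLE n q := by
  choose f hf using exists_orderLE
  exact ⟨T.sup f, fun q hq => (hf q).mono (Finset.le_sup hq)⟩

/-- The chain rule for a derivation composed with a substitution into rational functions. -/
theorem OrderLE.derivation_apply {n : ℕ} {q : RatFun} (hq : OrderLE n q) {A : Type*} [Field A]
    [Algebra ℝ A] (s : RatFun →ₐ[ℝ] A) (D : Derivation ℝ A A) :
    D (s q) = ∑ c ∈ coordsLE n, s (partialD c q) * D (s (coord c)) := by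
  obtain ⟨a, b, ha, hb, rfl⟩ := hq
  have hs (p : MvPolynomial Coord ℝ) :
      s (algebraMap _ RatFun p) = MvPolynomial.aeval (fun c => s (coord c)) p := by
    have : s.comp (IsScalarTower.toAlgHom ℝ (MvPolynomial Coord ℝ) RatFun)
        = MvPolynomial.aeval (fun c => s (coord c)) := by
      apply MvPolynomial.algHom_ext
      intro c
      rw [MvPolynomial.aeval_X]
      rfl
    exact DFunLike.congr_fun this p
  rw [map_div₀, Derivation.leibniz_div]
  simp only [Derivation.leibniz_div, partialD_algebraMap, smul_eq_mul, map_mul, map_sub, map_pow,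
    map_inv₀, hs, derivation_aeval D _ _ ha, derivation_aeval D _ _ hb]
  rw [Finset.mul_sum, Finset.mul_sum, ← Finset.sum_sub_distrib, Finset.mul_sum]
  exact Finset.sum_congr rfl fun c _ => by ring

theorem OrderLE.derivation_eq {n : ℕ} {q : RatFun} (hq : OrderLE n q)
    (D : Derivation ℝ RatFun RatFun) :
    D q = ∑ c ∈ coordsLE n, partialD c q * D (coord c) :=
  hq.derivation_apply (AlgHom.id ℝ RatFun) D

theorem OrderLE.partialD_eq_zero {n : ℕ} {q : RatFun} (hq : OrderLE n q) {c : Coord}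
    (hc : c ∉ coordsLE n) : partialD c q = 0 := by
  rw [hq.derivation_eq (partialD c)]
  refine Finset.sum_eq_zero fun d hd => ?_
  rw [partialD_of_ne (by rintro rfl; exact hc hd), mul_zero]

/-- Derivations of two fields compatible on coordinates are compatible. -/
theorem derivation_apply_of_coord {A : Type*} [Field A] [Algebra ℝ A] (s : RatFun →ₐ[ℝ] A)
    (D : Derivation ℝ A A) (E : Derivation ℝ RatFun RatFun)
    (h : ∀ c, D (s (coord c)) = s (E (coord c))) (q : RatFun) : D (s q) = s (E q) := by
  obtain ⟨n, hn⟩ := exists_orderLE q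
  simp only [hn.derivation_apply s D, hn.derivation_eq E, map_sum, map_mul, h]

/-- The rational functions of the base coordinates. -/
def baseField : IntermediateField ℝ RatFun := IntermediateField.adjoin ℝ {coord .x, coord .y}

theorem x_mem_baseField : coord .x ∈ baseField := IntermediateField.subset_adjoin _ _ (by simp)

theorem y_mem_baseField : coord .y ∈ baseField := IntermediateField.subset_adjoin _ _ (by simp)

/-- A rational function whose partial derivatives with respect to the jet coordinates vanish
depends on the base coordinates only. -/
theorem mem_baseField_of_partialD {q : RatFun}
    (h : ∀ c, c ≠ .x → c ≠ .y → partialD c q = 0) : q ∈ baseField := by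
  obtain ⟨a, b, hab, hq⟩ := IsFractionRing.exists_reduced_fraction (A := MvPolynomial Coord ℝ) q
  have hb0 : (b : MvPolynomial Coord ℝ) ≠ 0 := nonZeroDivisors.coe_ne_zero b
  have hinj := IsFractionRing.injective (MvPolynomial Coord ℝ) RatFun
  have hbm : algebraMap _ RatFun (b : MvPolynomial Coord ℝ) ≠ 0 := by
    rwa [Ne, IsFractionRing.to_map_eq_zero_iff]
  rw [IsFractionRing.mk'_eq_div] at hq
  subst hq
  have hmain : ∀ c, c ≠ .x → c ≠ .y → MvPolynomial.pderiv c a = 0 ∧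
      MvPolynomial.pderiv c (b : MvPolynomial Coord ℝ) = 0 := by
    intro c hx hy
    have h1 := h c hx hy
    rw [Derivation.leibniz_div, partialD_algebraMap, partialD_algebraMap, smul_eq_mul, mul_eq_zero,
      or_iff_right (pow_ne_zero _ (inv_ne_zero hbm)), sub_eq_zero, smul_eq_mul, smul_eq_mul,
      ← map_mul, ← map_mul] at h1
    have h2 := hinj h1
    -- For a reduced fraction, `b ∂a = a ∂b` makes `b` divide `∂b`, whose total degree is smaller;
    -- so `∂b = 0`, and then `∂a = 0`.
    have hdvd : (b : MvPolynomial Coord ℝ) ∣ MvPolynomial.pderiv c (b : MvPolynomial Coord ℝ) :=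
      hab.symm.dvd_of_dvd_mul_left ⟨_, h2.symm⟩
    have hb : MvPolynomial.pderiv c (b : MvPolynomial Coord ℝ) = 0 := by
      by_contra hne
      obtain ⟨e, he⟩ := hdvd
      have hlt := totalDegree_pderiv_lt hne
      have he0 : e ≠ 0 := by
        rintro rfl
        exact hne (by rw [he, mul_zero])
      rw [he, MvPolynomial.totalDegree_mul_of_isDomain hb0 he0] at hlt
      omega
    rw [hb, mul_zero, mul_eq_zero, or_iff_right hb0] at h2
    exact ⟨h2, hb⟩
  have hmem : ∀ p : MvPolynomial Coord ℝ, (∀ c, c ≠ .x → c ≠ .y → MvPolynomial.pderiv c p = 0) →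
      algebraMap _ RatFun p ∈ baseField := by
    intro p hp
    have hs : p ∈ MvPolynomial.supported ℝ ({.x, .y} : Set Coord) :=
      mem_supported_of_pderiv fun c hc => by
        simp only [Set.mem_insert_iff, Set.mem_singleton_iff, not_or] at hc
        exact hp c hc.1 hc.2
    rw [MvPolynomial.supported_eq_adjoin_X] at hs
    clear hp
    induction hs using Algebra.adjoin_induction with
    | mem p hp =>
      obtain ⟨c, hc, rfl⟩ := hp
      rcases hc with rfl | rfl
      · exact x_mem_baseField
      · exact y_mem_baseField
    | algebraMap r =>
      rw [← IsScalarTower.algebraMap_apply ℝ (MvPolynomial Coord ℝ) RatFun]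
      exact baseField.algebraMap_mem r
    | add p q _ _ hp hq => rw [map_add]; exact add_mem hp hq
    | mul p q _ _ hp hq => rw [map_mul]; exact mul_mem hp hq
  exact div_mem (hmem _ fun c hx hy => (hmain c hx hy).1) (hmem _ fun c hx hy => (hmain c hx hy).2)

/-- A derivation vanishing on the base coordinates vanishes on their rational functions. -/
theorem derivation_eq_zero_of_mem_baseField {D : Derivation ℝ RatFun RatFun}
    (hx : D (coord .x) = 0) (hy : D (coord .y) = 0) {q : RatFun} (hq : q ∈ baseField) : D q = 0 := by
  induction hq using IntermediateField.adjoin_induction with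
  | mem q hq =>
    rcases hq with rfl | rfl
    · exact hx
    · exact hy
  | algebraMap r => exact D.map_algebraMap r
  | add p q _ _ hp hq => rw [map_add, hp, hq, add_zero]
  | mul p q _ _ hp hq => rw [Derivation.leibniz, hp, hq, smul_zero, smul_zero, add_zero]
  | inv q _ hq => rw [Derivation.leibniz_inv, hq, smul_zero]

end
end EulerDarboux

/-! ### Embedding of the rational functions by substitution of a generic solution. -/

namespace EulerDarboux
noncomputable section

open HahnSeries

/-! ### The generic solution -/

section Parameters

variable {K : Type*} [Field K] [Algebra ℝ K] [CharZero K]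

/-- A derivation of the coefficient field acting on expansions. -/
def paramDer (d : Derivation ℝ K K) :
    Derivation ℝ (HahnSeries ℤ (HahnSeries ℤ K)) (HahnSeries ℤ (HahnSeries ℤ K)) :=
  coeffDer (coeffDer d)

theorem coeff_paramDer (d : Derivation ℝ K K) (F : HahnSeries ℤ (HahnSeries ℤ K)) (n i : ℤ) :
    ((paramDer d F).coeff n).coeff i = d ((F.coeff n).coeff i) := by
  rw [paramDer, coeff_coeffDer, coeff_coeffDer]

theorem derivation_intCast_mul (d : Derivation ℝ K K) (m : ℤ) (a : K) :
    d (m * a) = m * d a := by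
  rw [Derivation.leibniz, Derivation.map_intCast, smul_zero, add_zero, smul_eq_mul]

theorem paramDer_Dr (d : Derivation ℝ K K) (F : HahnSeries ℤ (HahnSeries ℤ K)) :
    paramDer d (Dr F) = Dr (paramDer d F) := by
  apply ext_coeff
  intro n i
  have := derivation_intCast_mul d (i + 1)
  push_cast at this
  rw [coeff_Dr, coeff_paramDer, coeff_paramDer, coeff_Dr, this]

theorem paramDer_Dt (d : Derivation ℝ K K) (F : HahnSeries ℤ (HahnSeries ℤ K)) :
    paramDer d (Dt F) = Dt (paramDer d F) := by
  apply ext_coeff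
  intro n i
  have := derivation_intCast_mul d (n + 1 - i)
  push_cast at this
  rw [coeff_Dt, coeff_paramDer, coeff_paramDer, coeff_Dt, this]

theorem paramDer_SDx (d : Derivation ℝ K K) (F : HahnSeries ℤ (HahnSeries ℤ K)) :
    paramDer d (SDx F) = SDx (paramDer d F) := by
  rw [SDx, Derivation.add_apply, Derivation.add_apply, map_add, paramDer_Dr, paramDer_Dt]

theorem paramDer_SDy (d : Derivation ℝ K K) (F : HahnSeries ℤ (HahnSeries ℤ K)) :
    paramDer d (SDy F) = SDy (paramDer d F) := by
  rw [SDy, Derivation.sub_apply, Derivation.sub_apply, map_sub, paramDer_Dr, paramDer_Dt]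

theorem paramDer_serR (d : Derivation ℝ K K) : paramDer d serR = 0 := by
  rw [paramDer, serR, coeffDer_single, coeffDer_single, d.map_one_eq_zero, map_zero, map_zero]

theorem paramDer_serT (d : Derivation ℝ K K) : paramDer d serT = 0 := by
  rw [paramDer, serT, coeffDer_single, Derivation.map_one_eq_zero, map_zero]

/-- Derivations are linear over rational numbers. -/
theorem derivation_half {A : Type*} [Field A] [Algebra ℝ A] (D : Derivation ℝ A A) (a : A) :
    D (2⁻¹ * a) = 2⁻¹ * D a := by
  have h : D 2 = 0 := D.map_natCast 2
  rw [Derivation.leibniz, Derivation.leibniz_inv, h, smul_zero, smul_zero, add_zero, smul_eq_mul]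

variable (K) in
/-- The expansion of `x`. -/
def serX : HahnSeries ℤ (HahnSeries ℤ K) := 2⁻¹ * (serR + serT)

variable (K) in
/-- The expansion of `y`. -/
def serY : HahnSeries ℤ (HahnSeries ℤ K) := 2⁻¹ * (serR - serT)

theorem serX_add_serY : serX K + serY K = serR := by
  rw [serX, serY]
  ring

theorem serX_sub_serY : serX K - serY K = serT := by
  rw [serX, serY]
  ring

theorem SDx_serX : SDx (serX K) = 1 := by
  rw [serX, derivation_half, map_add, SDx, Derivation.add_apply, Derivation.add_apply, Dr_serR,
    Dt_serR, Dr_serT, Dt_serT]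
  ring

theorem SDx_serY : SDx (serY K) = 0 := by
  rw [serY, derivation_half, map_sub, SDx, Derivation.add_apply, Derivation.add_apply, Dr_serR,
    Dt_serR, Dr_serT, Dt_serT]
  ring

theorem SDy_serX : SDy (serX K) = 0 := by
  rw [serX, derivation_half, map_add, SDy, Derivation.sub_apply, Derivation.sub_apply, Dr_serR,
    Dt_serR, Dr_serT, Dt_serT]
  ring

theorem SDy_serY : SDy (serY K) = 1 := by
  rw [serY, derivation_half, map_sub, SDy, Derivation.sub_apply, Derivation.sub_apply, Dr_serR,
    Dt_serR, Dr_serT, Dt_serT]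
  ring

theorem paramDer_serX (d : Derivation ℝ K K) : paramDer d (serX K) = 0 := by
  rw [serX, derivation_half, map_add, paramDer_serR, paramDer_serT, add_zero, mul_zero]

theorem paramDer_serY (d : Derivation ℝ K K) : paramDer d (serY K) = 0 := by
  rw [serY, derivation_half, map_sub, paramDer_serR, paramDer_serT, sub_zero, mul_zero]

theorem serR_ne_zero : (serR : HahnSeries ℤ (HahnSeries ℤ K)) ≠ 0 := by
  simp [serR]

theorem serX_add_serY_ne_zero : serX K + serY K ≠ 0 := by
  rw [serX_add_serY]
  exact serR_ne_zero

theorem two_mul_sq_serX_add_sq_serY : 2 * (serX K ^ 2 + serY K ^ 2) = serR ^ 2 + serT ^ 2 := by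
  rw [← serX_add_serY, ← serX_sub_serY]
  ring

theorem sq_serX_add_sq_serY_ne_zero : serX K ^ 2 + serY K ^ 2 ≠ 0 := by
  intro h
  have h0 : (serR ^ 2 + serT ^ 2 : HahnSeries ℤ (HahnSeries ℤ K)) = 0 := by
    rw [← two_mul_sq_serX_add_sq_serY, h, mul_zero]
  have h1 := congrArg (fun F => (F.coeff 2).coeff 0) h0
  rw [pow_two, pow_two] at h1
  simp only [coeff_add, coeff_serR_mul, coeff_serT_mul] at h1
  simp [serR, serT, coeff_one] at h1

theorem equation_SDx_SDy (F : HahnSeries ℤ (HahnSeries ℤ K)) :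
    (serX K + serY K) * (SDx (SDx F) + SDy (SDy F)) + SDx F + SDy F
      = 2 * (serR * (Dr (Dr F) + Dt (Dt F)) + Dr F) := by
  rw [serX_add_serY]
  simp only [SDx, SDy, Derivation.add_apply, Derivation.sub_apply, map_add, map_sub]
  ring

theorem isLegendre_homSol : IsLegendre (serX K) (serY K) (fun k : ℕ => homSol K k) where
  zero := by simpa using homSol_zero
  one := by rw [serX_sub_serY]; simpa using homSol_one
  recurrence k := by
    have h := homSol_recurrence (K := K) k
    rw [two_mul_sq_serX_add_sq_serY, serX_sub_serY]
    push_cast at h ⊢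
    linear_combination h

end Parameters

instance : CharZero RatFun := charZero_of_injective_algebraMap (algebraMap ℝ RatFun).injective

/-- Algebraic independence of the coordinates of a solution depending on parameters. -/
theorem aeval_injective_of_parameters {A : Type*} [Field A] [Algebra ℝ A] [CharZero A]
    {X Y : Derivation ℝ A A} {g : Coord → A} {P : ℕ → A} (δ : ℕ → Derivation ℝ A A)
    (hxy : g .x + g .y ≠ 0) (hr : g .x ^ 2 + g .y ^ 2 ≠ 0)
    (hXx : X (g .x) = 1) (hXy : X (g .y) = 0) (hYx : Y (g .x) = 0) (hYy : Y (g .y) = 1)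
    (hP : IsLegendre (g .x) (g .y) P) (hδx : ∀ k, δ k (g .x) = 0) (hδy : ∀ k, δ k (g .y) = 0)
    (hδu : ∀ k i, δ k (g (.u i)) = Y^[i] (P k))
    (hδux : ∀ k i, δ k (g (.ux i)) = Y^[i] (X (P k))) :
    Function.Injective (MvPolynomial.aeval g : MvPolynomial Coord ℝ →ₐ[ℝ] A) := by
  -- Induction on the degree of a relation `Q`. Differentiating it along the parameters gives linear
  -- relations between the jets of the `P k`, so the derivatives of `Q` in the jet variables vanish
  -- on `g` and, by induction, as polynomials. Then `X` and `Y` remove `x` and `y`, and `Q` is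
  -- constant.
  have key : ∀ (N : ℕ) (Q : MvPolynomial Coord ℝ), Q.totalDegree < N →
      MvPolynomial.aeval g Q = 0 → Q = 0 := by
    intro N
    induction N with
    | zero => exact fun Q hQ => absurd hQ (Nat.not_lt_zero _)
    | succ N ih =>
      intro Q hN hQ
      obtain ⟨n, hn⟩ := exists_subset_coordsLE Q.vars
      have hs : Q ∈ MvPolynomial.supported ℝ (coordsLE n : Set Coord) := by
        rw [MvPolynomial.mem_supported, Finset.coe_subset]
        exact hn
      have hz (c : Coord) (hc : MvPolynomial.aeval g (MvPolynomial.pderiv c Q) = 0) :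
          MvPolynomial.pderiv c Q = 0 := by
        by_contra hne
        have := totalDegree_pderiv_lt hne
        exact hne (ih _ (by omega) hc)
      have hD (D : Derivation ℝ A A) :
          ∑ c ∈ coordsLE n, MvPolynomial.aeval g (MvPolynomial.pderiv c Q) * D (g c) = 0 := by
        rw [← derivation_aeval D g _ hs, hQ, map_zero]
      have hjet := jets_linearIndependent hxy hr hXx hXy hYx hYy hP n
        (fun i => MvPolynomial.aeval g (MvPolynomial.pderiv (.u i) Q))
        (fun i => MvPolynomial.aeval g (MvPolynomial.pderiv (.ux i) Q)) (by
          intro k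
          have := hD (δ k)
          rw [sum_coordsLE] at this
          simpa only [hδx, hδy, hδu, hδux, mul_zero, zero_add] using this)
      have hout (c : Coord) (hc : c ∉ coordsLE n) : MvPolynomial.pderiv c Q = 0 :=
        MvPolynomial.pderiv_eq_zero_of_notMem_vars fun h => hc (hn h)
      have hu (i : ℕ) : MvPolynomial.pderiv (.u i) Q = 0 := by
        by_cases hi : i ≤ n
        · exact hz _ (hjet.1 i hi)
        · exact hout _ (by rwa [mem_coordsLE_u])
      have hux (i : ℕ) : MvPolynomial.pderiv (.ux i) Q = 0 := by
        by_cases hi : i < n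
        · exact hz _ (hjet.2 i hi)
        · exact hout _ (by rwa [mem_coordsLE_ux])
      have hx : MvPolynomial.pderiv .x Q = 0 := by
        apply hz
        have := hD X
        rw [sum_coordsLE] at this
        simpa [hXx, hXy, hu, hux] using this
      have hy : MvPolynomial.pderiv .y Q = 0 := by
        apply hz
        have := hD Y
        rw [sum_coordsLE] at this
        simpa [hYx, hYy, hu, hux] using this
      have hempty : Q ∈ MvPolynomial.supported ℝ (∅ : Set Coord) :=
        mem_supported_of_pderiv fun c _ => by
          rcases c with _ | _ | i | i
          · exact hx
          · exact hy
          · exact hu i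
          · exact hux i
      rw [MvPolynomial.supported_empty, Algebra.mem_bot] at hempty
      obtain ⟨a, rfl⟩ := hempty
      rw [AlgHom.commutes, map_eq_zero] at hQ
      rw [hQ, map_zero]
  rw [injective_iff_map_eq_zero]
  exact fun Q => key _ Q (Nat.lt_succ_self _)

/-- Substitutions into rational functions. -/
abbrev Substitution (A : Type*) [Field A] [Algebra ℝ A] : Type _ := RatFun →ₐ[ℝ] A

theorem aeval_X_apply {A : Type*} [Field A] [Algebra ℝ A] (g : Coord → A) (c : Coord) :
    MvPolynomial.aeval (R := ℝ) g (MvPolynomial.X c) = g c := MvPolynomial.aeval_X _ _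

/-- Extension of an injective substitution to rational functions. -/
def liftRat {A : Type*} [Field A] [Algebra ℝ A] {s : MvPolynomial Coord ℝ →ₐ[ℝ] A}
    (hs : Function.Injective s) : RatFun →ₐ[ℝ] A :=
  IsLocalization.liftAlgHom (M := nonZeroDivisors (MvPolynomial Coord ℝ)) (f := s) fun p => by
    rw [isUnit_iff_ne_zero, Ne, map_eq_zero_iff s hs]
    exact nonZeroDivisors.coe_ne_zero p

theorem liftRat_coord {A : Type*} [Field A] [Algebra ℝ A] {s : MvPolynomial Coord ℝ →ₐ[ℝ] A}
    (hs : Function.Injective s) (c : Coord) : liftRat hs (coord c) = s (MvPolynomial.X c) := by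
  simp [liftRat, coord]

theorem uxx_zero_apply {A : Type*} [Field A] [Algebra ℝ A] (s : RatFun →ₐ[ℝ] A) {F : A}
    (hF : (s (coord .x) + s (coord .y)) * (F + s (coord (.u 2))) + s (coord (.ux 0))
      + s (coord (.u 1)) = 0) : F = s (uxx 0) := by
  have h0 : s (coord .x) + s (coord .y) ≠ 0 := by
    rw [← map_add]
    exact (map_ne_zero s).mpr x_add_y_ne_zero
  rw [uxx, Function.iterate_zero_apply, map_sub, map_div₀, map_neg, map_add, map_add]
  field_simp
  linear_combination hF

theorem mem_Sym_iff_apply {A : Type*} [Field A] [Algebra ℝ A] (s : RatFun →ₐ[ℝ] A)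
    {X Y : Derivation ℝ A A} (hX : ∀ q, X (s q) = s (Dx q)) (hY : ∀ q, Y (s q) = s (Dy q))
    {q : RatFun} : q ∈ Sym ↔ (s (coord .x) + s (coord .y)) * (X (X (s q)) + Y (Y (s q)))
      + X (s q) + Y (s q) = 0 := by
  rw [mem_Sym, ← map_eq_zero_iff s s.toRingHom.injective]
  simp only [map_add, map_mul, hX, hY]

theorem two_mul_eq_zero_iff {A : Type*} [Field A] [CharZero A] {a : A} : 2 * a = 0 ↔ a = 0 := by
  simp

/-- Expansions with coefficients depending on the parameters of the generic solution. -/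
abbrev Expansion : Type := HahnSeries ℤ (HahnSeries ℤ RatFun)

/-- The parameters of the generic solution. -/
def parameter (n : ℤ) : RatFun := if 0 ≤ n then coord (.u n.toNat) else 0

/-- The generic solution, a combination of the homogeneous solutions of nonnegative degree with
independent coefficients. -/
def genericSol : Expansion :=
  ofSuppBddBelow (fun n => C (parameter n) * axial RatFun n) ⟨0, by
    intro n hn
    by_contra h
    exact hn (by simp [parameter, h])⟩

theorem coeff_genericSol (n : ℤ) :
    genericSol.coeff n = C (parameter n) * axial RatFun n := rfl

theorem genericSol_equation :
    serR * (Dr (Dr genericSol) + Dt (Dt genericSol)) + Dr genericSol = 0 := by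
  apply ext_coeff
  intro n i
  have := coeff_equation genericSol (n + 1) (i + 1)
  rw [add_sub_cancel_right, add_sub_cancel_right] at this
  rw [this, coeff_genericSol]
  rw [HahnSeries.C_apply, coeff_single_zero_mul, coeff_single_zero_mul, coeff_zero, coeff_zero,
    coeff_axial, coeff_axial]
  have := axialCoeff_ode RatFun (n + 1) (i + 1)
  linear_combination parameter (n + 1) * this

theorem algebraMap_axialCoeff {K : Type*} [Field K] [Algebra ℝ K] (κ n : ℤ) :
    algebraMap ℝ K (axialCoeff ℝ κ n) = axialCoeff K κ n := by
  have h (i : ℕ) : algebraMap ℝ K (axialCoeffAux ℝ κ i) = axialCoeffAux K κ i := by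
    induction i with
    | zero => exact map_one _
    | succ i ih =>
      simp only [axialCoeffAux, map_mul, map_div₀, map_neg, map_sub, map_add, map_pow, map_one,
        map_natCast, map_intCast, map_ofNat, ih]
  rw [axialCoeff, axialCoeff, apply_ite (algebraMap ℝ K), map_zero, h]

theorem derivation_axialCoeff (d : Derivation ℝ RatFun RatFun) (κ i : ℤ) :
    d (axialCoeff RatFun κ i) = 0 := by
  rw [← algebraMap_axialCoeff, d.map_algebraMap]

/-- The coordinates `.u k` serve a second time, as independent transcendental coefficients; the
derivative in the `k`-th one picks out the solution it multiplies. -/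
theorem paramDer_genericSol (k : ℕ) :
    paramDer (partialD (.u k)) genericSol = homSol RatFun k := by
  apply ext_coeff
  intro n i
  rw [coeff_paramDer, coeff_genericSol, HahnSeries.C_apply, coeff_single_zero_mul, coeff_axial,
    mul_comm, Derivation.leibniz, derivation_axialCoeff, smul_zero, add_zero, smul_eq_mul]
  by_cases h : n = k
  · subst h
    simp [parameter, partialD_self, homSol]
  · have hp : partialD (.u k) (parameter n) = 0 := by
      rw [parameter]
      split_ifs with hn
      · exact partialD_of_ne (by simp; omega)
      · exact map_zero _
    rw [hp, mul_zero, homSol, coeff_single_of_ne h, coeff_zero]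

/-- The values of the coordinates on the generic solution. -/
def specCoord : Coord → Expansion
  | .x => serX RatFun
  | .y => serY RatFun
  | .u k => SDy^[k] genericSol
  | .ux k => SDy^[k] (SDx genericSol)

/-- Substitution of the generic solution into polynomials. -/
def specPoly : MvPolynomial Coord ℝ →ₐ[ℝ] Expansion := MvPolynomial.aeval specCoord

theorem iterate_paramDer_SDy (d : Derivation ℝ RatFun RatFun) (k : ℕ) (F : Expansion) :
    paramDer d (SDy^[k] F) = SDy^[k] (paramDer d F) := by
  induction k with
  | zero => rfl
  | succ k ih => rw [Function.iterate_succ_apply', Function.iterate_succ_apply', paramDer_SDy, ih]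

theorem specPoly_injective : Function.Injective specPoly :=
  aeval_injective_of_parameters (g := specCoord) (fun k => paramDer (partialD (.u k)))
    serX_add_serY_ne_zero sq_serX_add_sq_serY_ne_zero
    SDx_serX SDx_serY SDy_serX SDy_serY isLegendre_homSol
    (fun _ => paramDer_serX _) (fun _ => paramDer_serY _)
    (fun k i => by
      rw [specCoord, iterate_paramDer_SDy, paramDer_genericSol])
    (fun k i => by
      rw [specCoord, iterate_paramDer_SDy, paramDer_SDx, paramDer_genericSol])

/-- Substitution of the generic solution into rational functions. -/
def spec : Substitution Expansion := liftRat (A := Expansion) specPoly_injective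

theorem spec_coord (c : Coord) : spec (coord c) = specCoord c :=
  (liftRat_coord (A := Expansion) specPoly_injective c).trans (aeval_X_apply (A := Expansion) _ _)

theorem Substitution.injective {A : Type*} [Field A] [Algebra ℝ A] (s : Substitution A) :
    Function.Injective s := s.toRingHom.injective

section

variable {A : Type*} [Field A] [Algebra ℝ A] (s : Substitution A)

theorem Substitution.apply_zero : s 0 = 0 := map_zero s
theorem Substitution.apply_one : s 1 = 1 := map_one s
theorem Substitution.apply_add (p q : RatFun) : s (p + q) = s p + s q := map_add s p q
theorem Substitution.apply_mul (p q : RatFun) : s (p * q) = s p * s q := map_mul s p q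
theorem Substitution.apply_algebraMap (r : ℝ) : s (algebraMap ℝ RatFun r) = algebraMap ℝ A r :=
  s.commutes r
theorem Substitution.apply_sum {ι : Type*} (T : Finset ι) (f : ι → RatFun) :
    s (∑ i ∈ T, f i) = ∑ i ∈ T, s (f i) := map_sum s f T

end

theorem spec_zero : spec 0 = 0 := Substitution.apply_zero (A := Expansion) spec
theorem spec_one : spec 1 = 1 := Substitution.apply_one (A := Expansion) spec
theorem spec_add (p q : RatFun) : spec (p + q) = spec p + spec q :=
  Substitution.apply_add (A := Expansion) spec p q
theorem spec_mul (p q : RatFun) : spec (p * q) = spec p * spec q :=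
  Substitution.apply_mul (A := Expansion) spec p q
theorem spec_sum {ι : Type*} (T : Finset ι) (f : ι → RatFun) :
    spec (∑ i ∈ T, f i) = ∑ i ∈ T, spec (f i) :=
  Substitution.apply_sum (A := Expansion) spec T f
theorem spec_algebraMap (r : ℝ) :
    spec (algebraMap ℝ RatFun r) = C (C (algebraMap ℝ RatFun r)) :=
  (Substitution.apply_algebraMap (A := Expansion) spec r).trans
    (by rw [HahnSeries.algebraMap_apply, HahnSeries.algebraMap_apply])

theorem spec_injective : Function.Injective spec := Substitution.injective (A := Expansion) spec

theorem spec_Dy (q : RatFun) : SDy (spec q) = spec (Dy q) := by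
  apply derivation_apply_of_coord (A := Expansion)
  rintro (_ | _ | k | k)
  · rw [Dy_x, spec_coord, specCoord, SDy_serX, spec_zero]
  · rw [Dy_y, spec_coord, specCoord, SDy_serY, spec_one]
  · rw [Dy_u, spec_coord, spec_coord, specCoord, specCoord, Function.iterate_succ_apply']
  · rw [Dy_ux, spec_coord, spec_coord, specCoord, specCoord, Function.iterate_succ_apply']

theorem iterate_spec_Dy (k : ℕ) (q : RatFun) : SDy^[k] (spec q) = spec (Dy^[k] q) := by
  induction k with
  | zero => rfl
  | succ k ih => rw [Function.iterate_succ_apply', Function.iterate_succ_apply', ih, spec_Dy]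

theorem iterate_SDx_SDy (k : ℕ) (F : Expansion) : SDx (SDy^[k] F) = SDy^[k] (SDx F) := by
  induction k with
  | zero => rfl
  | succ k ih => rw [Function.iterate_succ_apply', Function.iterate_succ_apply', SDx_SDy, ih]

theorem spec_uxx_zero : SDx (SDx genericSol) = spec (uxx 0) := by
  apply uxx_zero_apply (A := Expansion)
  have h := equation_SDx_SDy genericSol
  rw [genericSol_equation, mul_zero] at h
  simpa only [spec_coord, specCoord, Function.iterate_succ_apply, Function.iterate_zero_apply]
    using h

theorem spec_Dx (q : RatFun) : SDx (spec q) = spec (Dx q) := by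
  apply derivation_apply_of_coord (A := Expansion)
  rintro (_ | _ | k | k)
  · rw [Dx_x, spec_coord, specCoord, SDx_serX, spec_one]
  · rw [Dx_y, spec_coord, specCoord, SDx_serY, spec_zero]
  · rw [Dx_u, spec_coord, spec_coord, specCoord, specCoord, iterate_SDx_SDy]
  · rw [Dx_ux, spec_coord, specCoord, iterate_SDx_SDy, spec_uxx_zero, iterate_spec_Dy]
    rfl

/-- Since `spec` is injective and commutes with total derivatives, being a symmetry means being a
formal solution after substitution. -/
theorem mem_Sym_iff_spec {q : RatFun} : q ∈ Sym ↔
    serR * (Dr (Dr (spec q)) + Dt (Dt (spec q))) + Dr (spec q) = 0 := by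
  rw [mem_Sym_iff_apply (A := Expansion) spec spec_Dx spec_Dy, spec_coord, spec_coord]
  refine Iff.trans ?_ two_mul_eq_zero_iff
  rw [← equation_SDx_SDy]
  rfl

end
end EulerDarboux

/-! ### Families of formal solutions indexed by the degree. -/

namespace EulerDarboux
noncomputable section

open HahnSeries

/-! ### Families of expansions depending polynomially on the degree -/

section Families

variable {K : Type*} [Field K] [Algebra ℝ K] [CharZero K]

/-- Families whose homogeneous components depend polynomially on the degree. -/
def IsPolyFamily (H : ℤ → HahnSeries ℤ (HahnSeries ℤ K)) : Prop :=
  ∀ j i : ℤ, IsPolyFun fun κ => ((H κ).coeff (κ + j)).coeff i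

/-- Families whose homogeneous components have the same parity as the homogeneous solutions. -/
def IsParityFamily (H : ℤ → HahnSeries ℤ (HahnSeries ℤ K)) : Prop :=
  ∀ j κ : ℤ, HasParity κ ((H κ).coeff (κ + j))

theorem coeff_sum_series {A ι : Type*} [CommRing A] (s : Finset ι) (F : ι → HahnSeries ℤ A)
    (n : ℤ) : (∑ i ∈ s, F i).coeff n = ∑ i ∈ s, (F i).coeff n := by
  classical
  induction s using Finset.induction_on with
  | empty => simp
  | insert i s hi ih => rw [Finset.sum_insert hi, Finset.sum_insert hi, coeff_add, ih]

theorem IsPolyFamily.sum {ι : Type*} (s : Finset ι) {H : ι → ℤ → HahnSeries ℤ (HahnSeries ℤ K)}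
    (h : ∀ c ∈ s, IsPolyFamily (H c)) : IsPolyFamily fun κ => ∑ c ∈ s, H c κ := by
  intro j i
  simp only [coeff_sum_series]
  exact IsPolyFun.sum s fun c hc => h c hc j i

theorem IsParityFamily.sum {ι : Type*} (s : Finset ι) {H : ι → ℤ → HahnSeries ℤ (HahnSeries ℤ K)}
    (h : ∀ c ∈ s, IsParityFamily (H c)) : IsParityFamily fun κ => ∑ c ∈ s, H c κ := by
  intro j κ
  simp only [coeff_sum_series]
  exact HasParity.sum s fun c hc => h c hc j κ

theorem coeff_mul_single_family (a : HahnSeries ℤ (HahnSeries ℤ K)) (f : HahnSeries ℤ K)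
    (κ n j : ℤ) : (a * single (κ - n) f).coeff (κ + j) = a.coeff (j + n) * f := by
  rw [coeff_mul_single, show κ + j - (κ - n) = j + n by ring]

theorem IsHomFamily.isPolyFamily_mul {n : ℤ} {F : ℤ → HahnSeries ℤ (HahnSeries ℤ K)}
    (hF : IsHomFamily n F) (a : HahnSeries ℤ (HahnSeries ℤ K)) :
    IsPolyFamily fun κ => a * F κ := by
  obtain ⟨f, hf, hF⟩ := hF
  intro j i
  simp only [hF, coeff_mul_single_family]
  exact hf.isPolyFun_mul _ _

theorem IsHomFamily.isParityFamily_mul {n : ℤ} {F : ℤ → HahnSeries ℤ (HahnSeries ℤ K)}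
    (hF : IsHomFamily n F) {a : HahnSeries ℤ (HahnSeries ℤ K)}
    (ha : ∀ m, a.coeff m ∈ ratSeries K) : IsParityFamily fun κ => a * F κ := by
  obtain ⟨f, hf, hF⟩ := hF
  intro j κ
  simp only [hF, coeff_mul_single_family]
  exact (hf.parity κ).mul (ha _)

/-- A polynomial family consisting of solutions for natural degrees consists of multiples of
homogeneous solutions for all integer degrees. -/
theorem IsPolyFamily.coeff_eq {H : ℤ → HahnSeries ℤ (HahnSeries ℤ K)} (hH : IsPolyFamily H)
    (hsol : ∀ k : ℕ, serR * (Dr (Dr (H k)) + Dt (Dt (H k))) + Dr (H k) = 0) (j κ : ℤ) :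
    (H κ).coeff (κ + j) = C (((H κ).coeff (κ + j)).coeff 0) * axial K (κ + j) := by
  apply eq_axial_of_ode
  intro i
  -- At each exponent `i` the recurrence of the equation is a polynomial condition on `κ` that holds
  -- for all natural `κ`.
  refine IsPolyFun.eq_zero_of_nat
    (c := fun κ => (i : K) ^ 2 * ((H κ).coeff (κ + j)).coeff i
      + (((κ + j : ℤ) : K) - i + 1) * (((κ + j : ℤ) : K) - i + 2)
        * ((H κ).coeff (κ + j)).coeff (i - 2)) ?_ 0 ?_ κ
  · have h1 (m : K) : IsPolyFun fun κ : ℤ => ((κ + j : ℤ) : K) - i + m := by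
      have := (IsPolyFun.id (K := K)).add (IsPolyFun.const ((j : K) - i + m))
      convert this using 2 with κ
      push_cast
      ring
    exact ((IsPolyFun.const _).mul (hH j i)).add (((h1 1).mul (h1 2)).mul (hH j (i - 2)))
  · intro k _
    rw [← coeff_equation, hsol]
    simp

/-- If the family has the right parity, the solutions of negative degree do not mix with those of
nonnegative degree. -/
theorem IsPolyFamily.coeff_eq_zero {H : ℤ → HahnSeries ℤ (HahnSeries ℤ K)} (hH : IsPolyFamily H)
    (hp : IsParityFamily H)
    (hsol : ∀ k : ℕ, serR * (Dr (Dr (H k)) + Dt (Dt (H k))) + Dr (H k) = 0) {j κ : ℤ}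
    (h : (0 ≤ κ ∧ κ + j < 0) ∨ (κ < 0 ∧ 0 ≤ κ + j)) : (H κ).coeff (κ + j) = 0 := by
  -- The component has the parity of `κ` by assumption and that of `κ + j` as a multiple of a
  -- homogeneous solution; on different sides of zero these are incompatible.
  have h1 := hp j κ
  have h2 : HasParity (κ + j) ((H κ).coeff (κ + j)) := by
    rw [hH.coeff_eq hsol]
    exact (hasParity_axial (κ + j)).mul (C_mem_ratSeries _)
  rcases h with ⟨h, h'⟩ | ⟨h, h'⟩
  · exact HasParity.eq_zero h h' h1 h2
  · exact HasParity.eq_zero h' h h2 h1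

/-- The value of a jet coordinate on a series. -/
def jetSeries (c : Coord) (F : HahnSeries ℤ (HahnSeries ℤ K)) : HahnSeries ℤ (HahnSeries ℤ K) :=
  match c with
  | .x => 0
  | .y => 0
  | .u k => SDy^[k] F
  | .ux k => SDy^[k] (SDx F)

/-- The order of a jet coordinate. -/
def jetOrder : Coord → ℤ
  | .x => 0
  | .y => 0
  | .u k => k
  | .ux k => k + 1

theorem isHomFamily_zero : IsHomFamily 0 fun _ => (0 : HahnSeries ℤ (HahnSeries ℤ K)) := by
  have := (isHomFamily_homSol (K := K)).sub isHomFamily_homSol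
  simpa using this

theorem isHomFamily_jetSeries (c : Coord) :
    IsHomFamily (jetOrder c) fun κ => jetSeries c (homSol K κ) := by
  rcases c with _ | _ | k | k
  · exact isHomFamily_zero
  · exact isHomFamily_zero
  · simpa [jetOrder, jetSeries] using (isHomFamily_homSol (K := K)).iterate_SDy k
  · have := (isHomFamily_homSol (K := K)).SDx.iterate_SDy k
    rw [zero_add, add_comm] at this
    exact this

theorem coeff_Dr_series (F : HahnSeries ℤ (HahnSeries ℤ K)) (n : ℤ) :
    (Dr F).coeff n = single (-1) 1 * euler (F.coeff (n + 1)) := by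
  ext i
  rw [coeff_Dr, coeff_single_mul, coeff_euler]
  simp

theorem coeff_Dt_series (F : HahnSeries ℤ (HahnSeries ℤ K)) (n : ℤ) :
    (Dt F).coeff n = ((n + 1 : ℤ) : HahnSeries ℤ K) * F.coeff (n + 1) - euler (F.coeff (n + 1)) := by
  ext i
  rw [coeff_Dt, coeff_sub, coeff_intCast_mul, coeff_euler]
  push_cast
  ring

variable (K) in
/-- Expansions with rational homogeneous components. -/
def ratExpansions : Subfield (HahnSeries ℤ (HahnSeries ℤ K)) := seriesSubfield (ratSeries K)

theorem mem_ratExpansions {F : HahnSeries ℤ (HahnSeries ℤ K)} :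
    F ∈ ratExpansions K ↔ ∀ n, F.coeff n ∈ ratSeries K := mem_seriesSubfield

theorem Dr_mem_ratExpansions {F : HahnSeries ℤ (HahnSeries ℤ K)} (h : F ∈ ratExpansions K) :
    Dr F ∈ ratExpansions K := by
  rw [mem_ratExpansions] at h ⊢
  intro n
  rw [coeff_Dr_series]
  exact mul_mem single_neg_mem_ratSeries (euler_mem_ratSeries (h _))

theorem Dt_mem_ratExpansions {F : HahnSeries ℤ (HahnSeries ℤ K)} (h : F ∈ ratExpansions K) :
    Dt F ∈ ratExpansions K := by
  rw [mem_ratExpansions] at h ⊢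
  intro n
  rw [coeff_Dt_series]
  exact sub_mem (mul_mem (intCast_mem_ratSeries _) (h _)) (euler_mem_ratSeries (h _))

theorem SDx_mem_ratExpansions {F : HahnSeries ℤ (HahnSeries ℤ K)} (h : F ∈ ratExpansions K) :
    SDx F ∈ ratExpansions K := add_mem (Dr_mem_ratExpansions h) (Dt_mem_ratExpansions h)

theorem iterate_SDy_mem_ratExpansions {F : HahnSeries ℤ (HahnSeries ℤ K)} (h : F ∈ ratExpansions K)
    (k : ℕ) : SDy^[k] F ∈ ratExpansions K := by
  induction k with
  | zero => exact h
  | succ k ih =>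
    rw [Function.iterate_succ_apply']
    exact sub_mem (Dr_mem_ratExpansions ih) (Dt_mem_ratExpansions ih)

theorem single_mem_seriesSubfield {F : Type*} [Field F] {S : Subfield F} {a : F} (ha : a ∈ S)
    (m : ℤ) : single m a ∈ seriesSubfield S := by
  rw [mem_seriesSubfield]
  intro n
  by_cases h : n = m
  · subst h
    rwa [coeff_single_same]
  · rw [coeff_single_of_ne h]
    exact zero_mem S

theorem half_mul_mem {F : Type*} [Field F] {S : Subfield F} {a : F} (ha : a ∈ S) : 2⁻¹ * a ∈ S :=
  mul_mem (inv_mem (ofNat_mem S 2)) ha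

theorem serX_mem_seriesSubfield {S : Subfield (HahnSeries ℤ K)} (h : single 1 1 ∈ S) :
    serX K ∈ seriesSubfield S :=
  half_mul_mem (add_mem (single_mem_seriesSubfield h 1) (single_mem_seriesSubfield (one_mem S) 1))

theorem serY_mem_seriesSubfield {S : Subfield (HahnSeries ℤ K)} (h : single 1 1 ∈ S) :
    serY K ∈ seriesSubfield S :=
  half_mul_mem (sub_mem (single_mem_seriesSubfield h 1) (single_mem_seriesSubfield (one_mem S) 1))

end Families

/-! ### Subfields containing the expansions -/

theorem Substitution.mem_of_coord {A : Type*} [Field A] [Algebra ℝ A] (s : Substitution A)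
    {S : Subfield A} (hr : ∀ r : ℝ, s (algebraMap ℝ RatFun r) ∈ S) (hc : ∀ c, s (coord c) ∈ S)
    (q : RatFun) : s q ∈ S := by
  have h (p : MvPolynomial Coord ℝ) : s (algebraMap _ RatFun p) ∈ S := by
    induction p using MvPolynomial.induction_on with
    | C a =>
      rw [← MvPolynomial.algebraMap_eq,
        ← IsScalarTower.algebraMap_apply ℝ (MvPolynomial Coord ℝ) RatFun]
      exact hr a
    | add p q hp hq => rw [map_add, map_add]; exact add_mem hp hq
    | mul_X p d hp => rw [map_mul, map_mul]; exact mul_mem hp (hc d)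
  obtain ⟨a, b, -, rfl⟩ := IsFractionRing.div_surjective (A := MvPolynomial Coord ℝ) q
  rw [map_div₀]
  exact div_mem (h a) (h b)

theorem Substitution.mem_of_mem_baseField {A : Type*} [Field A] [Algebra ℝ A] (s : Substitution A)
    {S : Subfield A} (hr : ∀ r : ℝ, s (algebraMap ℝ RatFun r) ∈ S) (hx : s (coord .x) ∈ S)
    (hy : s (coord .y) ∈ S) {q : RatFun} (hq : q ∈ baseField) : s q ∈ S := by
  induction hq using IntermediateField.adjoin_induction with
  | mem q hq =>
    rcases hq with rfl | rfl
    · exact hx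
    · exact hy
  | algebraMap r => exact hr r
  | add p q _ _ hp hq => rw [map_add]; exact add_mem hp hq
  | mul p q _ _ hp hq => rw [map_mul]; exact mul_mem hp hq
  | inv q _ hq => rw [map_inv₀]; exact inv_mem hq

theorem genericSol_mem_ratExpansions : genericSol ∈ ratExpansions RatFun := by
  rw [mem_ratExpansions]
  intro n
  rw [coeff_genericSol]
  rcases le_or_gt 0 n with h | h
  · obtain ⟨k, rfl⟩ := Int.eq_ofNat_of_zero_le h
    exact mul_mem (C_mem_ratSeries _) (axial_nat_mem k)
  · rw [parameter, if_neg (not_le.mpr h), map_zero, zero_mul]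
    exact zero_mem _

/-- The generic solution involves only nonnegative degrees, so no square root enters. This is the
source of the parity of variations. -/
theorem spec_mem_ratExpansions (q : RatFun) : spec q ∈ ratExpansions RatFun := by
  apply Substitution.mem_of_coord (A := Expansion)
  · intro r
    rw [spec_algebraMap]
    exact single_mem_seriesSubfield (C_mem_ratSeries _) 0
  · rintro (_ | _ | k | k) <;> rw [spec_coord]
    · exact serX_mem_seriesSubfield single_mem_ratSeries
    · exact serY_mem_seriesSubfield single_mem_ratSeries
    · exact iterate_SDy_mem_ratExpansions genericSol_mem_ratExpansions k
    · exact iterate_SDy_mem_ratExpansions (SDx_mem_ratExpansions genericSol_mem_ratExpansions) k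

/-- The expansions of functions of the base coordinates have real coefficients. -/
theorem coeff_coeff_spec_of_mem_baseField {q : RatFun} (hq : q ∈ baseField) (n i : ℤ) :
    ((spec q).coeff n).coeff i ∈ (algebraMap ℝ RatFun).fieldRange := by
  have h : spec q ∈ seriesSubfield (seriesSubfield (algebraMap ℝ RatFun).fieldRange) := by
    refine Substitution.mem_of_mem_baseField (A := Expansion) spec ?_ ?_ ?_ hq
    · intro r
      rw [spec_algebraMap]
      exact single_mem_seriesSubfield (single_mem_seriesSubfield (RingHom.mem_fieldRange_self _ r) 0) 0
    · rw [spec_coord]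
      exact serX_mem_seriesSubfield (single_mem_seriesSubfield (one_mem _) 1)
    · rw [spec_coord]
      exact serY_mem_seriesSubfield (single_mem_seriesSubfield (one_mem _) 1)
  exact mem_seriesSubfield.mp (mem_seriesSubfield.mp h n) i

end
end EulerDarboux

/-! ### Rational symmetries are affine in the jets. -/

namespace EulerDarboux
noncomputable section

open HahnSeries

/-! ### Polynomial solutions -/

/-- The homogeneous polynomial solutions. -/
def solid : ℕ → RatFun
  | 0 => 1
  | 1 => coord .x - coord .y
  | k + 2 => ((2 * k + 3) * ((coord .x - coord .y) * solid (k + 1))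
      - (k + 1) * (2 * (coord .x ^ 2 + coord .y ^ 2) * solid k)) / (k + 2)

theorem isLegendre_solid : IsLegendre (coord .x) (coord .y) solid where
  zero := rfl
  one := rfl
  recurrence k := by
    have h : (k + 2 : RatFun) ≠ 0 := by exact_mod_cast Nat.succ_ne_zero (k + 1)
    rw [solid, mul_div_cancel₀ _ h]

theorem IsLegendre.map {A : Type*} [Field A] [Algebra ℝ A] (s : Substitution A) {x y : RatFun}
    {P : ℕ → RatFun} (h : IsLegendre x y P) : IsLegendre (s x) (s y) fun k => s (P k) where
  zero := by rw [h.zero, map_one]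
  one := by rw [h.one, map_sub]
  recurrence k := by
    have := congrArg s (h.recurrence k)
    simpa only [map_mul, map_add, map_sub, map_pow, map_natCast, map_ofNat, map_one] using this

theorem IsLegendre.unique {A : Type*} [Field A] [CharZero A] {x y : A} {P Q : ℕ → A}
    (hP : IsLegendre x y P) (hQ : IsLegendre x y Q) (k : ℕ) : P k = Q k := by
  have key : P k = Q k ∧ P (k + 1) = Q (k + 1) := by
    induction k with
    | zero => exact ⟨by rw [hP.zero, hQ.zero], by rw [hP.one, hQ.one]⟩
    | succ k ih =>
      refine ⟨ih.2, ?_⟩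
      have h : (k + 2 : A) ≠ 0 := by exact_mod_cast Nat.succ_ne_zero (k + 1)
      apply mul_left_cancel₀ h
      rw [hP.recurrence, hQ.recurrence, ih.1, ih.2]
  exact key.1

/-- Both sequences satisfy the Legendre recurrence with the same initial values. -/
theorem spec_solid (k : ℕ) : spec (solid k) = homSol RatFun k := by
  have h := isLegendre_solid.map (A := Expansion) spec
  rw [spec_coord, spec_coord] at h
  exact h.unique isLegendre_homSol k

theorem solid_mem_Sym (k : ℕ) : solid k ∈ Sym := by
  rw [mem_Sym_iff_spec, spec_solid]
  exact homSol_equation _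

theorem solid_mem_baseField (k : ℕ) : solid k ∈ baseField := by
  have hx := x_mem_baseField
  have hy := y_mem_baseField
  have hn (n : ℕ) : (n : RatFun) ∈ baseField := natCast_mem _ n
  have key : solid k ∈ baseField ∧ solid (k + 1) ∈ baseField := by
    induction k with
    | zero => exact ⟨one_mem _, sub_mem hx hy⟩
    | succ k ih =>
      refine ⟨ih.2, ?_⟩
      rw [solid]
      refine div_mem (sub_mem (mul_mem ?_ (mul_mem (sub_mem hx hy) ih.2))
        (mul_mem ?_ (mul_mem (mul_mem ?_ (add_mem (pow_mem hx 2) (pow_mem hy 2))) ih.1))) ?_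
      · exact_mod_cast hn (2 * k + 3)
      · exact_mod_cast hn (k + 1)
      · exact_mod_cast hn 2
      · exact_mod_cast hn (k + 2)
  exact key.1

/-- The value of a jet coordinate on a function, zero for base coordinates. -/
def jetDer (c : Coord) (φ : RatFun) : RatFun := evol φ (coord c)

theorem spec_jetDer (c : Coord) (φ : RatFun) : spec (jetDer c φ) = jetSeries c (spec φ) := by
  rcases c with _ | _ | k | k
  · rw [jetDer, evol_x, spec_zero]; rfl
  · rw [jetDer, evol_y, spec_zero]; rfl
  · rw [jetDer, evol_u, ← iterate_spec_Dy]; rfl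
  · rw [jetDer, evol_ux, ← iterate_spec_Dy, ← spec_Dx]; rfl

theorem OrderLE.evol_eq {n : ℕ} {q : RatFun} (hq : OrderLE n q) (φ : RatFun) :
    evol φ q = ∑ c ∈ coordsLE n, partialD c q * jetDer c φ := hq.derivation_eq _

theorem evol_of_mem_baseField (φ : RatFun) {q : RatFun} (hq : q ∈ baseField) : evol φ q = 0 :=
  derivation_eq_zero_of_mem_baseField (evol_x φ) (evol_y φ) hq

theorem partialD_of_mem_baseField {c : Coord} (hx : c ≠ .x) (hy : c ≠ .y) {q : RatFun}
    (hq : q ∈ baseField) : partialD c q = 0 :=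
  derivation_eq_zero_of_mem_baseField (partialD_of_ne hx.symm) (partialD_of_ne hy.symm) hq

theorem derivation_mem_baseField {D : Derivation ℝ RatFun RatFun} (hx : D (coord .x) ∈ baseField)
    (hy : D (coord .y) ∈ baseField) {q : RatFun} (hq : q ∈ baseField) : D q ∈ baseField := by
  induction hq using IntermediateField.adjoin_induction with
  | mem q hq =>
    rcases hq with rfl | rfl
    · exact hx
    · exact hy
  | algebraMap r => rw [D.map_algebraMap]; exact zero_mem _
  | add p q _ _ hp hq => rw [map_add]; exact add_mem hp hq
  | mul p q hp' hq' hp hq =>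
    rw [Derivation.leibniz]
    exact add_mem (mul_mem hp' hq) (mul_mem hq' hp)
  | inv q hq' hq =>
    rw [Derivation.leibniz_inv]
    exact mul_mem (neg_mem (pow_mem (inv_mem hq') 2)) hq

theorem Dx_mem_baseField {q : RatFun} (hq : q ∈ baseField) : Dx q ∈ baseField :=
  derivation_mem_baseField (by rw [Dx_x]; exact one_mem _) (by rw [Dx_y]; exact zero_mem _) hq

theorem iterate_Dy_mem_baseField {q : RatFun} (hq : q ∈ baseField) (k : ℕ) :
    Dy^[k] q ∈ baseField := by
  induction k with
  | zero => exact hq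
  | succ k ih =>
    rw [Function.iterate_succ_apply']
    exact derivation_mem_baseField (by rw [Dy_x]; exact zero_mem _) (by rw [Dy_y]; exact one_mem _)
      ih

theorem jetDer_mem_baseField (c : Coord) {q : RatFun} (hq : q ∈ baseField) :
    jetDer c q ∈ baseField := by
  rcases c with _ | _ | k | k
  · rw [jetDer, evol_x]; exact zero_mem _
  · rw [jetDer, evol_y]; exact zero_mem _
  · rw [jetDer, evol_u]; exact iterate_Dy_mem_baseField hq k
  · rw [jetDer, evol_ux]; exact iterate_Dy_mem_baseField (Dx_mem_baseField hq) k

theorem sq_x_add_sq_y_ne_zero : coord .x ^ 2 + coord .y ^ 2 ≠ 0 := by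
  intro h
  have h1 := congrArg spec h
  rw [pow_two, pow_two, spec_add, spec_mul, spec_mul, spec_coord, spec_coord, spec_zero] at h1
  apply sq_serX_add_sq_serY_ne_zero (K := RatFun)
  rw [pow_two, pow_two]
  exact h1

/-- The jets of the polynomial solutions satisfy no linear relation. -/
theorem eq_zero_of_sum_jetDer_solid {n : ℕ} {a : Coord → RatFun}
    (h : ∀ k, ∑ c ∈ coordsLE n, a c * jetDer c (solid k) = 0) {c : Coord} (hc : c ∈ coordsLE n)
    (hx : c ≠ .x) (hy : c ≠ .y) : a c = 0 := by
  have hjet := jets_linearIndependent x_add_y_ne_zero sq_x_add_sq_y_ne_zero Dx_x Dx_y Dy_x Dy_y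
    isLegendre_solid n (fun i => a (.u i)) (fun i => a (.ux i)) (by
      intro k
      have := h k
      rw [sum_coordsLE] at this
      simpa only [jetDer, evol_x, evol_y, evol_u, evol_ux, mul_zero, zero_add] using this)
  rcases c with _ | _ | k | k
  · exact absurd rfl hx
  · exact absurd rfl hy
  · exact hjet.1 k (mem_coordsLE_u.mp hc)
  · exact hjet.2 k (mem_coordsLE_ux.mp hc)

/-- By the chain rule the hypothesis is a linear relation between the jets of all polynomial
solutions, with the partial derivatives of `q` as coefficients; these must vanish. -/
theorem mem_baseField_of_evol_solid {q : RatFun} (h : ∀ k, evol (solid k) q = 0) :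
    q ∈ baseField := by
  obtain ⟨n, hn⟩ := exists_orderLE q
  refine mem_baseField_of_partialD fun c hx hy => ?_
  by_cases hc : c ∈ coordsLE n
  · exact eq_zero_of_sum_jetDer_solid (a := fun c => partialD c q)
      (fun k => (hn.evol_eq _).symm.trans (h k)) hc hx hy
  · exact hn.partialD_eq_zero hc

/-! ### Rational symmetries are affine in the jet coordinates -/

/-- The second variation along homogeneous solutions. -/
def secondVariation (n : ℕ) (φ : RatFun) (κ μ : ℤ) : Expansion :=
  ∑ d ∈ coordsLE n, ∑ c ∈ coordsLE n, spec (partialD c (partialD d φ)) *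
    jetSeries d (homSol RatFun μ) * jetSeries c (homSol RatFun κ)

/-- The jets of `solid l` depend on `x`, `y` only, so the second variation differentiates just the
coefficients. The resulting bilinear expression also makes sense for negative degrees, where no
rational solution is available. -/
theorem secondVariation_nat {n : ℕ} {φ : RatFun} (hφ : OrderLE n φ)
    (hφ' : ∀ d ∈ coordsLE n, OrderLE n (partialD d φ)) (k l : ℕ) :
    secondVariation n φ k l = spec (evol (solid k) (evol (solid l) φ)) := by
  have h : evol (solid k) (evol (solid l) φ) = ∑ d ∈ coordsLE n, ∑ c ∈ coordsLE n,
      partialD c (partialD d φ) * jetDer d (solid l) * jetDer c (solid k) := by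
    rw [hφ.evol_eq, map_sum]
    refine Finset.sum_congr rfl fun d hd => ?_
    rw [Derivation.leibniz,
      evol_of_mem_baseField _ (jetDer_mem_baseField d (solid_mem_baseField l)), smul_zero, zero_add,
      (hφ' d hd).evol_eq, smul_eq_mul, Finset.mul_sum]
    exact Finset.sum_congr rfl fun c _ => by ring
  rw [h, secondVariation, spec_sum]
  refine Finset.sum_congr rfl fun d _ => ?_
  rw [spec_sum]
  refine Finset.sum_congr rfl fun c _ => ?_
  rw [spec_mul, spec_mul, spec_jetDer, spec_jetDer, spec_solid, spec_solid]

theorem isPolyFamily_secondVariation_left (n : ℕ) (φ : RatFun) (μ : ℤ) :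
    IsPolyFamily fun κ => secondVariation n φ κ μ :=
  IsPolyFamily.sum _ fun _ _ => IsPolyFamily.sum _ fun c _ =>
    (isHomFamily_jetSeries c).isPolyFamily_mul _

theorem isPolyFamily_secondVariation_right (n : ℕ) (φ : RatFun) (κ : ℤ) :
    IsPolyFamily fun μ => secondVariation n φ κ μ := by
  refine IsPolyFamily.sum _ fun d _ => IsPolyFamily.sum _ fun c _ => ?_
  have := (isHomFamily_jetSeries (K := RatFun) d).isPolyFamily_mul
    (spec (partialD c (partialD d φ)) * jetSeries c (homSol RatFun κ))
  simpa only [mul_right_comm] using this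

/-- The second degree must be natural here: then the factor with the jets of `H_l` is rational, and
the parity is that of `H_κ` alone. -/
theorem isParityFamily_secondVariation (n : ℕ) (φ : RatFun) (l : ℕ) :
    IsParityFamily fun κ => secondVariation n φ κ l := by
  refine IsParityFamily.sum _ fun d _ => IsParityFamily.sum _ fun c _ => ?_
  refine (isHomFamily_jetSeries c).isParityFamily_mul ?_
  rw [← spec_solid, ← spec_jetDer, ← spec_mul]
  exact mem_ratExpansions.mp (spec_mem_ratExpansions _)

/-- The two degrees can be continued independently to negative values. One of them taken negative
and the other large violates the separation of degrees unless the component is zero, and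
polynomiality spreads this to all degrees. -/
theorem evol_solid_evol_solid {φ : RatFun} (hφ : φ ∈ Sym) (k l : ℕ) :
    evol (solid k) (evol (solid l) φ) = 0 := by
  obtain ⟨n₀, h₀⟩ := exists_orderLE φ
  obtain ⟨n, hn₀, hn, hn'⟩ : ∃ n, n₀ ≤ n ∧ OrderLE n φ ∧ ∀ d ∈ coordsLE n, OrderLE n (partialD d φ) := by
    obtain ⟨m, hm⟩ := exists_orderLE_finset ((coordsLE n₀).image fun d => partialD d φ)
    refine ⟨max m n₀, le_max_right _ _, h₀.mono (le_max_right _ _), fun d _ => ?_⟩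
    by_cases hd : d ∈ coordsLE n₀
    · exact (hm _ (Finset.mem_image_of_mem _ hd)).mono (le_max_left _ _)
    · rw [h₀.partialD_eq_zero hd]
      exact ⟨0, 1, zero_mem _, one_mem _, by simp⟩
  have hsol (l k : ℕ) : serR * (Dr (Dr (secondVariation n φ k l))
      + Dt (Dt (secondVariation n φ k l))) + Dr (secondVariation n φ k l) = 0 := by
    rw [secondVariation_nat hn hn', ← mem_Sym_iff_spec]
    exact evol_mem (solid_mem_Sym k) (evol_mem (solid_mem_Sym l) hφ)
  -- For `κ < 0` and `l ≥ -m` the component of degree `l + m ≥ 0` vanishes by parity; it is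
  -- polynomial in `l`, hence zero for every `l`.
  have hneg (κ : ℤ) (hκ : κ < 0) (l : ℕ) (m i : ℤ) :
      ((secondVariation n φ κ l).coeff (l + m)).coeff i = 0 := by
    refine (isPolyFamily_secondVariation_right n φ κ m i).eq_zero_of_nat (-m).toNat ?_ l
    intro l hl
    have := (isPolyFamily_secondVariation_left n φ l).coeff_eq_zero
      (isParityFamily_secondVariation n φ l) (hsol l) (j := l + m - κ) (κ := κ)
      (Or.inr ⟨hκ, by omega⟩)
    rw [add_sub_cancel] at this
    rw [this, coeff_zero]
  -- With the difference between the degree of the component and `κ` fixed, its coefficients are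
  -- polynomial in `κ` and vanish for all `κ < 0`.
  have hzero : secondVariation n φ k l = 0 := by
    apply ext_coeff
    intro m i
    have := (isPolyFamily_secondVariation_left n φ l (m - k) i).eq_zero_of_neg (fun κ hκ => by
      have := hneg κ hκ l (κ + (m - k) - l) i
      rwa [add_sub_cancel] at this) k
    rw [add_sub_cancel] at this
    rw [this, coeff_zero, coeff_zero]
  rw [secondVariation_nat hn hn', ← spec_zero] at hzero
  exact spec_injective hzero

/-- Rational symmetries are affine functions of the jet coordinates. -/
theorem partialD_mem_baseField {φ : RatFun} (hφ : φ ∈ Sym) {d : Coord} (hx : d ≠ .x)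
    (hy : d ≠ .y) : partialD d φ ∈ baseField := by
  obtain ⟨n, hn⟩ := exists_orderLE φ
  by_cases hd : d ∈ coordsLE n
  · refine mem_baseField_of_partialD fun e hex hey => ?_
    refine eq_zero_of_sum_jetDer_solid (n := n) (a := fun d => partialD e (partialD d φ)) ?_ hd hx hy
    intro l
    -- The first variation is annihilated by all further variations, so it is a function of `x`,
    -- `y`. Applying `∂/∂e` leaves a linear relation between the jets of `solid l`, with the second
    -- derivatives of `φ` as coefficients.
    have h1 : partialD e (evol (solid l) φ) = 0 :=
      partialD_of_mem_baseField hex hey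
        (mem_baseField_of_evol_solid fun k => evol_solid_evol_solid hφ k l)
    rw [hn.evol_eq, map_sum] at h1
    rw [← h1]
    refine Finset.sum_congr rfl fun d _ => ?_
    rw [Derivation.leibniz, partialD_of_mem_baseField hex hey
      (jetDer_mem_baseField d (solid_mem_baseField l)), smul_zero, zero_add, smul_eq_mul, mul_comm]
  · rw [hn.partialD_eq_zero hd]
    exact zero_mem _

/-- Affineness in the jets makes the linearization an operator with coefficients in `x`, `y`; this
is why the solutions form an ideal. -/
theorem evol_mem_baseField {φ f : RatFun} (hφ : φ ∈ Sym) (hf : f ∈ baseField) :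
    evol f φ ∈ baseField := by
  obtain ⟨n, hn⟩ := exists_orderLE φ
  rw [hn.evol_eq]
  refine sum_mem fun c _ => ?_
  rcases c with _ | _ | k | k
  · rw [jetDer, evol_x, mul_zero]; exact zero_mem _
  · rw [jetDer, evol_y, mul_zero]; exact zero_mem _
  · exact mul_mem (partialD_mem_baseField hφ (by simp) (by simp)) (jetDer_mem_baseField _ hf)
  · exact mul_mem (partialD_mem_baseField hφ (by simp) (by simp)) (jetDer_mem_baseField _ hf)

end
end EulerDarboux

/-! ### Symbols: polynomiality, reality and degree bounds. -/

namespace EulerDarboux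
noncomputable section

open HahnSeries

/-! ### Degrees of symbols -/

/-- Symbols that do not mix solutions of negative and nonnegative degree. -/
def IsSplit (d : ℤ) (p : Polynomial ℝ) : Prop :=
  ∀ κ : ℤ, (0 ≤ κ ∧ κ + d < 0) ∨ (κ < 0 ∧ 0 ≤ κ + d) → p.eval (κ : ℝ) = 0

section Degrees

variable {F : Type*} [Field F] [Algebra ℝ F] [CharZero F] {x y : F} {P : ℕ → F}
  {Dx Dy : Derivation ℝ F F}

/-- The generating function of the values of a differential operator on the polynomial
solutions. -/
theorem hasOrder_mk (hxx : Dx x = 1) (hxy : Dx y = 0) (hyx : Dy x = 0) (hyy : Dy y = 1)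
    (hP : IsLegendre x y P) (n : ℕ) (a b : ℕ → F) :
    HasOrder x y P n (PowerSeries.mk fun k => ∑ i ∈ Finset.range (n + 1), a i * Dy^[i] (P k)
      + ∑ i ∈ Finset.range n, b i * Dy^[i] (Dx (P k))) := by
  have h1 : HasOrder x y P n (∑ i ∈ Finset.range (n + 1),
      PowerSeries.C (a i) * (powerDer Dy)^[i] (PowerSeries.mk P)) :=
    HasOrder.sum _ fun i hi => ((rep_iterate_y hyx hyy hP i).hasOrder.mono
      (Nat.lt_succ_iff.mp (Finset.mem_range.mp hi))).C_mul _
  have h2 : HasOrder x y P n (∑ i ∈ Finset.range n,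
      PowerSeries.C (b i) * (powerDer Dy)^[i] (powerDer Dx (PowerSeries.mk P))) :=
    HasOrder.sum _ fun i hi => ((rep_iterate_xy hxx hxy hyx hyy hP i).hasOrder.mono
      (Finset.mem_range.mp hi)).C_mul _
  convert h1.add h2 using 1
  ext k
  simp only [PowerSeries.coeff_mk, map_add, map_sum, PowerSeries.coeff_C_mul,
    coeff_iterate_powerDer, coeff_powerDer]

/-- Multiplying the generating function of `L` by `X ^ j` realigns the degrees; the vanishing of `c`
below `j` fills in the first coefficients. -/
theorem natDegree_le_of_raising
    (hxy : x + y ≠ 0) (hr : x ^ 2 + y ^ 2 ≠ 0) (hP : IsLegendre x y P) {n : ℕ} {L : ℕ → F}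
    (hL : HasOrder x y P n (PowerSeries.mk L)) (c : Polynomial F) (j : ℕ)
    (h : ∀ k, L k = c.eval ((k + j : ℕ) : F) * P (k + j)) (h0 : ∀ m < j, c.eval (m : F) = 0) :
    c.natDegree ≤ n := by
  refine natDegree_le_of_hasOrder hxy hr hP hL c j 0 ?_
  ext m
  rw [pow_zero, one_mul, PowerSeries.coeff_X_pow_mul', PowerSeries.coeff_mk, PowerSeries.coeff_mk]
  split_ifs with hm
  · rw [h, Nat.sub_add_cancel hm]
  · rw [h0 m (not_le.mp hm), zero_mul]

theorem natDegree_le_of_lowering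
    (hxy : x + y ≠ 0) (hr : x ^ 2 + y ^ 2 ≠ 0) (hP : IsLegendre x y P) {n : ℕ} {L : ℕ → F}
    (hL : HasOrder x y P n (PowerSeries.mk L)) (c : Polynomial F) (j : ℕ)
    (h : ∀ k, L (k + j) = c.eval (k : F) * P k) (h0 : ∀ m < j, L m = 0) :
    c.natDegree ≤ n := by
  refine natDegree_le_of_hasOrder hxy hr hP hL c 0 j ?_
  ext m
  rw [pow_zero, one_mul, PowerSeries.coeff_X_pow_mul', PowerSeries.coeff_mk, PowerSeries.coeff_mk]
  split_ifs with hm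
  · rw [← h, Nat.sub_add_cancel hm]
  · rw [h0 m (not_le.mp hm)]

/-- The degree of the symbol of a differential operator is at most its order. -/
theorem natDegree_symbol_le
    (hxy : x + y ≠ 0) (hr : x ^ 2 + y ^ 2 ≠ 0) (hxx : Dx x = 1) (hxy' : Dx y = 0) (hyx : Dy x = 0) (hyy : Dy y = 1)
    (τ : ℝ →+* F) {H : ℤ → F} (hP : IsLegendre x y fun k : ℕ => H k) {n : ℕ} (a b : ℕ → F) {j : ℤ}
    {p : Polynomial ℝ} (hsplit : IsSplit j p)
    (hL : ∀ k : ℕ, ∑ i ∈ Finset.range (n + 1), a i * Dy^[i] (H k)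
      + ∑ i ∈ Finset.range n, b i * Dy^[i] (Dx (H k)) = τ (p.eval (k : ℝ)) * H (k + j)) :
    p.natDegree ≤ n := by
  have hord := hasOrder_mk hxx hxy' hyx hyy hP n a b
  -- The generating function lemmas index the factor by the target degree `k + j`, while `p` is
  -- evaluated at `k`. The values missing at the start are zero because `p` is split.
  set q := (p.comp (Polynomial.X - Polynomial.C (j : ℝ))).map τ with hq
  have hdeg : q.natDegree = p.natDegree := by
    rw [hq, Polynomial.natDegree_map_eq_of_injective τ.injective, Polynomial.natDegree_comp,
      Polynomial.natDegree_X_sub_C, mul_one]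
  have hqe (m : ℕ) : q.eval (m : F) = τ (p.eval ((m - j : ℤ) : ℝ)) := by
    rw [hq, Polynomial.eval_natCast_map]
    simp
  rw [← hdeg]
  rcases le_or_gt 0 j with hj | hj
  · obtain ⟨m, rfl⟩ := Int.eq_ofNat_of_zero_le hj
    refine natDegree_le_of_raising hxy hr hP hord q m (fun k => ?_) fun l hl => ?_
    · rw [hL, hqe]
      push_cast
      rw [add_sub_cancel_right]
    · rw [hqe, hsplit _ (Or.inr ⟨by omega, by omega⟩), map_zero]
  · obtain ⟨m, rfl⟩ : ∃ m : ℕ, j = -m := ⟨(-j).toNat, by omega⟩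
    refine natDegree_le_of_lowering hxy hr hP hord q m (fun k => ?_) fun l hl => ?_
    · rw [hL, hqe]
      push_cast
      rw [add_neg_cancel_right, sub_neg_eq_add]
    · rw [hL, ← Int.cast_natCast, hsplit _ (Or.inl ⟨by omega, by omega⟩), map_zero, zero_mul]

end Degrees

theorem sum_coordsLE_mul {A : Type*} [Field A] (n : ℕ) (a f : Coord → A) (hx : f .x = 0)
    (hy : f .y = 0) : ∑ c ∈ coordsLE n, a c * f c = ∑ i ∈ Finset.range (n + 1), a (.u i) * f (.u i)
      + ∑ i ∈ Finset.range n, a (.ux i) * f (.ux i) := by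
  rw [sum_coordsLE, hx, hy, mul_zero, mul_zero, zero_add, zero_add]

theorem single_C_mul_axial (a : RatFun) (n : ℤ) :
    single n (C a * axial RatFun n) = C (C a) * homSol RatFun n := by
  rw [homSol, C_apply (C a), single_mul_single, zero_add]

/-- A polynomial with real values at natural numbers has real coefficients. -/
theorem exists_real_polynomial {K : Type*} [Field K] [Algebra ℝ K] [CharZero K] (P : Polynomial K)
    (h : ∀ k : ℕ, P.eval (k : K) ∈ (algebraMap ℝ K).fieldRange) :
    ∃ Q : Polynomial ℝ, P = Q.map (algebraMap ℝ K) := by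
  choose r hr using h
  have hv : Set.InjOn (fun i : ℕ => (i : ℝ)) (Finset.range (P.natDegree + 1)) :=
    Nat.cast_injective.injOn
  have hv' : Set.InjOn (fun i : ℕ => (i : K)) (Finset.range (P.natDegree + 1)) :=
    Nat.cast_injective.injOn
  refine ⟨Lagrange.interpolate (Finset.range (P.natDegree + 1)) (fun i : ℕ => (i : ℝ)) r, ?_⟩
  refine Polynomial.eq_of_degrees_lt_of_eval_index_eq (Finset.range (P.natDegree + 1)) hv' ?_ ?_ ?_
  · rw [Finset.card_range]
    exact_mod_cast Polynomial.degree_le_natDegree.trans_lt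
      (WithBot.coe_lt_coe.mpr (Nat.lt_succ_self _))
  · rw [Polynomial.degree_map]
    exact Lagrange.degree_interpolate_lt _ hv
  · intro i hi
    rw [Polynomial.eval_natCast_map, Lagrange.eval_interpolate_at_node _ hv hi, hr]

/-! ### Symbols of symmetries -/

/-- The variation along homogeneous solutions. -/
def firstVariation (n : ℕ) (φ : RatFun) (κ : ℤ) : Expansion :=
  ∑ c ∈ coordsLE n, spec (partialD c φ) * jetSeries c (homSol RatFun κ)

theorem firstVariation_nat {n : ℕ} {φ : RatFun} (hφ : OrderLE n φ) (k : ℕ) :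
    firstVariation n φ k = spec (evol (solid k) φ) := by
  rw [hφ.evol_eq, firstVariation, spec_sum]
  exact Finset.sum_congr rfl fun c _ => by rw [spec_mul, spec_jetDer, spec_solid]

theorem isPolyFamily_firstVariation (n : ℕ) (φ : RatFun) : IsPolyFamily (firstVariation n φ) :=
  IsPolyFamily.sum _ fun c _ => (isHomFamily_jetSeries c).isPolyFamily_mul _

theorem isParityFamily_firstVariation (n : ℕ) (φ : RatFun) : IsParityFamily (firstVariation n φ) :=
  IsParityFamily.sum _ fun c _ => (isHomFamily_jetSeries c).isParityFamily_mul
    (mem_ratExpansions.mp (spec_mem_ratExpansions _))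

theorem sum_single {A ι : Type*} [CommRing A] (s : Finset ι) (n : ℤ) (f : ι → A) :
    ∑ i ∈ s, single n (f i) = single n (∑ i ∈ s, f i) := by
  classical
  induction s using Finset.induction_on with
  | empty => simp
  | insert i s hi ih => rw [Finset.sum_insert hi, Finset.sum_insert hi, single_add, ih]

/-- The coefficients of the homogeneous component of degree `j` of the linearization. -/
def symbolCoeff (φ : RatFun) (j : ℤ) (c : Coord) : Expansion :=
  single (j + jetOrder c) ((spec (partialD c φ)).coeff (j + jetOrder c))

/-- The linearization decomposes according to the shift of degree, and every component is again a
differential operator of order at most `n`; so the degree bound applies to each symbol separately.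
-/
theorem sum_single_mul_jetSeries (n : ℕ) (φ : RatFun) (j κ : ℤ) :
    ∑ c ∈ coordsLE n, symbolCoeff φ j c * jetSeries c (homSol RatFun κ) = single (κ + j) ((firstVariation n φ κ).coeff (κ + j)) := by
  have h (c : Coord) : symbolCoeff φ j c * jetSeries c (homSol RatFun κ) =
      single (κ + j) ((spec (partialD c φ) * jetSeries c (homSol RatFun κ)).coeff (κ + j)) := by
    obtain ⟨f, -, hf⟩ := isHomFamily_jetSeries (K := RatFun) c
    have hf := hf κ
    simp only at hf
    rw [symbolCoeff, hf, coeff_mul_single_family, single_mul_single,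
      show j + jetOrder c + (κ - jetOrder c) = κ + j by ring]
  rw [Finset.sum_congr rfl fun c _ => h c, firstVariation, coeff_sum_series]
  exact sum_single _ _ _

/-- The coefficient of the solution of degree `k + j` in the value of the linearization of a
symmetry on the solution of degree `k`. -/
def symbol (φ : RatFun) (j : ℤ) (k : ℕ) : RatFun :=
  ((spec (evol (solid k) φ)).coeff (k + j)).coeff 0

theorem coeff_spec_evol {φ : RatFun} (hφ : φ ∈ Sym) (j : ℤ) (k : ℕ) :
    (spec (evol (solid k) φ)).coeff (k + j) = C (symbol φ j k) * axial RatFun (k + j) := by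
  obtain ⟨n, hn⟩ := exists_orderLE φ
  have := (isPolyFamily_firstVariation n φ).coeff_eq (fun k => by
    rw [firstVariation_nat hn, ← mem_Sym_iff_spec]
    exact evol_mem (solid_mem_Sym k) hφ) j k
  rw [firstVariation_nat hn] at this
  exact this

/-- Polynomiality comes from that of the `H_κ`, real coefficients from the fact that the variations
are functions of `x`, `y`, the splitting from parity, and the degree bound from the order of the
operator. -/
theorem exists_symbol_polynomial {φ : RatFun} (hφ : φ ∈ Sym) {n : ℕ} (hn : OrderLE n φ) (j : ℤ) :
    ∃ p : Polynomial ℝ, p.natDegree ≤ n ∧ IsSplit j p ∧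
      ∀ k, symbol φ j k = algebraMap ℝ RatFun (p.eval (k : ℝ)) := by
  have hsol (k : ℕ) : serR * (Dr (Dr (firstVariation n φ k)) + Dt (Dt (firstVariation n φ k)))
      + Dr (firstVariation n φ k) = 0 := by
    rw [firstVariation_nat hn, ← mem_Sym_iff_spec]
    exact evol_mem (solid_mem_Sym k) hφ
  obtain ⟨P, hP⟩ := isPolyFamily_firstVariation n φ j 0
  have hsym (k : ℕ) : symbol φ j k = P.eval (k : RatFun) := by
    have := hP k
    simp only [firstVariation_nat hn] at this
    simpa [symbol] using this
  obtain ⟨p, rfl⟩ := exists_real_polynomial P fun k => by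
    rw [← hsym]
    exact coeff_coeff_spec_of_mem_baseField (evol_mem_baseField hφ (solid_mem_baseField k)) _ _
  have heval (κ : ℤ) : (p.map (algebraMap ℝ RatFun)).eval (κ : RatFun)
      = algebraMap ℝ RatFun (p.eval (κ : ℝ)) := Polynomial.eval_intCast_map _ _ _
  simp only [heval] at hP
  have hsplit : IsSplit j p := by
    intro κ hκ
    have := (isPolyFamily_firstVariation n φ).coeff_eq_zero (isParityFamily_firstVariation n φ)
      hsol hκ
    have h2 := hP κ
    rw [this, coeff_zero, eq_comm, map_eq_zero] at h2
    exact h2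
  refine ⟨p, ?_, hsplit, fun k => ?_⟩
  · refine natDegree_symbol_le (F := Expansion) serX_add_serY_ne_zero sq_serX_add_sq_serY_ne_zero
      SDx_serX SDx_serY SDy_serX SDy_serY
      (((C : HahnSeries ℤ RatFun →+* Expansion).comp C).comp (algebraMap ℝ RatFun))
      (H := homSol RatFun) isLegendre_homSol (n := n)
      (fun i => symbolCoeff φ j (.u i)) (fun i => symbolCoeff φ j (.ux i)) hsplit fun k => ?_
    have h1 := sum_single_mul_jetSeries n φ j k
    rw [sum_coordsLE_mul (A := Expansion) n _ (fun c => jetSeries c (homSol RatFun k)) rfl rfl] at h1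
    refine h1.trans ?_
    rw [(isPolyFamily_firstVariation n φ).coeff_eq hsol, hP, Int.cast_natCast]
    exact single_C_mul_axial _ _
  · rw [hsym]
    exact Polynomial.eval_natCast_map _ _ _

end
end EulerDarboux

/-! ### Symmetries as shift operators on the polynomial solutions. -/

namespace EulerDarboux
noncomputable section

open HahnSeries

/-! ### Symmetries acting on solutions by shifts of the degree -/

/-- A split polynomial has `|d|` prescribed roots: `-1, …, -d` for positive `d`, and `0, …, |d| - 1`
for negative `d`. -/
theorem IsSplit.eq_zero {d : ℤ} {p : Polynomial ℝ} (h : IsSplit d p) (hp : p.natDegree < d.natAbs) :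
    p = 0 := by
  rcases le_or_gt 0 d with hd | hd
  · refine Polynomial.eq_zero_of_natDegree_lt_card_of_eval_eq_zero p
      (f := fun i : Fin d.natAbs => (((-1 - i : ℤ)) : ℝ)) ?_ ?_ (by simpa using hp)
    · intro i j hij
      have : (-1 - i : ℤ) = -1 - j := Int.cast_injective hij
      ext
      omega
    · intro i
      have := i.2
      exact h _ (Or.inr ⟨by omega, by omega⟩)
  · refine Polynomial.eq_zero_of_natDegree_lt_card_of_eval_eq_zero p
      (f := fun i : Fin d.natAbs => (((i : ℤ)) : ℝ)) ?_ ?_ (by simpa using hp)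
    · intro i j hij
      have : (i : ℤ) = j := Int.cast_injective hij
      ext
      omega
    · intro i
      have := i.2
      exact h _ (Or.inl ⟨by omega, by omega⟩)

/-- The homogeneous polynomial solutions as symmetries, zero for negative degrees. -/
def solidSym (k : ℤ) : Sym := if 0 ≤ k then ⟨solid k.toNat, solid_mem_Sym _⟩ else 0

theorem solidSym_natCast (k : ℕ) : solidSym k = ⟨solid k, solid_mem_Sym k⟩ := by
  simp [solidSym]

theorem solidSym_of_neg {k : ℤ} (hk : k < 0) : solidSym k = 0 := by
  rw [solidSym, if_neg (not_le.mpr hk)]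

theorem coe_lie_solidSym (k : ℕ) (φ : Sym) :
    ((⁅solidSym k, φ⁆ : Sym) : RatFun) = evol (solid k) φ := by
  rw [coe_lie, solidSym_natCast, jacobi, evol_of_mem_baseField _ (solid_mem_baseField k), sub_zero]

/-- The symmetry shifts the degree of solutions by `d` with coefficients given by `a`. -/
structure HasAction (φ : Sym) (d : ℤ) (a : Polynomial ℝ) : Prop where
  isSplit : IsSplit d a
  lie_eq : ∀ k : ℤ, ⁅solidSym k, φ⁆ = a.eval (k : ℝ) • solidSym (k + d)

/-- Embeddings of the real numbers into a field. -/
abbrev RealHom (A : Type*) [Field A] : Type _ := ℝ →+* A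

/-- Real numbers as expansions. -/
def realExpansion : RealHom Expansion :=
  ((C : HahnSeries ℤ RatFun →+* Expansion).comp C).comp (algebraMap ℝ RatFun)

theorem RealHom.zero_mul {A : Type*} [Field A] (τ : RealHom A) (a : A) : τ 0 * a = 0 := by
  rw [map_zero, MulZeroClass.zero_mul]

theorem realExpansion_zero_mul (F : Expansion) : realExpansion 0 * F = 0 :=
  RealHom.zero_mul (A := Expansion) realExpansion F

theorem spec_smul (r : ℝ) (q : RatFun) : spec (r • q) = realExpansion r * spec q := by
  rw [Algebra.smul_def, spec_mul, spec_algebraMap]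
  rfl

theorem hasAction_of_spec {φ : Sym} {d : ℤ} {a : Polynomial ℝ} (ha : IsSplit d a)
    (h : ∀ k : ℕ, spec (evol (solid k) φ)
      = realExpansion (a.eval (k : ℝ)) * homSol RatFun (k + d)) : HasAction φ d a := by
  refine ⟨ha, fun k => ?_⟩
  rcases le_or_gt 0 k with hk | hk
  · obtain ⟨k, rfl⟩ := Int.eq_ofNat_of_zero_le hk
    apply Subtype.ext
    apply spec_injective
    rw [coe_lie_solidSym, h]
    rcases le_or_gt 0 (k + d) with hd | hd
    · obtain ⟨m, hm⟩ := Int.eq_ofNat_of_zero_le hd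
      rw [hm, solidSym_natCast, Submodule.coe_smul, spec_smul, spec_solid, Int.cast_natCast]
    · rw [solidSym_of_neg hd, smul_zero, ← Int.cast_natCast, ha k (Or.inl ⟨hk, hd⟩)]
      exact (realExpansion_zero_mul _).trans spec_zero.symm
  · rw [solidSym_of_neg hk, zero_lie]
    rcases le_or_gt 0 (k + d) with hd | hd
    · rw [ha k (Or.inr ⟨hk, hd⟩), zero_smul]
    · rw [solidSym_of_neg hd, smul_zero]

/-- A path from `κ` through `κ + d` to `κ + d + e` that changes sides must do so in one of its two
steps, and the factor of that step vanishes. -/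
theorem IsSplit.lie {d e : ℤ} {a b : Polynomial ℝ} (ha : IsSplit d a) (hb : IsSplit e b) :
    IsSplit (d + e) (a * b.comp (Polynomial.X + Polynomial.C (d : ℝ))
      - b * a.comp (Polynomial.X + Polynomial.C (e : ℝ))) := by
  have key {d e : ℤ} {a b : Polynomial ℝ} (ha : IsSplit d a) (hb : IsSplit e b) (κ : ℤ)
      (hκ : (0 ≤ κ ∧ κ + (d + e) < 0) ∨ (κ < 0 ∧ 0 ≤ κ + (d + e))) :
      a.eval (κ : ℝ) * b.eval ((κ + d : ℤ) : ℝ) = 0 := by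
    by_cases h : (0 ≤ κ ∧ κ + d < 0) ∨ (κ < 0 ∧ 0 ≤ κ + d)
    · rw [ha κ h, zero_mul]
    · rw [hb (κ + d) (by omega), mul_zero]
  intro κ hκ
  have h1 := key ha hb κ hκ
  have h2 := key hb ha κ (by rwa [add_comm e d])
  push_cast at h1 h2
  simp [h1, h2]

/-- By the Jacobi identity the bracket acts as a commutator of weighted shifts, `b` being evaluated
after the shift by `d` and `a` after that by `e`. -/
theorem HasAction.lie {φ ψ : Sym} {d e : ℤ} {a b : Polynomial ℝ} (hφ : HasAction φ d a)
    (hψ : HasAction ψ e b) : HasAction ⁅φ, ψ⁆ (d + e)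
      (a * b.comp (Polynomial.X + Polynomial.C (d : ℝ))
        - b * a.comp (Polynomial.X + Polynomial.C (e : ℝ))) := by
  refine ⟨hφ.isSplit.lie hψ.isSplit, fun k => ?_⟩
  rw [leibniz_lie, hφ.lie_eq, hψ.lie_eq, smul_lie, lie_smul, ← lie_skew φ, hψ.lie_eq, hφ.lie_eq,
    smul_neg, smul_smul, smul_smul, ← sub_eq_add_neg, show k + e + d = k + (d + e) by ring,
    show k + d + e = k + (d + e) by ring, ← sub_smul]
  congr 1
  simp

theorem HasAction.congr {φ : Sym} {d e : ℤ} {a b : Polynomial ℝ} (h : HasAction φ d a) (hd : d = e)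
    (hab : a = b) : HasAction φ e b := hd ▸ hab ▸ h

/-! ### The action of the explicit symmetries -/

section Explicit

variable {A : Type*} [Field A] [Algebra ℝ A] [CharZero A] (s : Substitution A)
  {X Y : Derivation ℝ A A}

theorem Substitution.evol_rho0 (hX : ∀ q, X (s q) = s (Dx q)) (hY : ∀ q, Y (s q) = s (Dy q))
    (P : RatFun) : s (evol P rho0) = -X (s P) + Y (s P) := by
  rw [rho0]
  simp only [map_add, map_neg, evol_u, evol_ux, Function.iterate_succ_apply,
    Function.iterate_zero_apply, hX, hY]

theorem Substitution.evol_rho1 (hX : ∀ q, X (s q) = s (Dx q)) (hY : ∀ q, Y (s q) = s (Dy q))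
    (P : RatFun) : s (evol P rho1) =
      1 / 2 * (s (coord .x) ^ 2 - 2 * s (coord .x) * s (coord .y) - s (coord .y) ^ 2) * X (s P)
      + 1 / 2 * (s (coord .x) ^ 2 + 2 * s (coord .x) * s (coord .y) - s (coord .y) ^ 2) * Y (s P)
      + 1 / 2 * (s (coord .x) - s (coord .y)) * s P := by
  rw [rho1]
  simp only [pow_two, Derivation.leibniz, Derivation.leibniz_div, smul_eq_mul, map_add, map_sub,
    map_mul, map_div₀, map_one, map_ofNat, Derivation.map_one_eq_zero, derivation_two, evol_x,
    evol_y, evol_u, evol_ux, Function.iterate_succ_apply, Function.iterate_zero_apply, hX, hY,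
    mul_zero, add_zero, sub_zero]

theorem Substitution.evol_rho2 (hX : ∀ q, X (s q) = s (Dx q)) (hY : ∀ q, Y (s q) = s (Dy q))
    (P : RatFun) : s (evol P rho2) =
      (s (coord .x) + s (coord .y)) * Y (Y (s P)) + (s (coord .x) - s (coord .y)) * Y (X (s P))
      + 1 / (2 * (s (coord .x) + s (coord .y)))
        * ((s (coord .x) - s (coord .y)) * X (s P) + (3 * s (coord .x) + s (coord .y)) * Y (s P)) := by
  rw [rho2]
  simp only [Derivation.leibniz, Derivation.leibniz_div, smul_eq_mul, map_add, map_sub,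
    map_mul, map_div₀, map_one, map_ofNat, Derivation.map_one_eq_zero, derivation_two,
    derivation_three, evol_x,
    evol_y, evol_u, evol_ux, Function.iterate_succ_apply, Function.iterate_zero_apply, hX, hY,
    mul_zero, add_zero, sub_zero]

theorem translation_identity {h dt : A} (dr : A) (k : ℕ) (e : dt = (k : ℤ) * h) :
    -(dr + dt) + (dr - dt) = -2 * k * h := by
  rw [e, Int.cast_natCast]
  ring

theorem raising_identity {r t h h' dr dt x y : A} {k : ℕ} (hx : x = 2⁻¹ * (r + t))
    (hy : y = 2⁻¹ * (r - t))
    (e : 2 * (r * (t * dr)) + t * (t * dt) - r * (r * dt) + t * h = ((k + 1 : ℤ) : A) * h') :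
    1 / 2 * (x ^ 2 - 2 * x * y - y ^ 2) * (dr + dt) + 1 / 2 * (x ^ 2 + 2 * x * y - y ^ 2) * (dr - dt)
      + 1 / 2 * (x - y) * h = 1 / 2 * (k + 1) * h' := by
  subst hx hy
  push_cast at e
  linear_combination e / 2

/-- On solutions the operator of `ϱ₂` reduces to `-(2 (r ∂_r + t ∂_t) + 1) ∂_t`: the equation
eliminates `∂_r`, and `h4` is Euler's identity for `H_{k-1}`. -/
theorem lowering_identity {r t h' dr dt drr drt dtt er et x y : A} {k : ℕ} (hr : r ≠ 0)
    (hx : x = 2⁻¹ * (r + t)) (hy : y = 2⁻¹ * (r - t)) (he : r * (drr + dtt) + dr = 0)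
    (h1 : dt = (k : ℤ) * h') (h2 : drt = (k : ℤ) * er)
    (h3 : dtt = (k : ℤ) * et) (h4 : r * er + t * et = ((k - 1 : ℤ) : A) * h') :
    (x + y) * ((drr - drt) - (drt - dtt)) + (x - y) * ((drr + drt) - (drt + dtt))
      + 1 / (2 * (x + y)) * ((x - y) * (dr + dt) + (3 * x + y) * (dr - dt))
      = -((2 * k - 1) * k) * h' := by
  rw [Int.cast_natCast] at h1 h2 h3
  push_cast at h4
  have hxy : x + y = r := by rw [hx, hy]; ring
  have hxy' : x - y = t := by rw [hx, hy]; ring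
  have h3x : 3 * x + y = 2 * r + t := by rw [hx, hy]; ring
  rw [hxy, hxy', h3x, h2]
  have hdr : dr = -(r * (drr + k * et)) := by rw [← h3]; linear_combination he
  rw [hdr, h1, h3]
  field_simp
  linear_combination (-2 * k * 2) * r * h4

end Explicit

/-! ### Values of the symbols in a field -/

section Values

variable {A : Type*} [Field A] (τ : RealHom A) (k : ℕ)

theorem map_eval_lowering : τ ((-2 * Polynomial.X : Polynomial ℝ).eval (k : ℝ)) = -2 * k := by
  simp [map_ofNat τ 2]

theorem map_eval_raising :
    τ ((Polynomial.C (1 / 2) * (Polynomial.X + 1) : Polynomial ℝ).eval (k : ℝ))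
      = 1 / 2 * (k + 1) := by
  simp [map_ofNat τ 2]

theorem map_eval_second :
    τ ((-((2 * Polynomial.X - 1) * Polynomial.X) : Polynomial ℝ).eval (k : ℝ))
      = -((2 * k - 1) * k) := by
  simp [map_ofNat τ 2]

end Values

section Second

variable {K : Type*} [Field K] [Algebra ℝ K] (F : HahnSeries ℤ (HahnSeries ℤ K))

theorem SDy_SDy : SDy (SDy F) = (Dr (Dr F) - Dr (Dt F)) - (Dr (Dt F) - Dt (Dt F)) := by
  simp only [SDy, Derivation.sub_apply, map_sub, Dr_Dt]

theorem SDy_SDx : SDy (SDx F) = (Dr (Dr F) + Dr (Dt F)) - (Dr (Dt F) + Dt (Dt F)) := by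
  simp only [SDx, SDy, Derivation.sub_apply, Derivation.add_apply, map_add, Dr_Dt]
  abel

end Second

theorem hasAction_symU : HasAction symU 0 1 := by
  refine ⟨fun κ hκ => by omega, fun k => ?_⟩
  rw [Polynomial.eval_one, one_smul, add_zero]
  rcases le_or_gt 0 k with hk | hk
  · obtain ⟨k, rfl⟩ := Int.eq_ofNat_of_zero_le hk
    apply Subtype.ext
    rw [coe_lie_solidSym, symU, solidSym_natCast, evol_u]
    rfl
  · rw [solidSym_of_neg hk, zero_lie]

theorem hasAction_rho0 : HasAction rho0 (-1) (-2 * Polynomial.X) := by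
  refine hasAction_of_spec (fun κ hκ => ?_) fun k => ?_
  · obtain rfl : κ = 0 := by omega
    simp
  · rw [Substitution.evol_rho0 (A := Expansion) spec spec_Dx spec_Dy, spec_solid,
      map_eval_lowering (A := Expansion)]
    exact translation_identity (A := Expansion) _ k (Dt_homSol (K := RatFun) k)

theorem hasAction_rho1 : HasAction rho1 1 (Polynomial.C (1 / 2) * (Polynomial.X + 1)) := by
  refine hasAction_of_spec (fun κ hκ => ?_) fun k => ?_
  · obtain rfl : κ = -1 := by omega
    simp
  · rw [Substitution.evol_rho1 (A := Expansion) spec spec_Dx spec_Dy, spec_solid,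
      map_eval_raising (A := Expansion), spec_coord, spec_coord]
    exact raising_identity (A := Expansion) rfl rfl (raise_homSol (K := RatFun) k)

theorem hasAction_rho2 : HasAction rho2 (-1) (-((2 * Polynomial.X - 1) * Polynomial.X)) := by
  refine hasAction_of_spec (fun κ hκ => ?_) fun k => ?_
  · obtain rfl : κ = 0 := by omega
    simp
  · rw [Substitution.evol_rho2 (A := Expansion) spec spec_Dx spec_Dy, spec_solid,
      map_eval_second (A := Expansion), spec_coord, spec_coord]
    rw [SDy_SDy, SDy_SDx]
    have h1 := Dt_homSol (K := RatFun) k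
    have h2 := derivation_intCast_mul (K := Expansion) Dr k (homSol RatFun (k - 1))
    have h3 := derivation_intCast_mul (K := Expansion) Dt k (homSol RatFun (k - 1))
    rw [← h1] at h2 h3
    have h4 := euler_homSol (K := RatFun) (k - 1)
    exact lowering_identity (A := Expansion) serR_ne_zero rfl rfl (homSol_equation _) h1 h2 h3 h4

end
end EulerDarboux

/-! ### Symbols of the iterated brackets and their leading coefficients. -/

namespace EulerDarboux
noncomputable section

open Polynomial

/-! ### Iterated brackets -/

/-- To leading order the difference operator `(X + 1) (B(X + 1) - B(X))` agrees with `X d/dX`; on a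
monomial this is the binomial formula. -/
theorem coeff_X_add_one_mul_comp_sub (B : ℝ[X]) {k : ℕ} (h : B.natDegree ≤ k) :
    ((X + 1) * B.comp (X + 1) - (X + 1) * B).coeff k = k * B.coeff k := by
  refine induction_with_natDegree_le
    (fun B : ℝ[X] => ((X + 1) * B.comp (X + 1) - (X + 1) * B).coeff k = k * B.coeff k) k
    (by simp) (fun i a _ hi => ?_) (fun p q _ _ hp hq => ?_) B h
  · have e : (X + 1) * (C a * X ^ i).comp (X + 1) - (X + 1) * (C a * X ^ i)
        = C a * ((X + 1) ^ (i + 1) - X ^ (i + 1) - X ^ i) := by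
      simp only [mul_comp, C_comp, pow_comp, X_comp]
      ring
    rw [e, coeff_C_mul, coeff_sub, coeff_sub, coeff_X_add_one_pow, coeff_X_pow, coeff_C_mul,
      coeff_X_pow]
    rcases lt_trichotomy k (i + 1) with hk | rfl | hk
    · obtain rfl : k = i := by omega
      simp
      ring
    · simp
    · rw [Nat.choose_eq_zero_of_lt hk, if_neg (by omega), if_neg (by omega)]
      simp
  · have e : (X + 1) * (p + q).comp (X + 1) - (X + 1) * (p + q)
        = ((X + 1) * p.comp (X + 1) - (X + 1) * p) + ((X + 1) * q.comp (X + 1) - (X + 1) * q) := by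
      rw [add_comp]
      ring
    rw [e, coeff_add, hp, hq, coeff_add, mul_add]

/-- The symbol of the bracket with the raising symmetry. -/
theorem raising_symbol (B : ℝ[X]) (d : ℤ) {j : ℕ} (h : B.natDegree ≤ j) :
    (B * (C (1 / 2 : ℝ) * (X + 1)).comp (X + C (d : ℝ))
      - C (1 / 2 : ℝ) * (X + 1) * B.comp (X + C ((1 : ℤ) : ℝ))).natDegree ≤ j ∧
    (B * (C (1 / 2 : ℝ) * (X + 1)).comp (X + C (d : ℝ))
      - C (1 / 2 : ℝ) * (X + 1) * B.comp (X + C ((1 : ℤ) : ℝ))).coeff j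
        = (d - j) / 2 * B.coeff j := by
  have e : B * (C (1 / 2 : ℝ) * (X + 1)).comp (X + C (d : ℝ))
      - C (1 / 2 : ℝ) * (X + 1) * B.comp (X + C ((1 : ℤ) : ℝ))
      = C (1 / 2) * (C (d : ℝ) * B - ((X + 1) * B.comp (X + 1) - (X + 1) * B)) := by
    simp only [mul_comp, C_comp, add_comp, X_comp, one_comp, Int.cast_one, C_1]
    ring
  have hc (k : ℕ) (hk : j ≤ k) :
      (B * (C (1 / 2 : ℝ) * (X + 1)).comp (X + C (d : ℝ))
        - C (1 / 2 : ℝ) * (X + 1) * B.comp (X + C ((1 : ℤ) : ℝ))).coeff k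
        = (d - k) / 2 * B.coeff k := by
    rw [e, coeff_C_mul, coeff_sub, coeff_C_mul, coeff_X_add_one_mul_comp_sub B (h.trans hk)]
    ring
  refine ⟨?_, hc j le_rfl⟩
  rw [natDegree_le_iff_coeff_eq_zero]
  intro k hk
  rw [hc k hk.le, coeff_eq_zero_of_natDegree_lt (h.trans_lt hk), mul_zero]

/-- The shift `-(i + 1)` forces the roots `0, …, i`, which for degree `i + 1` leaves only multiples
of the falling factorial. -/
theorem hasAction_iterate_rho2 (i : ℕ) : ∃ α : ℝ, α ≠ 0 ∧
    HasAction ((fun φ => ⁅φ, rho2⁆)^[i] rho0) (-(i + 1)) (C α * descPochhammer ℝ (i + 1)) := by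
  induction i with
  | zero =>
    refine ⟨-2, by norm_num, ?_⟩
    refine hasAction_rho0.congr (by simp) ?_
    simp [descPochhammer, map_ofNat C 2]
  | succ i ih =>
    obtain ⟨α, hα, h⟩ := ih
    refine ⟨α * (2 * (i + 1)), by positivity, ?_⟩
    rw [Function.iterate_succ_apply']
    refine (h.lie hasAction_rho2).congr (by push_cast; ring) ?_
    -- Both terms of the commutator contain the next falling factorial, one by splitting off its
    -- last factor and the other its first; the remaining factors `-(2 X - 2 i - 3)` and `2 X - 1`
    -- add up to the constant `2 (i + 1)`.
    have h1 : descPochhammer ℝ (i + 1 + 1) = descPochhammer ℝ (i + 1) * (X - ((i + 1 : ℕ) : ℝ[X])) :=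
      descPochhammer_succ_right ℝ (i + 1)
    have h2 : descPochhammer ℝ (i + 1 + 1) = X * (descPochhammer ℝ (i + 1)).comp (X - 1) :=
      descPochhammer_succ_left ℝ (i + 1)
    have h3 : (X + C ((-1 : ℤ) : ℝ) : ℝ[X]) = X - 1 := by
      simp [sub_eq_add_neg]
    rw [h3]
    simp only [mul_comp, C_comp, neg_comp, sub_comp, X_comp, one_comp, ofNat_comp]
    push_cast at h1 ⊢
    simp only [map_neg, map_add, map_mul, map_one, map_natCast, map_ofNat] 
    linear_combination C α * (2 * X - 2 * (i : ℝ[X]) - 3) * h1 - C α * (2 * X - 1) * h2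

/-- With `j = i + 1`, the `m`-th bracket with `ϱ₁` multiplies the coefficient at `j` by `((m - 1 -
j) - j) / 2`. This factor first vanishes for `m = 2 j + 1`. -/
theorem hasAction_rho (i m : ℕ) : ∃ B : ℝ[X], HasAction (rho (i + 1) m) (m - (i + 1)) B ∧
    B.natDegree ≤ i + 1 ∧ (m ≤ 2 * (i + 1) → B.coeff (i + 1) ≠ 0) := by
  induction m with
  | zero =>
    obtain ⟨α, hα, h⟩ := hasAction_iterate_rho2 i
    refine ⟨_, h.congr (by simp) rfl, ?_, fun _ => ?_⟩
    · exact (natDegree_C_mul_le _ _).trans (descPochhammer_natDegree _ _).le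
    · have := (monic_descPochhammer ℝ (i + 1)).coeff_natDegree
      rw [descPochhammer_natDegree] at this
      rw [coeff_C_mul, this, mul_one]
      exact hα
  | succ m ih =>
    obtain ⟨B, h, hB, hc⟩ := ih
    have hr := raising_symbol B (m - (i + 1)) hB
    have hrho : rho (i + 1) (m + 1) = ⁅rho (i + 1) m, rho1⁆ := Function.iterate_succ_apply' _ _ _
    refine ⟨_, ?_, hr.1, fun hm => ?_⟩
    · rw [hrho]
      exact (h.lie hasAction_rho1).congr (by push_cast; ring) rfl
    · rw [hr.2]
      refine mul_ne_zero ?_ (hc (by omega))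
      have : ((m - (i + 1) : ℤ) - (i + 1) : ℤ) ≠ 0 := by omega
      have h' : (((m - (i + 1) : ℤ) - (i + 1) : ℤ) : ℝ) ≠ 0 := by exact_mod_cast this
      push_cast at h' ⊢
      exact div_ne_zero h' two_ne_zero

theorem mem_baseField_of_hasAction_zero {φ : Sym} {d : ℤ} (h : HasAction φ d 0) :
    (φ : RatFun) ∈ baseField := by
  refine mem_baseField_of_evol_solid fun k => ?_
  rw [← coe_lie_solidSym, h.lie_eq, eval_zero, zero_smul, ZeroMemClass.coe_zero]

/-! ### Homogeneity in the jet coordinates -/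

theorem evol_u_u (k : ℕ) : evol (coord (.u 0)) (coord (.u k)) = coord (.u k) := by
  rw [evol_u]
  induction k with
  | zero => rfl
  | succ k ih => rw [Function.iterate_succ_apply', ih, Dy_u]

theorem evol_u_ux (k : ℕ) : evol (coord (.u 0)) (coord (.ux k)) = coord (.ux k) := by
  rw [evol_ux, Dx_u]
  induction k with
  | zero => rfl
  | succ k ih => rw [Function.iterate_succ_apply', ih, Dy_ux]

/-- The field `evol (coord (.u 0))` is the Euler field in the jets, so commuting with `symU` means
homogeneity of degree one in the jets, a property preserved by brackets. -/
theorem coe_lie_symU (φ : Sym) :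
    ((⁅φ, symU⁆ : Sym) : RatFun) = φ - evol (coord (.u 0)) (φ : RatFun) := by
  rw [coe_lie, jacobi, symU, evol_u, Function.iterate_zero_apply]

theorem lie_rho0_symU : ⁅rho0, symU⁆ = 0 := by
  apply Subtype.ext
  rw [coe_lie_symU, rho0]
  simp only [map_add, map_neg, evol_u_u, evol_u_ux, sub_self, ZeroMemClass.coe_zero]

theorem lie_rho1_symU : ⁅rho1, symU⁆ = 0 := by
  apply Subtype.ext
  rw [coe_lie_symU, rho1]
  simp only [pow_two, Derivation.leibniz, Derivation.leibniz_div, smul_eq_mul, map_add, map_sub,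
    Derivation.map_one_eq_zero, derivation_two, evol_x, evol_y, evol_u_u, evol_u_ux,
    mul_zero, add_zero, sub_zero, ZeroMemClass.coe_zero]
  ring

theorem lie_rho2_symU : ⁅rho2, symU⁆ = 0 := by
  apply Subtype.ext
  rw [coe_lie_symU, rho2]
  simp only [Derivation.leibniz, Derivation.leibniz_div, smul_eq_mul, map_add, map_sub,
    Derivation.map_one_eq_zero, derivation_two, derivation_three, evol_x, evol_y, evol_u_u,
    evol_u_ux, mul_zero, add_zero, sub_zero, ZeroMemClass.coe_zero]
  ring

theorem lie_lie_symU {φ ψ : Sym} (hφ : ⁅φ, symU⁆ = 0) (hψ : ⁅ψ, symU⁆ = 0) :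
    ⁅⁅φ, ψ⁆, symU⁆ = 0 := by
  rw [lie_lie, hφ, hψ, lie_zero, lie_zero, sub_zero]

theorem lie_rho_symU (j m : ℕ) : ⁅rho j m, symU⁆ = 0 := by
  have h1 (i : ℕ) : ⁅((fun φ => ⁅φ, rho2⁆)^[i] rho0 : Sym), symU⁆ = 0 := by
    induction i with
    | zero => exact lie_rho0_symU
    | succ i ih => rw [Function.iterate_succ_apply']; exact lie_lie_symU ih lie_rho2_symU
  induction m with
  | zero => exact h1 (j - 1)
  | succ m ih =>
    rw [rho, Function.iterate_succ_apply']
    exact lie_lie_symU ih lie_rho1_symU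

theorem eq_zero_of_mem_baseField {φ : Sym} (h : (φ : RatFun) ∈ baseField) (hu : ⁅φ, symU⁆ = 0) :
    φ = 0 := by
  have := coe_lie_symU φ
  rw [hu, evol_of_mem_baseField _ h, sub_zero] at this
  exact Subtype.ext this.symm

/-- The shift `m - j` exceeds `j`, which bounds the degree of the symbol, so the symbol vanishes.
What remains is a function of `x`, `y`, and homogeneity of degree one in the jets makes it zero. -/
theorem rho_eq_zero {j m : ℕ} (hj : 1 ≤ j) (hm : 2 * j < m) : rho j m = 0 := by
  obtain ⟨i, rfl⟩ : ∃ i, j = i + 1 := ⟨j - 1, by omega⟩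
  obtain ⟨B, h, hB, -⟩ := hasAction_rho i m
  have hB0 : B = 0 := h.isSplit.eq_zero (by omega)
  subst hB0
  exact eq_zero_of_mem_baseField (mem_baseField_of_hasAction_zero h) (lie_rho_symU _ _)

end
end EulerDarboux

/-! ### The quotient by solutions and its basis. -/

namespace EulerDarboux
noncomputable section

open Polynomial

/-! ### Symbols determine symmetries up to solutions -/

theorem coeff_coeff_realExpansion_mul (r : ℝ) (F : Expansion) (n i : ℤ) :
    ((realExpansion r * F).coeff n).coeff i = r • (F.coeff n).coeff i := by
  change ((HahnSeries.C (HahnSeries.C (algebraMap ℝ RatFun r)) * F).coeff n).coeff i = _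
  rw [HahnSeries.C_apply (HahnSeries.C _), HahnSeries.coeff_single_zero_mul, HahnSeries.C_apply,
    HahnSeries.coeff_single_zero_mul, Algebra.smul_def]

/-- The symbol as a linear function of the symmetry. -/
def symbolMap (j : ℤ) (k : ℕ) : Sym →ₗ[ℝ] RatFun where
  toFun φ := symbol φ j k
  map_add' φ ψ := by
    rw [symbol, Submodule.coe_add, map_add, spec_add, HahnSeries.coeff_add, HahnSeries.coeff_add]
    rfl
  map_smul' r φ := by
    rw [symbol, Submodule.coe_smul, Derivation.map_smul, spec_smul, coeff_coeff_realExpansion_mul]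
    rfl

theorem symbolMap_apply (j : ℤ) (k : ℕ) (φ : Sym) : symbolMap j k φ = symbol φ j k := rfl

theorem HasAction.symbolMap_eq {φ : Sym} {d : ℤ} {a : ℝ[X]} (h : HasAction φ d a) (j : ℤ) (k : ℕ) :
    symbolMap j k φ = if j = d then algebraMap ℝ RatFun (a.eval (k : ℝ)) else 0 := by
  have h1 := h.lie_eq k
  rw [symbolMap_apply, symbol, ← coe_lie_solidSym, h1, Int.cast_natCast, Submodule.coe_smul,
    spec_smul, coeff_coeff_realExpansion_mul, Algebra.smul_def]
  rcases le_or_gt 0 (k + d) with hd | hd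
  · obtain ⟨m, hm⟩ := Int.eq_ofNat_of_zero_le hd
    rw [hm, solidSym_natCast, spec_solid, homSol]
    split_ifs with hj
    · rw [hj, hm, HahnSeries.coeff_single_same, coeff_axial, axialCoeff_zero, mul_one]
    · rw [HahnSeries.coeff_single_of_ne (by omega), HahnSeries.coeff_zero, mul_zero]
  · have := h.isSplit k (Or.inl ⟨by omega, hd⟩)
    rw [Int.cast_natCast] at this
    rw [this, map_zero, zero_mul, ite_self]

theorem mem_baseField_of_symbolMap {φ : Sym} (h : ∀ j k, symbolMap j k φ = 0) :
    (φ : RatFun) ∈ baseField := by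
  refine mem_baseField_of_evol_solid fun k => ?_
  apply spec_injective
  rw [spec_zero]
  apply ext_coeff
  intro n i
  have h1 := coeff_spec_evol φ.2 (n - k) k
  rw [← symbolMap_apply, h, map_zero, zero_mul, add_sub_cancel] at h1
  rw [h1, HahnSeries.coeff_zero, HahnSeries.coeff_zero, HahnSeries.coeff_zero]

theorem symbolMap_of_mem_baseField {φ : Sym} (h : (φ : RatFun) ∈ baseField) (j : ℤ) (k : ℕ) :
    symbolMap j k φ = 0 := by
  rw [symbolMap_apply, symbol, evol_of_mem_baseField _ h, spec_zero, HahnSeries.coeff_zero,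
    HahnSeries.coeff_zero]

theorem HasAction.zero (d : ℤ) : HasAction 0 d 0 :=
  ⟨fun κ _ => eval_zero, fun k => by rw [lie_zero, eval_zero, zero_smul]⟩

theorem HasAction.add {φ ψ : Sym} {d : ℤ} {a b : ℝ[X]} (hφ : HasAction φ d a)
    (hψ : HasAction ψ d b) : HasAction (φ + ψ) d (a + b) :=
  ⟨fun κ hκ => by rw [eval_add, hφ.isSplit κ hκ, hψ.isSplit κ hκ, add_zero],
    fun k => by rw [lie_add, hφ.lie_eq, hψ.lie_eq, eval_add, add_smul]⟩

theorem HasAction.smul {φ : Sym} {d : ℤ} {a : ℝ[X]} (r : ℝ) (hφ : HasAction φ d a) :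
    HasAction (r • φ) d (C r * a) :=
  ⟨fun κ hκ => by rw [eval_mul, hφ.isSplit κ hκ, mul_zero],
    fun k => by rw [lie_smul, hφ.lie_eq, eval_mul, eval_C, mul_smul]⟩

/-! ### The basis -/

/-- Indices of the basis. -/
abbrev BasisIndex : Type := Option {p : ℕ × ℕ // 1 ≤ p.1 ∧ p.2 ≤ 2 * p.1}

/-- Representatives of the basis. -/
def basisSym : BasisIndex → Sym
  | none => symU
  | some p => rho p.1.1 p.1.2

/-- The degree of the symbol of a representative. -/
def basisDegree : BasisIndex → ℕ
  | none => 0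
  | some p => p.1.1

/-- The shift of the degree of solutions under a representative. -/
def basisShift : BasisIndex → ℤ
  | none => 0
  | some p => p.1.2 - p.1.1

theorem exists_basisPoly (i : BasisIndex) : ∃ B : ℝ[X], HasAction (basisSym i) (basisShift i) B ∧
    B.natDegree ≤ basisDegree i ∧ B.coeff (basisDegree i) ≠ 0 := by
  rcases i with _ | ⟨⟨j, m⟩, hj, hm⟩
  · exact ⟨1, hasAction_symU, by simp, by simp [basisDegree]⟩
  · obtain ⟨i, rfl⟩ : ∃ i, j = i + 1 := ⟨j - 1, by simp only at hj; omega⟩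
    obtain ⟨B, h, hB, hc⟩ := hasAction_rho i m
    exact ⟨B, h.congr (by simp [basisShift]) rfl, hB, hc hm⟩

theorem basisIndex_ext {i i' : BasisIndex} (hd : basisDegree i = basisDegree i')
    (hs : basisShift i = basisShift i') : i = i' := by
  rcases i with _ | ⟨⟨j, m⟩, hj, hm⟩ <;> rcases i' with _ | ⟨⟨j', m'⟩, hj', hm'⟩ <;>
    simp only [basisDegree, basisShift] at hd hs
  · rfl
  · simp only at hj'
    omega
  · simp only at hj
    omega
  · obtain rfl := hd
    obtain rfl : m = m' := by omega
    rfl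

/-- Shift `d` and degree `j` determine `m = j + d`, and `0 ≤ m ≤ 2 j` is the same as `|d| ≤ j`; the
symmetry `u` accounts for `j = 0`. -/
theorem exists_basisIndex {d : ℤ} {j : ℕ} (h : d.natAbs ≤ j) :
    ∃ i, basisDegree i = j ∧ basisShift i = d := by
  rcases Nat.eq_zero_or_pos j with rfl | hj
  · exact ⟨none, rfl, by simp only [basisShift]; omega⟩
  · exact ⟨some ⟨(j, (j + d).toNat), hj, by simp only; omega⟩, rfl,
      by simp only [basisShift]; omega⟩

/-- Every split symbol is the symbol of a combination of the representatives. -/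
theorem exists_mem_span_hasAction {d : ℤ} {p : ℝ[X]} (hp : IsSplit d p) :
    ∃ v ∈ Submodule.span ℝ (Set.range basisSym), HasAction v d p := by
  have key : ∀ (N : ℕ) (p : ℝ[X]), IsSplit d p → (∀ k, N ≤ k → p.coeff k = 0) →
      ∃ v ∈ Submodule.span ℝ (Set.range basisSym), HasAction v d p := by
    intro N
    induction N with
    | zero =>
      intro p _ h0
      obtain rfl : p = 0 := by
        ext k
        exact h0 k (Nat.zero_le k)
      exact ⟨0, zero_mem _, HasAction.zero d⟩
    | succ N ih =>
      intro p hp h0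
      by_cases hN : p.coeff N = 0
      · refine ih p hp fun k hk => ?_
        rcases hk.eq_or_lt with rfl | hk
        · exact hN
        · exact h0 k hk
      · have hdeg : N ≤ p.natDegree := le_natDegree_of_ne_zero hN
        have hdeg' : p.natDegree ≤ N := natDegree_le_iff_coeff_eq_zero.mpr fun k hk => h0 k hk
        -- A nonzero split polynomial has degree at least `|d|`, so a representative of degree
        -- exactly `N` exists, and a multiple of it removes the leading term.
        have hd : d.natAbs ≤ N := by
          by_contra hlt
          rw [hp.eq_zero (by omega)] at hN
          exact hN (coeff_zero N)
        obtain ⟨i, hi, hs⟩ := exists_basisIndex hd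
        obtain ⟨B, hB, hBd, hBc⟩ := exists_basisPoly i
        rw [hi] at hBd hBc
        rw [hs] at hB
        set r := p.coeff N / B.coeff N with hr
        have hq : IsSplit d (p - C r * B) := fun κ hκ => by
          rw [eval_sub, eval_mul, hp κ hκ, hB.isSplit κ hκ, mul_zero, sub_zero]
        obtain ⟨v, hv, hva⟩ := ih (p - C r * B) hq fun k hk => by
          rw [coeff_sub, coeff_C_mul]
          rcases hk.eq_or_lt with rfl | hk
          · rw [hr, div_mul_cancel₀ _ hBc, sub_self]
          · rw [h0 k hk, coeff_eq_zero_of_natDegree_lt (hBd.trans_lt hk), mul_zero, sub_zero]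
        exact ⟨v + r • basisSym i, add_mem hv (Submodule.smul_mem _ _
          (Submodule.subset_span ⟨i, rfl⟩)), (hva.add (hB.smul r)).congr rfl (by ring)⟩
  exact key (p.natDegree + 1) p hp fun k hk => coeff_eq_zero_of_natDegree_lt (by omega)

/-- The order `n` bounds the degrees of all symbols, hence only shifts with `|j| ≤ n` occur and the
sum of the matching combinations is finite. -/
theorem exists_mem_span_sub_mem_baseField (φ : Sym) :
    ∃ v ∈ Submodule.span ℝ (Set.range basisSym), ((φ - v : Sym) : RatFun) ∈ baseField := by
  obtain ⟨n, hn⟩ := exists_orderLE (φ : RatFun)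
  choose p hdeg hsplit hp using exists_symbol_polynomial φ.2 hn
  choose v hv hva using fun j => exists_mem_span_hasAction (hsplit j)
  refine ⟨∑ j ∈ Finset.Icc (-n : ℤ) n, v j, sum_mem fun j _ => hv j, ?_⟩
  refine mem_baseField_of_symbolMap fun j k => ?_
  rw [map_sub, map_sum, symbolMap_apply, hp]
  simp only [(hva _).symbolMap_eq, Finset.sum_ite_eq]
  split_ifs with hj
  · exact sub_self _
  · rw [(hsplit j).eq_zero ((hdeg j).trans_lt (by rw [Finset.mem_Icc] at hj; omega)), eval_zero,
      map_zero, sub_zero]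

/-- Different shifts are separated by the symbols. Within one shift the symbols have pairwise
different degrees, so the largest degree occurring with nonzero coefficient gives a contradiction.
-/
theorem eq_zero_of_sum_basisSym_mem_baseField {s : Finset BasisIndex} {g : BasisIndex → ℝ}
    (h : ((∑ i ∈ s, g i • basisSym i : Sym) : RatFun) ∈ baseField) {i : BasisIndex} (hi : i ∈ s) :
    g i = 0 := by
  choose B hB hBd hBc using exists_basisPoly
  by_contra hg
  have hQ (d : ℤ) : ∑ i ∈ s with basisShift i = d, C (g i) * B i = 0 := by
    apply polynomial_eq_zero_of_eval_nat _ 0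
    intro k _
    apply (algebraMap ℝ RatFun).injective
    have h1 := symbolMap_of_mem_baseField h d k
    rw [map_sum] at h1
    simp only [map_smul, (hB _).symbolMap_eq] at h1
    rw [eval_finsetSum, map_zero, map_sum, Finset.sum_filter]
    refine Eq.trans ?_ h1
    refine Finset.sum_congr rfl fun i _ => ?_
    by_cases hd : d = basisShift i
    · rw [if_pos hd.symm, if_pos hd, eval_mul, eval_C, map_mul, Algebra.smul_def]
    · rw [if_neg (Ne.symm hd), if_neg hd, smul_zero]
  obtain ⟨m, hm, hmax⟩ := Finset.exists_max_image
    (s.filter fun l => basisShift l = basisShift i ∧ g l ≠ 0) basisDegree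
    ⟨i, by simp [hi, hg]⟩
  rw [Finset.mem_filter] at hm
  have h1 := congrArg (fun q => q.coeff (basisDegree m)) (hQ (basisShift i))
  simp only [finsetSum_coeff, coeff_C_mul, coeff_zero] at h1
  rw [Finset.sum_eq_single m] at h1
  · exact mul_ne_zero hm.2.2 (hBc m) h1
  · intro l hl hlm
    rw [Finset.mem_filter] at hl
    by_cases hgl : g l = 0
    · rw [hgl, zero_mul]
    · have hle := hmax l (Finset.mem_filter.mpr ⟨hl.1, hl.2, hgl⟩)
      have hne : basisDegree l ≠ basisDegree m := fun e =>
        hlm (basisIndex_ext e (hl.2.trans hm.2.1.symm))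
      rw [coeff_eq_zero_of_natDegree_lt ((hBd l).trans_lt (by omega)), mul_zero]
  · intro hm'
    exact absurd (Finset.mem_filter.mpr ⟨hm.1, hm.2.1⟩) hm'

/-! ### The quotient by solutions -/

theorem mem_solutions {φ : Sym} : φ ∈ solutions ↔ (φ : RatFun) ∈ baseField := Iff.rfl

/-- The bracket of a symmetry with a solution is, up to sign, the variation of the symmetry along
this solution, a function of `x`, `y`; so the solutions are already closed under brackets with
symmetries. -/
theorem coe_solutionIdeal : (solutionIdeal : Set Sym) = (solutions : Set Sym) := by
  let I : LieIdeal ℝ Sym :=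
    { solutions with
      lie_mem := by
        intro φ f hf
        change ((⁅φ, f⁆ : Sym) : RatFun) ∈ baseField
        rw [coe_lie, jacobi, evol_of_mem_baseField _ (mem_solutions.mp hf), zero_sub]
        exact neg_mem (evol_mem_baseField φ.2 hf) }
  apply Set.Subset.antisymm
  · have : solutionIdeal ≤ I := LieSubmodule.lieSpan_le.mpr fun φ hφ => hφ
    exact fun φ hφ => this hφ
  · exact LieSubmodule.subset_lieSpan

theorem mem_solutionIdeal {φ : Sym} : φ ∈ solutionIdeal ↔ (φ : RatFun) ∈ baseField := by
  rw [← mem_solutions, ← SetLike.mem_coe, coe_solutionIdeal, SetLike.mem_coe]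

/-- The class of a symmetry as a linear map. -/
def clsMap : Sym →ₗ[ℝ] NSym := (LieSubmodule.Quotient.mk' solutionIdeal : Sym →ₗ[ℝ] NSym)

theorem clsMap_apply (φ : Sym) : clsMap φ = cls φ := rfl

theorem clsMap_eq_zero_iff {φ : Sym} : clsMap φ = 0 ↔ (φ : RatFun) ∈ baseField := by
  rw [← mem_solutionIdeal]
  exact LieSubmodule.Quotient.mk_eq_zero'

theorem cls_surjective (z : NSym) : ∃ φ, cls φ = z := LieSubmodule.Quotient.surjective_mk' _ z

theorem cls_lie (φ ψ : Sym) : cls ⁅φ, ψ⁆ = ⁅cls φ, cls ψ⁆ := rfl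

theorem linearIndependent_cls : LinearIndependent ℝ fun i => cls (basisSym i) := by
  rw [linearIndependent_iff']
  intro s g h i hi
  refine eq_zero_of_sum_basisSym_mem_baseField (s := s) ?_ hi
  rw [← clsMap_eq_zero_iff, map_sum, ← h]
  exact Finset.sum_congr rfl fun i _ => by rw [map_smul, clsMap_apply]

theorem top_le_span_cls : ⊤ ≤ Submodule.span ℝ (Set.range fun i => cls (basisSym i)) := by
  rintro z -
  obtain ⟨φ, rfl⟩ := cls_surjective z
  obtain ⟨v, hv, hφ⟩ := exists_mem_span_sub_mem_baseField φ
  have h1 : cls φ = clsMap v := by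
    rw [← clsMap_eq_zero_iff, map_sub, sub_eq_zero] at hφ
    exact hφ
  rw [h1, show (Set.range fun i => cls (basisSym i)) = clsMap '' Set.range basisSym by
    rw [← Set.range_comp]; rfl, Submodule.span_image]
  exact Submodule.mem_map_of_mem hv

/-- The basis of the algebra of rational symmetries up to solutions. -/
def basis : Module.Basis BasisIndex ℝ NSym := Module.Basis.mk linearIndependent_cls top_le_span_cls

theorem basis_apply (i : BasisIndex) : basis i = cls (basisSym i) := Module.Basis.mk_apply _ _ _

instance : Infinite BasisIndex :=
  Infinite.of_injective (fun k : ℕ => some ⟨(k + 1, 0), by simp⟩) fun k l h => by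
    simpa using h

theorem lieSpan_generators : LieSubalgebra.lieSpan ℝ NSym
    {cls symU, cls rho0, cls rho1, cls rho2} = ⊤ := by
  set G := LieSubalgebra.lieSpan ℝ NSym {cls symU, cls rho0, cls rho1, cls rho2} with hG
  have hsub : {cls symU, cls rho0, cls rho1, cls rho2} ⊆ (G : Set NSym) :=
    LieSubalgebra.subset_lieSpan
  have hu : cls symU ∈ G := hsub (by simp)
  have h0 : cls rho0 ∈ G := hsub (by simp)
  have h1 : cls rho1 ∈ G := hsub (by simp)
  have h2 : cls rho2 ∈ G := hsub (by simp)
  have hi (i : ℕ) : cls ((fun φ => ⁅φ, rho2⁆)^[i] rho0) ∈ G := by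
    induction i with
    | zero => exact h0
    | succ i ih =>
      rw [Function.iterate_succ_apply', cls_lie]
      exact G.lie_mem ih h2
  have hrho (j m : ℕ) : cls (rho j m) ∈ G := by
    induction m with
    | zero => exact hi (j - 1)
    | succ m ih =>
      rw [rho, Function.iterate_succ_apply', cls_lie]
      exact G.lie_mem ih h1
  have htop : ⊤ ≤ G.toSubmodule := by
    rw [← basis.span_eq, Submodule.span_le]
    rintro _ ⟨i, rfl⟩
    rw [basis_apply]
    rcases i with _ | p
    · exact hu
    · exact hrho _ _
  rw [eq_top_iff]
  exact fun z _ => htop Submodule.mem_top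

end
end EulerDarboux

theorem mainTheorem4 :
    -- the rational solutions form an ideal of the Lie algebra of rational symmetries,
    -- so that the algebra `NSym` is the quotient by the solutions
    (EulerDarboux.solutionIdeal : Set EulerDarboux.Sym)
      = (EulerDarboux.solutions : Set EulerDarboux.Sym) ∧
    -- infinite dimensional as a vector space
    ¬ Module.Finite ℝ EulerDarboux.NSym ∧
    -- finitely generated as a Lie algebra
    (∃ S : Finset EulerDarboux.NSym,
      LieSubalgebra.lieSpan ℝ EulerDarboux.NSym (S : Set EulerDarboux.NSym) = ⊤) ∧
    -- the brackets with `m > 2 j` vanish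
    (∀ j m : ℕ, 1 ≤ j → 2 * j < m → EulerDarboux.rho j m = 0) ∧
    -- the remaining ones form, together with `u`, a linear basis
    (∃ b : Module.Basis (Option {p : ℕ × ℕ // 1 ≤ p.1 ∧ p.2 ≤ 2 * p.1}) ℝ EulerDarboux.NSym,
      b none = EulerDarboux.cls EulerDarboux.symU ∧
      ∀ p, b (some p) = EulerDarboux.cls (EulerDarboux.rho p.1.1 p.1.2)) := by
  classical
  refine ⟨EulerDarboux.coe_solutionIdeal, fun h => ?_, ⟨{EulerDarboux.cls EulerDarboux.symU,
    EulerDarboux.cls EulerDarboux.rho0, EulerDarboux.cls EulerDarboux.rho1,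
    EulerDarboux.cls EulerDarboux.rho2}, ?_⟩, fun j m => EulerDarboux.rho_eq_zero,
    EulerDarboux.basis, EulerDarboux.basis_apply none,
    fun p => EulerDarboux.basis_apply (some p)⟩
  · have := Module.Finite.finite_basis EulerDarboux.basis
    exact not_finite EulerDarboux.BasisIndex
  · simpa using EulerDarboux.lieSpan_generators
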